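/- **Setting.** Let $d\ge 1$, let $\Omega\subset\mathbb R^d$ be a bounded domain (connected open set) with Lipschitz boundary, and let $\delta_0>0$. For $\rho>0$ put $\Omega_I=\{y\notin\Omega:\ |y-x|<\rho\text{ for some }x\in\Omega\}$ and $\overline\Omega=\Omega\cup\Omega_I$ (both depend on $\rho$), with $\rho=\delta$ for the Poisson model and $\rho=2\delta$ for the LPS model, $0<\delta\le\delta_0$. For every $\delta$ let $\Omega_I=\Omega_{nloc}\cup\Omega_{loc}$ be a partition into disjoint measurable sets, and $\Gamma_{loc}=\partial\Omega_{loc}\cap\partial\overline\Omega$, $\Gamma_{nloc}=\partial\Omega_{nloc}\cap\partial\overline\Omega$. The data, the solutions and the partition may depend on $\delta$. We write $\|\cdot\|_0$ for the norm of $L^2(\overline\Omega)$. We say that $\Omega_{nloc}$ *contains a fixed patch* if there are $x_0\in\partial\Omega$ and $r>0$, independent of $\delta$, with $\Omega_I\cap B_r(x_0)\subset\Omega_{nloc}$ for all $\delta\in(0,\delta_0]$. **Poisson model.** Let $\gamma=\gamma_\delta(x,y)\ge 0$ be measurable symmetric kernels such that, for $x\in\Omega$, $\gamma(x,y)>0$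 if $|y-x|<\delta$ and $\gamma(x,y)=0$ otherwise; for each $\delta$ there are $\gamma_1,\gamma_2>0$ with $\gamma_1\le\int_{\overline\Omega}\gamma(x,y)\,dy$ for $x\in\Omega$ and $\int_{\overline\Omega}\gamma(x,y)^2\,dy\le\gamma_2^2$ for $x\in\overline\Omega$; and $\gamma$ is properly scaled: for all indices, uniformly in $x\in\Omega$ and $\delta\in(0,\delta_0]$, with $z=y-x$, $$\int z_i\,\gamma\,dy=O(\delta^2),\qquad \int z_iz_j\,\gamma\,dy=\delta_{ij}+O(\delta^2),\qquad \int z_iz_jz_k\,\gamma\,dy=O(\delta^2).$$ Let $$\mathcal L u(x)=2\int_{\mathbb R^d}(u(y)-u(x))\gamma(x,y)\,dy,\qquad \mathcal N u(x)=-\int_{\overline\Omega}(u(y)-u(x))\gamma(x,y)\,dy,$$ $$|||v|||^2=\int_{\overline\Omega}\int_{\overline\Omega}(v(y)-v(x))^2\gamma(x,y)\,dy\,dx,$$ let $V=\{v\in L^2(\overline\Omega):|||v|||<\infty\}$ and $V_\Lambda=\{v\in V:\ v=0\text{ on }\Lambda\}$. Let $u_l\in C^4(\overline\Omega)$, with derivatives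 of order at most $4$ bounded on $\overline\Omega$ uniformly in $\delta$, solve $$-\Delta u_l=s\ \text{in }\overline\Omega,\qquad u_l=w_l\ \text{on }\Gamma_{loc},\qquad u_l=v_n\ \text{on }\Gamma_{nloc},$$ and let $v_n$ be compatible with $u_l$, that is, $v_n=u_l$ a.e. in $\Omega_{nloc}$. Let $u_n\in V$ satisfy (a.e.) $-\mathcal L u_n=s$ in $\Omega$, $u_n=v_n$ in $\Omega_{nloc}$, and * (DtD) $u_n=u_l$ in $\Omega_{loc}$, or * (DtN) $-\mathcal N u_n=-\mathcal N u_l$ in $\Omega_{loc}$. Then $\|u_n-u_l\|_0=O(\delta^2)$ as $\delta\to0$: for DtD without further assumption; for DtN if the kernels satisfy the nonlocal Poincaré inequality $\|v\|_0\le C_{pn}|||v|||$ for all $v\in V_{\Omega_{nloc}}$ with $C_{pn}$ independent of $\delta$; and for DtN also, without assuming that inequality, if the kernels are radial (functions of $\delta$ and $|y-x|$) and $\Omega_{nloc}$ contains a fixed patch. **LPS model.** Let $\mu>0$ and $d\lambda+2\mu>0$. Let $\gamma=\gamma_\delta$ be radial kernels, $\gamma_\delta(r)>0$ for $0\le r<\delta$,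 $\gamma_\delta(r)=0$ for $r\ge\delta$, with $\gamma_\delta(|\cdot|)\in L^1(\mathbb R^d)$. Put $m(\delta)=\int_{B_\delta(0)}\gamma(|z|)|z|^2dz$, $C_1=d^2/2$, $C_2=2d(d+2)$ (so $C_1=2$, $C_2=16$ for $d=2$), $$\theta(x)=\frac{2}{m(\delta)}\int_{\overline\Omega}\gamma(|y-x|)\,(y-x)\cdot(\mathbf u(y)-\mathbf u(x))\,dy,$$ $$\mathcal L^{LPS}\mathbf u(x)=\frac{C_1}{m(\delta)}\int_{\overline\Omega}(\lambda-\mu)\gamma(|y-x|)(y-x)(\theta(x)+\theta(y))\,dy+\frac{C_2}{m(\delta)}\int_{\overline\Omega}\mu\,\gamma(|y-x|)\frac{(y-x)\otimes(y-x)}{|y-x|^2}(\mathbf u(y)-\mathbf u(x))\,dy,$$ let $\mathcal N^{LPS}\mathbf u(x)$ be the same expression for $x\in\Omega_I$, and let $$|||\mathbf u|||^2_{LPS}=\frac1{m(\delta)}\int_{\overline\Omega}\int_{\overline\Omega\cap B_\delta(x)}\frac{\gamma(|y-x|)}{|y-x|^2}\big[(\mathbf u(y)-\mathbf u(x))\cdot(y-x)\big]^2dy\,dx.$$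 Let $\mathbf u_l\in C^4(\overline\Omega)$, with derivatives of order at most $4$ bounded uniformly in $\delta$, solve $$-\nabla\cdot(\lambda\,\mathrm{tr}(\mathbf E)\mathbf I+2\mu\mathbf E)=\mathbf s\ \text{in }\overline\Omega,\quad \mathbf E=\tfrac12(\nabla\mathbf u_l+\nabla\mathbf u_l^T),\qquad \mathbf u_l=\mathbf w_l\ \text{on }\Gamma_{loc},\quad \mathbf u_l=\mathbf v_n\ \text{on }\Gamma_{nloc},$$ with $\mathbf v_n=\mathbf u_l$ a.e. in $\Omega_{nloc}$. Let $\mathbf u_n\in [L^2(\overline\Omega)]^d$ with $|||\mathbf u_n|||_{LPS}<\infty$ satisfy (a.e.) $-\mathcal L^{LPS}\mathbf u_n=\mathbf s$ in $\Omega$, $\mathbf u_n=\mathbf v_n$ in $\Omega_{nloc}$, and * (DtD) $\mathbf u_n=\mathbf u_l$ in $\Omega_{loc}$, or * (DtN) $-\mathcal N^{LPS}\mathbf u_n=-\mathcal N^{LPS}\mathbf u_l$ in $\Omega_{loc}$, where $\Omega_{nloc}$ contains a fixed patch. Then $\|\mathbf u_n-\mathbf u_l\|_0=O(\delta^2)$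 as $\delta\to0$. -/

import Mathlib

open MeasureTheory Set Filter Topology
open scoped ENNReal NNReal RealInnerProductSpace

noncomputable section

namespace NonlocalBC

/-- The ambient space `ℝ^d` with its Euclidean norm. -/
abbrev Sp (d : ℕ) : Type := EuclideanSpace ℝ (Fin d)

/-! ### Domains -/

/-- `Ω` has a Lipschitz boundary: near each boundary point, `Ω` is the strict epigraph, in some
direction `e`, of a Lipschitz function of the component orthogonal to `e`. -/
def HasLipschitzBoundary {d : ℕ} (Ω : Set (Sp d)) : Prop :=
  ∀ x₀ ∈ frontier Ω, ∃ r : ℝ, 0 < r ∧ ∃ e : Sp d, ‖e‖ = 1 ∧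
    ∃ (φ : Sp d → ℝ) (K : ℝ≥0), LipschitzWith K φ ∧
      ∀ x ∈ Metric.ball x₀ r, (x ∈ Ω ↔ φ (x - ⟪e, x⟫ • e) < ⟪e, x⟫)

/-- Bounded domain (connected open set) with Lipschitz boundary. -/
structure IsLipschitzDomain {d : ℕ} (Ω : Set (Sp d)) : Prop where
  isOpen : IsOpen Ω
  isConnected : IsConnected Ω
  isBounded : Bornology.IsBounded Ω
  lipschitz : HasLipschitzBoundary Ω

/-- The interaction domain `Ω_I` of thickness `ρ`. -/
def interactionDomain {d : ℕ} (Ω : Set (Sp d)) (ρ : ℝ) : Set (Sp d) :=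
  {y | y ∉ Ω ∧ ∃ x ∈ Ω, ‖y - x‖ < ρ}

/-- The extended domain `Ω ∪ Ω_I`. -/
def extDomain {d : ℕ} (Ω : Set (Sp d)) (ρ : ℝ) : Set (Sp d) :=
  Ω ∪ interactionDomain Ω ρ

/-- `Ω_I = Ω_nloc ∪ Ω_loc`, a nonoverlapping (measurable) partition. -/
structure IsPartition {d : ℕ} (Ω : Set (Sp d)) (ρ : ℝ) (Ωnloc Ωloc : Set (Sp d)) : Prop where
  measurable_nloc : MeasurableSet Ωnloc
  measurable_loc : MeasurableSet Ωloc
  disjoint : Disjoint Ωnloc Ωloc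
  union_eq : Ωnloc ∪ Ωloc = interactionDomain Ω ρ

/-- The nonlocal Dirichlet regions `Ωnloc δ`, inside the interaction domains of thickness
`ρ δ`, do not degenerate: they all contain the part of the interaction domain in one fixed
neighbourhood of one boundary point. -/
def ContainsPatch {d : ℕ} (Ω : Set (Sp d)) (δ₀ : ℝ) (ρ : ℝ → ℝ) (Ωnloc : ℝ → Set (Sp d)) :
    Prop :=
  ∃ x₀ ∈ frontier Ω, ∃ r : ℝ, 0 < r ∧ ∀ δ ∈ Ioc 0 δ₀,
    interactionDomain Ω (ρ δ) ∩ Metric.ball x₀ r ⊆ Ωnloc δ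

/-! ### Regularity and rates -/

/-- `u` is of class `C⁴` on the open set `D`, all derivatives of order at most four being bounded
there by `M`. -/
structure IsC4Bounded {d : ℕ} {F : Type*} [NormedAddCommGroup F] [NormedSpace ℝ F]
    (D : Set (Sp d)) (M : ℝ) (u : Sp d → F) : Prop where
  contDiffOn : ContDiffOn ℝ 4 u D
  bound : ∀ k : ℕ, k ≤ 4 → ∀ x ∈ D, ‖iteratedFDeriv ℝ k u x‖ ≤ M

/-- `err δ = O(δ²)` as `δ → 0⁺`. -/
def IsQuadratic (err : ℝ → ℝ≥0∞) : Prop :=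
  ∃ C δ₁ : ℝ, 0 < δ₁ ∧ ∀ δ ∈ Ioc 0 δ₁, err δ ≤ ENNReal.ofReal (C * δ ^ 2)

/-- The norm of `u - v` in `L²(D)`. -/
def l2Error {d : ℕ} {F : Type*} [NormedAddCommGroup F] (D : Set (Sp d)) (u v : Sp d → F) :
    ℝ≥0∞ :=
  eLpNorm (fun x => u x - v x) 2 (volume.restrict D)

/-! ### The nonlocal Poisson model -/

/-- The nonlocal Laplacian `2 ∫ (u(y) - u(x)) γ(x,y) dy`. -/
def nonlocalLaplacian {d : ℕ} (γ : Sp d → Sp d → ℝ) (u : Sp d → ℝ) (x : Sp d) : ℝ :=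
  2 * ∫ y, (u y - u x) * γ x y

/-- The nonlocal flux `-∫_D (u(y) - u(x)) γ(x,y) dy`, where `D = Ω ∪ Ω_I`. -/
def nonlocalFlux {d : ℕ} (γ : Sp d → Sp d → ℝ) (D : Set (Sp d)) (u : Sp d → ℝ) (x : Sp d) : ℝ :=
  -∫ y in D, (u y - u x) * γ x y

/-- The squared energy seminorm. -/
def energySq {d : ℕ} (γ : Sp d → Sp d → ℝ) (D : Set (Sp d)) (v : Sp d → ℝ) : ℝ≥0∞ :=
  ∫⁻ x in D, ∫⁻ y in D, ENNReal.ofReal ((v y - v x) ^ 2 * γ x y)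

/-- Membership in the energy space `V(D)`. -/
def MemEnergySpace {d : ℕ} (γ : Sp d → Sp d → ℝ) (D : Set (Sp d)) (v : Sp d → ℝ) : Prop :=
  MemLp v 2 (volume.restrict D) ∧ energySq γ D v < ∞

/-- Membership in the volume-constrained energy space `V_Λ(D)`. -/
def MemConstrainedSpace {d : ℕ} (γ : Sp d → Sp d → ℝ) (D Λ : Set (Sp d)) (v : Sp d → ℝ) : Prop :=
  MemEnergySpace γ D v ∧ ∀ᵐ x ∂(volume.restrict Λ), v x = 0

/-- The class of kernel families `γ δ`, `0 < δ ≤ δ₀`. -/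
structure IsPoissonKernel {d : ℕ} (Ω : Set (Sp d)) (δ₀ : ℝ) (γ : ℝ → Sp d → Sp d → ℝ) : Prop where
  measurable : ∀ δ ∈ Ioc 0 δ₀, Measurable (Function.uncurry (γ δ))
  nonneg : ∀ δ ∈ Ioc 0 δ₀, ∀ x y, 0 ≤ γ δ x y
  symm : ∀ δ ∈ Ioc 0 δ₀, ∀ x y, γ δ x y = γ δ y x
  pos : ∀ δ ∈ Ioc 0 δ₀, ∀ x ∈ Ω, ∀ y ∈ Metric.ball x δ, 0 < γ δ x y
  eq_zero : ∀ δ ∈ Ioc 0 δ₀, ∀ x ∈ Ω, ∀ y ∉ Metric.ball x δ, γ δ x y = 0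
  /-- Integrability bounds, with constants that may depend on `δ`. -/
  integrable : ∀ δ ∈ Ioc 0 δ₀, ∃ γ₁ γ₂ : ℝ, 0 < γ₁ ∧ 0 < γ₂ ∧
    (∀ x ∈ Ω, ENNReal.ofReal γ₁ ≤ ∫⁻ y in extDomain Ω δ, ENNReal.ofReal (γ δ x y)) ∧
    (∀ x ∈ extDomain Ω δ,
      ∫⁻ y in extDomain Ω δ, ENNReal.ofReal (γ δ x y ^ 2) ≤ ENNReal.ofReal (γ₂ ^ 2))
  /-- Proper scaling: up to `O(δ²)`, uniformly on `Ω`, the first and third moments vanish and the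
  matrix of second moments is the identity. These are exactly the conditions on `γ` under which
  the nonlocal Laplacian and the Laplacian of every cubic polynomial differ by `O(δ²)`. -/
  scaled : ∃ K : ℝ, ∀ δ ∈ Ioc 0 δ₀, ∀ x ∈ Ω,
    (∀ i, |∫ y, (y i - x i) * γ δ x y| ≤ K * δ ^ 2) ∧
    (∀ i j, |(∫ y, (y i - x i) * (y j - x j) * γ δ x y) - (if i = j then 1 else 0)|
      ≤ K * δ ^ 2) ∧
    (∀ i j k, |∫ y, (y i - x i) * (y j - x j) * (y k - x k) * γ δ x y| ≤ K * δ ^ 2)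

/-- The kernels depend only on the distance. -/
def IsRadialKernel {d : ℕ} (δ₀ : ℝ) (γ : ℝ → Sp d → Sp d → ℝ) : Prop :=
  ∃ g : ℝ → ℝ → ℝ, ∀ δ ∈ Ioc 0 δ₀, ∀ x y, γ δ x y = g δ ‖y - x‖

/-- The kernels satisfy the nonlocal Poincaré inequality on `V_{Ω_nloc}(Ω ∪ Ω_I)`, with a constant
independent of `δ`. -/
def SatisfiesPoincare {d : ℕ} (Ω : Set (Sp d)) (δ₀ : ℝ) (γ : ℝ → Sp d → Sp d → ℝ)
    (Ωnloc : ℝ → Set (Sp d)) : Prop :=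
  ∃ C : ℝ, ∀ δ ∈ Ioc 0 δ₀, ∀ v : Sp d → ℝ,
    MemConstrainedSpace (γ δ) (extDomain Ω δ) (Ωnloc δ) v →
      (eLpNorm v 2 (volume.restrict (extDomain Ω δ))) ^ 2
        ≤ ENNReal.ofReal (C ^ 2) * energySq (γ δ) (extDomain Ω δ) v

/-- `u` is a classical solution of the local Poisson problem `-Δu = s` in `D = Ω ∪ Ω_I`, `u = w`
on `Γ_loc = ∂Ω_loc ∩ ∂D`, `u = v` on `Γ_nloc = ∂Ω_nloc ∩ ∂D`; boundary values are attained as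
limits from `D`. -/
structure IsLocalPoissonSolution {d : ℕ} (D Ωnloc Ωloc : Set (Sp d)) (s w v u : Sp d → ℝ) :
    Prop where
  equation : ∀ x ∈ D, -(Laplacian.laplacian u x) = s x
  boundary_loc : ∀ x ∈ frontier Ωloc ∩ frontier D, Tendsto u (𝓝[D] x) (𝓝 (w x))
  boundary_nloc : ∀ x ∈ frontier Ωnloc ∩ frontier D, Tendsto u (𝓝[D] x) (𝓝 (v x))

/-- `un` solves the nonlocal Poisson problem of the Dirichlet-to-Dirichlet strategy, with data `s`
in `Ω`, the local solution `ul` in `Ω_loc` and `v` in `Ω_nloc`. -/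
structure IsPoissonDtD {d : ℕ} (γ : Sp d → Sp d → ℝ) (Ω D Ωnloc Ωloc : Set (Sp d))
    (s ul v un : Sp d → ℝ) : Prop where
  mem : MemEnergySpace γ D un
  equation : ∀ᵐ x ∂(volume.restrict Ω), -(nonlocalLaplacian γ un x) = s x
  loc : ∀ᵐ x ∂(volume.restrict Ωloc), un x = ul x
  nloc : ∀ᵐ x ∂(volume.restrict Ωnloc), un x = v x

/-- `un` solves the nonlocal Poisson problem of the Dirichlet-to-Neumann strategy: in `Ω_loc` its
nonlocal flux is that of the local solution `ul`. -/
structure IsPoissonDtN {d : ℕ} (γ : Sp d → Sp d → ℝ) (Ω D Ωnloc Ωloc : Set (Sp d))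
    (s ul v un : Sp d → ℝ) : Prop where
  mem : MemEnergySpace γ D un
  equation : ∀ᵐ x ∂(volume.restrict Ω), -(nonlocalLaplacian γ un x) = s x
  loc : ∀ᵐ x ∂(volume.restrict Ωloc), -(nonlocalFlux γ D un x) = -(nonlocalFlux γ D ul x)
  nloc : ∀ᵐ x ∂(volume.restrict Ωnloc), un x = v x

/-! ### The linear peridynamic solid (LPS) model -/

/-- The class of radial kernel families `γ(|y - x|) = g δ ‖y - x‖`, `0 < δ ≤ δ₀`. -/
structure IsLPSKernel (d : ℕ) (δ₀ : ℝ) (g : ℝ → ℝ → ℝ) : Prop where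
  measurable : ∀ δ ∈ Ioc 0 δ₀, Measurable (g δ)
  nonneg : ∀ δ ∈ Ioc 0 δ₀, ∀ r, 0 ≤ g δ r
  pos : ∀ δ ∈ Ioc 0 δ₀, ∀ r, 0 ≤ r → r < δ → 0 < g δ r
  eq_zero : ∀ δ ∈ Ioc 0 δ₀, ∀ r, δ ≤ r → g δ r = 0
  integrable : ∀ δ ∈ Ioc 0 δ₀, Integrable (fun z : Sp d => g δ ‖z‖)

/-- The second moment `m(δ) = ∫_{B_δ} g(|z|) |z|² dz`. -/
def lpsMoment (d : ℕ) (g : ℝ → ℝ) (δ : ℝ) : ℝ :=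
  ∫ z in Metric.ball (0 : Sp d) δ, g ‖z‖ * ‖z‖ ^ 2

/-- The nonlocal dilatation, with weight `m = m(δ)` and `D = Ω ∪ Ω_I`. -/
def dilatation {d : ℕ} (g : ℝ → ℝ) (m : ℝ) (D : Set (Sp d)) (u : Sp d → Sp d) (x : Sp d) : ℝ :=
  2 / m * ∫ y in D, g ‖y - x‖ * ⟪y - x, u y - u x⟫

/-- The constant `C₁`; it equals `2` for `d = 2`. -/
def lpsC₁ (d : ℕ) : ℝ := (d : ℝ) ^ 2 / 2

/-- The constant `C₂`; it equals `16` for `d = 2`. -/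
def lpsC₂ (d : ℕ) : ℝ := 2 * (d : ℝ) * ((d : ℝ) + 2)

/-- The LPS operator; the tensor `z ⊗ z` applied to a vector `b` is `⟪z, b⟫ • z`. -/
def lpsOperator {d : ℕ} (lam mu : ℝ) (g : ℝ → ℝ) (m : ℝ) (D : Set (Sp d)) (u : Sp d → Sp d)
    (x : Sp d) : Sp d :=
  (lpsC₁ d / m) • (∫ y in D,
      ((lam - mu) * g ‖y - x‖ * (dilatation g m D u x + dilatation g m D u y)) • (y - x))
    + (lpsC₂ d / m) • ∫ y in D,
      (mu * g ‖y - x‖ * (⟪y - x, u y - u x⟫ / ‖y - x‖ ^ 2)) • (y - x)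

/-- The LPS flux operator: the same expression as the LPS operator, evaluated at points of the
interaction domain. -/
def lpsFlux {d : ℕ} (lam mu : ℝ) (g : ℝ → ℝ) (m : ℝ) (D : Set (Sp d)) (u : Sp d → Sp d)
    (x : Sp d) : Sp d :=
  lpsOperator lam mu g m D u x

/-- The squared LPS energy norm, with `m = m(δ)`. -/
def lpsEnergySq {d : ℕ} (g : ℝ → ℝ) (δ m : ℝ) (D : Set (Sp d)) (u : Sp d → Sp d) : ℝ≥0∞ :=
  ENNReal.ofReal (1 / m) * ∫⁻ x in D, ∫⁻ y in D ∩ Metric.ball x δ,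
    ENNReal.ofReal (g ‖y - x‖ / ‖y - x‖ ^ 2 * ⟪u y - u x, y - x⟫ ^ 2)

/-- Membership in the LPS energy space. -/
def MemLPSEnergySpace {d : ℕ} (g : ℝ → ℝ) (δ m : ℝ) (D : Set (Sp d)) (u : Sp d → Sp d) : Prop :=
  MemLp u 2 (volume.restrict D) ∧ lpsEnergySq g δ m D u < ∞

/-- The partial derivative `∂_j u_i`. -/
def partialDeriv {d : ℕ} (u : Sp d → Sp d) (i j : Fin d) (x : Sp d) : ℝ :=
  fderiv ℝ (fun y => u y i) x (EuclideanSpace.single j 1)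

/-- The strain tensor `E = (∇u + ∇uᵀ) / 2`. -/
def strain {d : ℕ} (u : Sp d → Sp d) (x : Sp d) : Matrix (Fin d) (Fin d) ℝ :=
  Matrix.of fun i j => (partialDeriv u i j x + partialDeriv u j i x) / 2

/-- The stress tensor `λ tr(E) I + 2 μ E`. -/
def stress {d : ℕ} (lam mu : ℝ) (u : Sp d → Sp d) (x : Sp d) : Matrix (Fin d) (Fin d) ℝ :=
  (lam * (strain u x).trace) • (1 : Matrix (Fin d) (Fin d) ℝ) + (2 * mu) • strain u x

/-- The Navier operator `∇ · (λ tr(E) I + 2 μ E)`. -/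
def navier {d : ℕ} (lam mu : ℝ) (u : Sp d → Sp d) (x : Sp d) : Sp d :=
  WithLp.toLp 2 fun i =>
    ∑ j, fderiv ℝ (fun y => stress lam mu u y i j) x (EuclideanSpace.single j 1)

/-- `u` is a classical solution of the Navier problem in `D = Ω ∪ Ω_I`, with boundary values `w`
on `Γ_loc` and `v` on `Γ_nloc`. -/
structure IsLocalNavierSolution {d : ℕ} (lam mu : ℝ) (D Ωnloc Ωloc : Set (Sp d))
    (s w v u : Sp d → Sp d) : Prop where
  equation : ∀ x ∈ D, -(navier lam mu u x) = s x
  boundary_loc : ∀ x ∈ frontier Ωloc ∩ frontier D, Tendsto u (𝓝[D] x) (𝓝 (w x))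
  boundary_nloc : ∀ x ∈ frontier Ωnloc ∩ frontier D, Tendsto u (𝓝[D] x) (𝓝 (v x))

/-- `un` solves the LPS problem of the Dirichlet-to-Dirichlet strategy. -/
structure IsLPSDtD {d : ℕ} (lam mu : ℝ) (g : ℝ → ℝ) (δ : ℝ) (Ω D Ωnloc Ωloc : Set (Sp d))
    (s ul v un : Sp d → Sp d) : Prop where
  mem : MemLPSEnergySpace g δ (lpsMoment d g δ) D un
  equation : ∀ᵐ x ∂(volume.restrict Ω), -(lpsOperator lam mu g (lpsMoment d g δ) D un x) = s x
  loc : ∀ᵐ x ∂(volume.restrict Ωloc), un x = ul x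
  nloc : ∀ᵐ x ∂(volume.restrict Ωnloc), un x = v x

/-- `un` solves the LPS problem of the Dirichlet-to-Neumann strategy. -/
structure IsLPSDtN {d : ℕ} (lam mu : ℝ) (g : ℝ → ℝ) (δ : ℝ) (Ω D Ωnloc Ωloc : Set (Sp d))
    (s ul v un : Sp d → Sp d) : Prop where
  mem : MemLPSEnergySpace g δ (lpsMoment d g δ) D un
  equation : ∀ᵐ x ∂(volume.restrict Ω), -(lpsOperator lam mu g (lpsMoment d g δ) D un x) = s x
  loc : ∀ᵐ x ∂(volume.restrict Ωloc),
    -(lpsFlux lam mu g (lpsMoment d g δ) D un x) = -(lpsFlux lam mu g (lpsMoment d g δ) D ul x)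
  nloc : ∀ᵐ x ∂(volume.restrict Ωnloc), un x = v x

end NonlocalBC

end

noncomputable section

namespace NonlocalBC

/-! ### Geometry of Lipschitz domains -/

/-! Every case is stability plus consistency. Let e = u_n - u_l and let D be the extended domain. On
Ω_nloc the error vanishes; on Ω_loc either the error vanishes (DtD) or its flux does (DtN); on Ω the
operator applied to e equals the consistency error of u_l, which is at most A = O(δ²). Testing with
e itself therefore bounds the energy of e by a constant times A times the L¹ norm of e. If ‖e‖² ≤ P
· energy(e) with P independent of δ, Cauchy–Schwarz on the bounded set D gives ‖e‖ ≤ const · P · A ·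
|D|^(1/2). This is `IsPoissonKernel.l2Error_le` for the Poisson model and
`IsLPSWeight.eLpNorm_le_of_residual_le` for LPS; no regularity of u_n beyond L² enters.

Consistency is Taylor's formula to fourth order. For Poisson the scaling hypotheses treat the cubic
polynomial, and the remainder M|z|⁴ ≤ Mδ²|z|² is absorbed by the second moments
(`IsPoissonKernel.exists_consistency`). For LPS the radial symmetry removes the odd part of each
integrand, and the second and fourth moments follow from invariance under isometries and
polarization. The dilatation enters under a second integral against z, divided by m(δ), so an O(δ²)
error for it would not suffice: its increments from x to x + z need an error O(δ²|z|), which is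
`IsRadialWeight.abs_dilatation_sub_le`. The constants C₁ and C₂ are the ones for which the limit is
(λ+μ)∇div + μΔ.

Stability needs a Poincaré inequality uniform in δ, obtained in two ways when it is not assumed. For
Poisson DtD the kernels need not be radial, but e vanishes outside Ω: the function const - |x|² is a
positive bounded supersolution, and Picone's inequality turns it into a Poincaré inequality
(`poincare_of_supersolution`). For radial kernels and for LPS, `exists_korn_poincare` is proved by
walking. For a fixed short vector z, telescope ⟪u, z⟫ along x, x + z, x + 2z, ... until the walk
meets a region where u is already controlled or zero. About l/|z| steps cost a factor l²/|z|², which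
is exactly the weight in the projected energy. Averaging over a cone of directions z recovers |u|²
from its projections. Control starts at the patch, where walks leave Ω, spreads through Ω by
connectedness, and reaches the boundary layer by the interior cone condition.

For LPS the form must also dominate the projected energy. The integral of θ² is at most four times
that energy, by Cauchy–Schwarz, which yields coercivity exactly under μ > 0 and dλ + 2μ > 0
(`IsLPSWeight.exists_coercive`). -/

theorem extDomain_eq_thickening {d : ℕ} (Ω : Set (Sp d)) {ρ : ℝ} (hρ : 0 < ρ) :
    extDomain Ω ρ = Metric.thickening ρ Ω := by
  ext y
  simp only [extDomain, interactionDomain, mem_union, mem_ofPred_eq, Metric.mem_thickening_iff,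
    dist_eq_norm]
  constructor
  · rintro (h | ⟨-, h⟩)
    · exact ⟨y, h, by simpa using hρ⟩
    · exact h
  · intro h
    by_cases hy : y ∈ Ω
    · exact Or.inl hy
    · exact Or.inr ⟨hy, h⟩

theorem isOpen_extDomain {d : ℕ} (Ω : Set (Sp d)) {ρ : ℝ} (hρ : 0 < ρ) :
    IsOpen (extDomain Ω ρ) := by
  rw [extDomain_eq_thickening Ω hρ]
  exact Metric.isOpen_thickening

theorem measurableSet_extDomain {d : ℕ} (Ω : Set (Sp d)) {ρ : ℝ} (hρ : 0 < ρ) :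
    MeasurableSet (extDomain Ω ρ) :=
  (isOpen_extDomain Ω hρ).measurableSet

theorem ball_subset_extDomain {d : ℕ} {Ω : Set (Sp d)} {ρ : ℝ} (hρ : 0 < ρ) {x : Sp d}
    (hx : x ∈ Ω) : Metric.ball x ρ ⊆ extDomain Ω ρ := by
  rw [extDomain_eq_thickening Ω hρ]
  intro y hy
  exact Metric.mem_thickening_iff.2 ⟨x, hx, hy⟩

theorem isBounded_extDomain {d : ℕ} {Ω : Set (Sp d)} (hΩ : Bornology.IsBounded Ω) {ρ : ℝ}
    (hρ : 0 < ρ) : Bornology.IsBounded (extDomain Ω ρ) := by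
  rw [extDomain_eq_thickening Ω hρ]
  exact hΩ.thickening

theorem extDomain_mono {d : ℕ} (Ω : Set (Sp d)) {ρ ρ' : ℝ} (h : ρ ≤ ρ') :
    extDomain Ω ρ ⊆ extDomain Ω ρ' := by
  rintro y (hy | ⟨hy, x, hx, hxy⟩)
  · exact Or.inl hy
  · exact Or.inr ⟨hy, x, hx, hxy.trans_le h⟩

/-- The open cone of vectors whose direction is within `κ` of `e`. -/
def openCone {d : ℕ} (e : Sp d) (κ : ℝ) : Set (Sp d) := {z | ‖z - ‖z‖ • e‖ < κ * ‖z‖}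

theorem measurableSet_openCone {d : ℕ} (e : Sp d) (κ : ℝ) : MeasurableSet (openCone e κ) := by
  apply IsOpen.measurableSet
  exact isOpen_lt (by fun_prop) (by fun_prop)

/-- The interior cone condition for a Lipschitz epigraph. A displacement v with ‖v - t e‖ ≤ κt
raises the height by at least t - κt and changes the graph function by at most 2Kκt; κ = 1/(2K+2)
makes 2Kκ + 2κ = 1, so the point stays above the graph. Only the endpoint y + v, not the segment,
has to remain in the chart. -/
theorem exists_cone_of_mem_frontier {d : ℕ} {Ω : Set (Sp d)} (h : HasLipschitzBoundary Ω)
    {p : Sp d} (hp : p ∈ frontier Ω) :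
    ∃ r : ℝ, 0 < r ∧ ∃ e : Sp d, ‖e‖ = 1 ∧ ∃ κ : ℝ, 0 < κ ∧ κ < 1 ∧
      ∀ y ∈ Ω ∩ Metric.ball p r, ∀ (t : ℝ) (v : Sp d), 0 ≤ t → ‖v - t • e‖ ≤ κ * t →
        y + v ∈ Metric.ball p r → y + v ∈ Ω := by
  obtain ⟨r, hr, e, he, φ, K, hφ, hiff⟩ := h p hp
  refine ⟨r, hr, e, he, 1 / (2 * K + 2), by positivity, ?_, ?_⟩
  · rw [div_lt_one (by positivity)]
    have := K.2
    change 1 < 2 * (K : ℝ) + 2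
    nlinarith [K.coe_nonneg]
  · rintro y ⟨hyΩ, hyr⟩ t v ht hv hball
    rw [hiff _ hball]
    have h1 := (hiff y hyr).1 hyΩ
    set κ : ℝ := 1 / (2 * K + 2) with hκ
    have hκK : κ * (2 * K + 2) = 1 := by rw [hκ]; field_simp
    have hin : |⟪e, v - t • e⟫| ≤ ‖v - t • e‖ := by
      simpa [he] using abs_real_inner_le_norm e (v - t • e)
    have hev : ⟪e, v⟫ = t + ⟪e, v - t • e⟫ := by
      rw [inner_sub_right, inner_smul_right, real_inner_self_eq_norm_sq, he]; ring
    have hperp : ‖v - ⟪e, v⟫ • e‖ ≤ 2 * ‖v - t • e‖ := by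
      have : v - ⟪e, v⟫ • e = (v - t • e) - ⟪e, v - t • e⟫ • e := by
        rw [hev]; module
      rw [this]
      refine (norm_sub_le _ _).trans ?_
      rw [norm_smul, he, Real.norm_eq_abs]
      linarith
    have hL := hφ.dist_le_mul (y + v - ⟪e, y + v⟫ • e) (y - ⟪e, y⟫ • e)
    rw [Real.dist_eq, dist_eq_norm] at hL
    have hd : y + v - ⟪e, y + v⟫ • e - (y - ⟪e, y⟫ • e) = v - ⟪e, v⟫ • e := by
      rw [inner_add_right]; module
    rw [hd] at hL
    have h2 := (abs_le.1 hL).2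
    have h3 := (abs_le.1 hin).1
    rw [inner_add_right, hev]
    have hK := K.coe_nonneg
    have h4 : (K : ℝ) * ‖v - ⟪e, v⟫ • e‖ ≤ K * (2 * (κ * t)) := by
      gcongr; exact hperp.trans (by gcongr)
    have h5 : K * (2 * (κ * t)) + κ * t + κ * t = t := by
      linear_combination t * hκK
    have h6 : 0 ≤ κ * t := by positivity
    rw [inner_add_right, hev] at h2
    rw [hev] at h4
    linarith

theorem nonempty_frontier {d : ℕ} (hd : 1 ≤ d) {Ω : Set (Sp d)} (hΩ : IsLipschitzDomain Ω) :
    (frontier Ω).Nonempty := by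
  have : Nonempty (Fin d) := ⟨⟨0, hd⟩⟩
  have : Nontrivial (Sp d) := inferInstance
  rw [nonempty_iff_ne_empty]
  intro h
  rcases isClopen_iff.1 (isClopen_iff_frontier_eq_empty.2 h) with h | h
  · exact hΩ.isConnected.nonempty.ne_empty h
  · have := hΩ.isBounded
    rw [h] at this
    exact NormedSpace.unbounded_univ ℝ (Sp d) this

/-! ### Radial weights and polar coordinates -/

/-- Polar coordinates split the integral into a spherical factor depending on H only and a radial
factor depending on G only. Two such integrals with the same G thus have a ratio independent of G,
which makes later constants uniform in the kernel and in the horizon. -/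
theorem lintegral_radial_mul {d : ℕ} (hd : 1 ≤ d) {G : ℝ → ℝ≥0∞} (hG : Measurable G)
    {H : Sp d → ℝ≥0∞} (hH : Measurable H)
    (hom : ∀ (t : ℝ) (z : Sp d), 0 < t → H (t • z) = ENNReal.ofReal (t ^ 2) * H z) :
    ∫⁻ z, G ‖z‖ * H z = (∫⁻ ω, H (ω : Sp d) ∂(volume : Measure (Sp d)).toSphere) *
      ∫⁻ r : Ioi (0 : ℝ), G r * ENNReal.ofReal ((r : ℝ) ^ 2)
        ∂(Measure.volumeIoiPow (Module.finrank ℝ (Sp d) - 1)) := by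
  have : Nonempty (Fin d) := ⟨⟨0, hd⟩⟩
  have h1 : ∫⁻ z, G ‖z‖ * H z = ∫⁻ z in ({0}ᶜ : Set (Sp d)), G ‖z‖ * H z := by
    rw [restrict_compl_singleton]
  rw [h1, ← lintegral_subtype_comap (measurableSet_singleton _).compl]
  have hp := (volume : Measure (Sp d)).measurePreserving_homeomorphUnitSphereProd
  have h2 := hp.symm (homeomorphUnitSphereProd (Sp d)).toMeasurableEquiv
  rw [← h2.lintegral_comp_emb (MeasurableEquiv.measurableEmbedding _)]
  rw [← lintegral_prod_mul (f := fun ω : Metric.sphere (0 : Sp d) 1 => H ω)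
    (g := fun r : Ioi (0 : ℝ) => G r * ENNReal.ofReal ((r : ℝ) ^ 2))
    (hH.comp measurable_subtype_coe).aemeasurable (by apply Measurable.aemeasurable; fun_prop)]
  refine lintegral_congr fun p => ?_
  have h3 : (((homeomorphUnitSphereProd (Sp d)).toMeasurableEquiv.symm p : ({0}ᶜ : Set (Sp d))) :
      Sp d) = (p.2 : ℝ) • (p.1 : Sp d) := homeomorphUnitSphereProd_symm_apply_coe _ _
  rw [h3, hom _ _ p.2.2, norm_smul]
  have h4 : ‖(p.1 : Sp d)‖ = 1 := by simp
  have h5 : (0:ℝ) < p.2 := p.2.2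
  rw [h4, mul_one, Real.norm_eq_abs, abs_of_pos h5]
  ring

/-- An open set of directions is not contained in a hyperplane: the axis e works unless it is
orthogonal to b, and then a small tilt of e towards b does. -/
theorem exists_mem_sphere_openCone {d : ℕ} {e : Sp d} (he : ‖e‖ = 1) {κ : ℝ} (hκ : 0 < κ)
    {b : Sp d} (hb : b ≠ 0) :
    ∃ ω : Sp d, ‖ω‖ = 1 ∧ ω ∈ openCone e κ ∧ ⟪b, ω⟫ ≠ 0 := by
  by_cases hbe : ⟪b, e⟫ = 0
  · have hcont : ContinuousAt (fun t : ℝ => ‖e + t • b‖⁻¹ • (e + t • b)) 0 := by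
      apply ContinuousAt.fun_smul
      · apply ContinuousAt.inv₀ (by fun_prop)
        simp [he]
      · fun_prop
    have hball : Metric.ball e κ ∈ 𝓝 ((fun t : ℝ => ‖e + t • b‖⁻¹ • (e + t • b)) 0) := by
      simpa [he] using Metric.ball_mem_nhds e hκ
    have h1 := (hcont.eventually_mem hball).filter_mono (nhdsWithin_le_nhds (s := Ioi 0))
    obtain ⟨t, ht, ht0⟩ := (h1.and self_mem_nhdsWithin).exists
    have ht0' : (0:ℝ) < t := ht0
    have hin : ⟪b, e + t • b⟫ = t * ‖b‖ ^ 2 := by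
      rw [inner_add_right, inner_smul_right, hbe, real_inner_self_eq_norm_sq, zero_add]
    have hpos : 0 < t * ‖b‖ ^ 2 := by positivity
    have hne : e + t • b ≠ 0 := by
      intro h; rw [h, inner_zero_right] at hin; exact hpos.ne hin
    have hn : ‖‖e + t • b‖⁻¹ • (e + t • b)‖ = 1 := norm_smul_inv_norm hne
    refine ⟨_, hn, ?_, ?_⟩
    · simp only [openCone, mem_ofPred_eq, hn, one_smul, mul_one]
      simpa [dist_eq_norm] using ht
    · rw [inner_smul_right, hin]
      have : 0 < ‖e + t • b‖ := norm_pos_iff.2 hne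
      positivity
  · exact ⟨e, he, by simp [openCone, he, hκ], hbe⟩

/-- The spherical integral is a quadratic form in b, continuous and positive on the compact unit
sphere, so it has a positive minimum there; homogeneity of degree two does the rest. -/
theorem exists_sphere_quadratic_bound {d : ℕ} (hd : 1 ≤ d) {e : Sp d} (he : ‖e‖ = 1) {κ : ℝ}
    (hκ : 0 < κ) :
    ∃ c : ℝ, 0 < c ∧ ∀ b : Sp d, ENNReal.ofReal (c * ‖b‖ ^ 2) ≤
      ∫⁻ ω, (openCone e κ).indicator (fun z => ENNReal.ofReal (⟪b, z⟫ ^ 2)) (ω : Sp d)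
        ∂(volume : Measure (Sp d)).toSphere := by
  have : Nonempty (Fin d) := ⟨⟨0, hd⟩⟩
  set σ := (volume : Measure (Sp d)).toSphere
  set S : Set (Metric.sphere (0 : Sp d) 1) := Subtype.val ⁻¹' openCone e κ
  have hS : IsOpen S := by
    apply IsOpen.preimage continuous_subtype_val
    exact isOpen_lt (by fun_prop) (by fun_prop)
  set q : Sp d → ℝ := fun b => ∫ ω in S, ⟪b, (ω : Sp d)⟫ ^ 2 ∂σ
  have hle : ∀ (b : Sp d) (ω : Metric.sphere (0 : Sp d) 1), ⟪b, (ω : Sp d)⟫ ^ 2 ≤ ‖b‖ ^ 2 := by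
    intro b ω
    have h1 := abs_real_inner_le_norm b (ω : Sp d)
    rw [norm_eq_of_mem_sphere ω, mul_one] at h1
    exact sq_le_sq' (abs_le.1 h1).1 (abs_le.1 h1).2
  have hqi : ∀ b, Integrable (fun ω : Metric.sphere (0 : Sp d) 1 => ⟪b, (ω : Sp d)⟫ ^ 2)
      (σ.restrict S) := fun b => by
    refine Integrable.of_bound (C := ‖b‖ ^ 2) (by
      apply Continuous.aestronglyMeasurable; fun_prop) (ae_of_all _ fun ω => ?_)
    rw [Real.norm_eq_abs, abs_of_nonneg (sq_nonneg _)]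
    exact hle b ω
  have heq : ∀ b : Sp d, ∫⁻ ω, (openCone e κ).indicator (fun z => ENNReal.ofReal (⟪b, z⟫ ^ 2))
      (ω : Sp d) ∂σ = ENNReal.ofReal (q b) := by
    intro b
    rw [ofReal_integral_eq_lintegral_ofReal (hqi b) (ae_of_all _ fun ω => sq_nonneg _),
      ← lintegral_indicator hS.measurableSet]
    rfl
  have hcont : ContinuousOn q (Metric.sphere (0 : Sp d) 1) := by
    apply continuousOn_of_dominated (bound := fun _ => (1 : ℝ))
    · intro b _; exact (hqi b).aestronglyMeasurable
    · intro b hb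
      refine ae_of_all _ fun ω => ?_
      rw [Real.norm_eq_abs, abs_of_nonneg (sq_nonneg _)]
      have := hle b ω
      rw [mem_sphere_zero_iff_norm.1 hb] at this
      simpa using this
    · exact integrable_const _
    · exact ae_of_all _ fun ω => by fun_prop
  obtain ⟨b₀, hb₀, hmin⟩ := (isCompact_sphere (0 : Sp d) 1).exists_isMinOn
    ⟨e, by simpa using he⟩ hcont
  have hb₀' : b₀ ≠ 0 := by
    intro h; rw [h] at hb₀; simp at hb₀
  have hpos : 0 < q b₀ := by
    rw [← ENNReal.ofReal_pos, ← heq, lintegral_pos_iff_support (by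
      exact (Measurable.indicator (by fun_prop) (measurableSet_openCone e κ)).comp
        measurable_subtype_coe)]
    obtain ⟨ω, hω, hωc, hbω⟩ := exists_mem_sphere_openCone he hκ hb₀'
    set U : Set (Metric.sphere (0 : Sp d) 1) := S ∩ {ω | ⟪b₀, (ω : Sp d)⟫ ≠ 0}
    have hU : IsOpen U := hS.inter (isOpen_ne_fun (by fun_prop) (by fun_prop))
    have hUne : U.Nonempty := ⟨⟨ω, by simpa using hω⟩, hωc, hbω⟩
    refine (hU.measure_pos σ hUne).trans_le (measure_mono ?_)
    rintro η ⟨hη1, hη2⟩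
    rw [Function.mem_support]
    have h1 : (η : Sp d) ∈ openCone e κ := hη1
    have h2 : ⟪b₀, (η : Sp d)⟫ ≠ 0 := hη2
    rw [indicator_of_mem h1]
    have : 0 < ⟪b₀, (η : Sp d)⟫ ^ 2 := by positivity
    exact (ENNReal.ofReal_pos.2 this).ne'
  refine ⟨q b₀, hpos, fun b => ?_⟩
  rw [heq]
  apply ENNReal.ofReal_le_ofReal
  by_cases hb : b = 0
  · subst hb; simp [q]
  · have hb' : 0 < ‖b‖ := norm_pos_iff.2 hb
    have h1 : q b₀ ≤ q (‖b‖⁻¹ • b) := hmin (by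
      rw [mem_sphere_zero_iff_norm]; exact norm_smul_inv_norm hb)
    have h2 : q (‖b‖⁻¹ • b) = (‖b‖⁻¹) ^ 2 * q b := by
      simp only [q]
      rw [← integral_const_mul]
      congr 1; ext ω
      rw [real_inner_smul_left]; ring
    rw [h2] at h1
    calc q b₀ * ‖b‖ ^ 2 ≤ (‖b‖⁻¹) ^ 2 * q b * ‖b‖ ^ 2 := by gcongr
      _ = q b := by field_simp

/-- Averaging over a cone of directions, with any radial weight, controls the whole norm. -/
theorem exists_cone_average_bound {d : ℕ} (hd : 1 ≤ d) {e : Sp d} (he : ‖e‖ = 1) {κ : ℝ}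
    (hκ : 0 < κ) :
    ∃ c : ℝ≥0∞, c ≠ 0 ∧ c ≠ ∞ ∧ ∀ G : ℝ → ℝ≥0∞, Measurable G → ∀ b : Sp d,
      c * (∫⁻ z : Sp d, G ‖z‖ * ENNReal.ofReal (‖z‖ ^ 2)) * ENNReal.ofReal (‖b‖ ^ 2) ≤
        ∫⁻ z in openCone e κ, G ‖z‖ * ENNReal.ofReal (⟪b, z⟫ ^ 2) := by
  have : Nonempty (Fin d) := ⟨⟨0, hd⟩⟩
  obtain ⟨c, hc, hcb⟩ := exists_sphere_quadratic_bound hd he hκ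
  set σ := (volume : Measure (Sp d)).toSphere
  have hσ0 : σ univ ≠ 0 := by
    rw [Measure.measure_univ_ne_zero]; exact Measure.toSphere_ne_zero _
  have hσt : σ univ ≠ ∞ := measure_ne_top _ _
  -- The second moment of G has spherical factor `σ univ`; dividing by it leaves the same radial
  -- factor on both sides.
  refine ⟨ENNReal.ofReal c / σ univ, ?_, ?_, fun G hG b => ?_⟩
  · exact (ENNReal.div_pos (ENNReal.ofReal_pos.2 hc).ne' hσt).ne'
  · exact ENNReal.div_ne_top ENNReal.ofReal_ne_top hσ0
  · rw [lintegral_radial_mul hd hG (by fun_prop) (fun t z ht => by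
      rw [norm_smul, mul_pow, ENNReal.ofReal_mul (by positivity)]; simp)]
    have h1 : ∫⁻ z in openCone e κ, G ‖z‖ * ENNReal.ofReal (⟪b, z⟫ ^ 2) =
        ∫⁻ z, G ‖z‖ * (openCone e κ).indicator (fun z => ENNReal.ofReal (⟪b, z⟫ ^ 2)) z := by
      rw [← lintegral_indicator (measurableSet_openCone e κ)]
      refine lintegral_congr fun z => ?_
      by_cases hz : z ∈ openCone e κ <;> simp [hz]
    rw [h1, lintegral_radial_mul hd hG
      (Measurable.indicator (by fun_prop) (measurableSet_openCone e κ)) ?_]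
    · have h2 : ∫⁻ ω : Metric.sphere (0 : Sp d) 1, ENNReal.ofReal (‖(ω : Sp d)‖ ^ 2) ∂σ =
          σ univ := by
        simp
      rw [h2]
      set I := ∫⁻ r : Ioi (0 : ℝ), G r * ENNReal.ofReal ((r : ℝ) ^ 2)
        ∂(Measure.volumeIoiPow (Module.finrank ℝ (Sp d) - 1))
      calc ENNReal.ofReal c / σ univ * (σ univ * I) * ENNReal.ofReal (‖b‖ ^ 2)
          = ENNReal.ofReal (c * ‖b‖ ^ 2) * I := by
            rw [← mul_assoc, ENNReal.div_mul_cancel hσ0 hσt, ENNReal.ofReal_mul hc.le]; ring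
        _ ≤ _ := by gcongr; exact hcb b
    · intro t z ht
      have hmem : t • z ∈ openCone e κ ↔ z ∈ openCone e κ := by
        simp only [openCone, mem_ofPred_eq, norm_smul, Real.norm_eq_abs, abs_of_pos ht]
        rw [mul_smul, ← smul_sub, norm_smul, Real.norm_eq_abs, abs_of_pos ht]
        rw [show κ * (t * ‖z‖) = t * (κ * ‖z‖) by ring, mul_lt_mul_iff_right₀ ht]
      by_cases hz : z ∈ openCone e κ
      · rw [indicator_of_mem hz, indicator_of_mem (hmem.2 hz), inner_smul_right, mul_pow,
          ENNReal.ofReal_mul (by positivity)]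
      · rw [indicator_of_notMem hz, indicator_of_notMem (fun h => hz (hmem.1 h)), mul_zero]

/-! ### A nonlocal Korn–Poincaré inequality -/

/-- The second moment of a radial weight. -/
def radialMoment (d : ℕ) (G : ℝ → ℝ≥0∞) : ℝ≥0∞ :=
  ∫⁻ z : Sp d, G ‖z‖ * ENNReal.ofReal (‖z‖ ^ 2)

/-- The projected difference energy of a vector field on `D`. -/
def radialEnergy {d : ℕ} (G : ℝ → ℝ≥0∞) (D : Set (Sp d)) (u : Sp d → Sp d) : ℝ≥0∞ :=
  ∫⁻ x in D, ∫⁻ y in D, G ‖y - x‖ * ENNReal.ofReal (⟪u y - u x, y - x⟫ ^ 2 / ‖y - x‖ ^ 2)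

/-- The squared increment of `u` along `z`, projected on `z`, at points of `D` that `z` does not
lead out of `D`. -/
def stepSq {d : ℕ} (D : Set (Sp d)) (u : Sp d → Sp d) (z x : Sp d) : ℝ≥0∞ :=
  D.indicator (fun x => D.indicator (fun y => ENNReal.ofReal (⟪u y - u x, z⟫ ^ 2)) (x + z)) x

theorem stepSq_of_mem {d : ℕ} {D : Set (Sp d)} {u : Sp d → Sp d} {z x : Sp d} (hx : x ∈ D)
    (hz : x + z ∈ D) : stepSq D u z x = ENNReal.ofReal (⟪u (x + z) - u x, z⟫ ^ 2) := by
  simp [stepSq, hx, hz]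

theorem measurable_stepSq {d : ℕ} {D : Set (Sp d)} (hD : MeasurableSet D) {u : Sp d → Sp d}
    (hu : Measurable u) {α : Type*} [MeasurableSpace α] {f g : α → Sp d} (hf : Measurable f)
    (hg : Measurable g) : Measurable fun p => stepSq D u (f p) (g p) := by
  have h : (fun p => stepSq D u (f p) (g p)) =
      (g ⁻¹' D ∩ (fun p => g p + f p) ⁻¹' D).indicator
        fun p => ENNReal.ofReal (⟪u (g p + f p) - u (g p), f p⟫ ^ 2) := by
    ext p
    by_cases h1 : g p ∈ D <;> by_cases h2 : g p + f p ∈ D <;> simp [stepSq, h1, h2]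
  rw [h]
  apply Measurable.indicator (by fun_prop)
  exact (hg hD).inter ((hg.add hf) hD)

/-- Substituting y = x + z and exchanging the integrals organizes the energy by the step z. With z
frozen, all points of a walk with step z can be translated back to one integral over x. -/
theorem radialEnergy_eq {d : ℕ} {G : ℝ → ℝ≥0∞} (hG : Measurable G) {D : Set (Sp d)}
    (hD : MeasurableSet D) {u : Sp d → Sp d} (hu : Measurable u) :
    radialEnergy G D u =
      ∫⁻ z, G ‖z‖ * ENNReal.ofReal ((‖z‖ ^ 2)⁻¹) * ∫⁻ x, stepSq D u z x := by
  have h1 : radialEnergy G D u =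
      ∫⁻ x, ∫⁻ z, G ‖z‖ * ENNReal.ofReal ((‖z‖ ^ 2)⁻¹) * stepSq D u z x := by
    rw [radialEnergy, ← lintegral_indicator hD]
    refine lintegral_congr fun x => ?_
    by_cases hx : x ∈ D
    · rw [indicator_of_mem hx, ← lintegral_indicator hD, ← lintegral_add_left_eq_self _ x]
      refine lintegral_congr fun z => ?_
      by_cases hz : x + z ∈ D
      · rw [indicator_of_mem hz, stepSq_of_mem hx hz, add_sub_cancel_left, div_eq_mul_inv,
          ENNReal.ofReal_mul (sq_nonneg _)]
        ring
      · simp [stepSq, hz]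
    · simp [stepSq, hx]
  rw [h1, lintegral_lintegral_swap]
  · refine lintegral_congr fun z => ?_
    exact lintegral_const_mul _ (measurable_stepSq hD hu measurable_const measurable_id)
  · apply Measurable.aemeasurable
    have h2 : Measurable fun p : Sp d × Sp d => stepSq D u p.2 p.1 :=
      measurable_stepSq hD hu measurable_snd measurable_fst
    change Measurable fun p : Sp d × Sp d =>
      G ‖p.2‖ * ENNReal.ofReal ((‖p.2‖ ^ 2)⁻¹) * stepSq D u p.2 p.1
    exact Measurable.mul (by fun_prop) h2

/-- Only the component along z is telescoped, because the projected energy sees nothing else of an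
increment over z. -/
theorem inner_telescope {d : ℕ} (u : Sp d → Sp d) (x z : Sp d) (n : ℕ) :
    ⟪u x, z⟫ = ⟪u (x + (n : ℝ) • z), z⟫ -
      ∑ k ∈ Finset.range n, ⟪u (x + (k : ℝ) • z + z) - u (x + (k : ℝ) • z), z⟫ := by
  induction n with
  | zero => simp
  | succ n ih =>
    have h : x + ((n + 1 : ℕ) : ℝ) • z = x + (n : ℝ) • z + z := by push_cast; module
    rw [Finset.sum_range_succ, ih, h, inner_sub_left]
    ring

/-- Cauchy–Schwarz on the telescoped sum. The walk may stop early, at a zero of u, or complete its N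
steps and end in B. The bound is written with N rather than with the stopping time n, which depends
on x, so that it can be integrated over x. -/
theorem ofReal_inner_sq_le_telescope {d : ℕ} {D B : Set (Sp d)} {u : Sp d → Sp d} {x z : Sp d}
    {n N : ℕ} (hn : n ≤ N) (hD : ∀ k : ℕ, k ≤ n → x + (k : ℝ) • z ∈ D)
    (hend : u (x + (n : ℝ) • z) = 0 ∨ (n = N ∧ x + (n : ℝ) • z ∈ B)) :
    ENNReal.ofReal (⟪u x, z⟫ ^ 2) ≤
      2 * ENNReal.ofReal (‖z‖ ^ 2) *
        (B ∩ D).indicator (fun y => ENNReal.ofReal (‖u y‖ ^ 2)) (x + (N : ℝ) • z) +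
      2 * (N : ℝ≥0∞) * ∑ k ∈ Finset.range N, stepSq D u z (x + (k : ℝ) • z) := by
  set a : ℝ := ⟪u (x + (n : ℝ) • z), z⟫
  set f : ℕ → ℝ := fun k => ⟪u (x + (k : ℝ) • z + z) - u (x + (k : ℝ) • z), z⟫
  have h1 : ⟪u x, z⟫ = a - ∑ k ∈ Finset.range n, f k := inner_telescope u x z n
  have h2 : (∑ k ∈ Finset.range n, f k) ^ 2 ≤ n * ∑ k ∈ Finset.range n, f k ^ 2 := by
    simpa using sq_sum_le_card_mul_sum_sq (s := Finset.range n) (f := f)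
  have h3 : ⟪u x, z⟫ ^ 2 ≤ 2 * a ^ 2 + 2 * (n * ∑ k ∈ Finset.range n, f k ^ 2) := by
    rw [h1]
    nlinarith [sq_nonneg (a + ∑ k ∈ Finset.range n, f k)]
  have hS : 0 ≤ ∑ k ∈ Finset.range n, f k ^ 2 := Finset.sum_nonneg fun _ _ => sq_nonneg _
  refine (ENNReal.ofReal_le_ofReal h3).trans ?_
  rw [ENNReal.ofReal_add (by positivity) (by positivity)]
  refine add_le_add ?_ ?_
  · rcases hend with h0 | ⟨hnN, hB⟩
    · simp [a, h0]
    · subst hnN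
      rw [indicator_of_mem (show _ ∈ B ∩ D from ⟨hB, hD _ le_rfl⟩),
        ENNReal.ofReal_mul (by norm_num), mul_assoc,
        ← ENNReal.ofReal_mul (p := ‖z‖ ^ 2) (by positivity)]
      refine mul_le_mul' (ENNReal.ofReal_ofNat 2).le (ENNReal.ofReal_le_ofReal ?_)
      have := abs_real_inner_le_norm (u (x + (n : ℝ) • z)) z
      rw [← mul_pow, mul_comm ‖z‖]
      exact sq_le_sq' (abs_le.1 this).1 (abs_le.1 this).2
  · rw [ENNReal.ofReal_mul (by norm_num), ENNReal.ofReal_mul (by positivity), mul_assoc,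
      ENNReal.ofReal_sum_of_nonneg (fun _ _ => sq_nonneg _)]
    refine mul_le_mul' (by simp) (mul_le_mul' ?_ ?_)
    · simpa using hn
    · refine le_trans ?_ (Finset.sum_le_sum_of_subset (Finset.range_mono hn))
      refine Finset.sum_le_sum fun k hk => ?_
      rw [Finset.mem_range] at hk
      have hk1 : x + (k : ℝ) • z + z ∈ D := by
        have := hD (k + 1) hk
        push_cast at this
        convert this using 1
        module
      rw [stepSq_of_mem (hD k hk.le) hk1]

/-- The squared norm of `u` on `U` is bounded by the energy, uniformly in the horizon, in the
weight and in the field `u` vanishing on the part of the interaction domain near `x₀`. -/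
def Controls {d : ℕ} (Ω : Set (Sp d)) (a : ℝ) (x₀ : Sp d) (r : ℝ) (U : Set (Sp d)) : Prop :=
  ∃ C : ℝ≥0∞, C ≠ ∞ ∧ ∃ δ₁ : ℝ, 0 < δ₁ ∧ ∀ δ ∈ Ioc 0 δ₁, ∀ G : ℝ → ℝ≥0∞, Measurable G →
    (∀ t, δ ≤ t → G t = 0) → ∀ u : Sp d → Sp d, Measurable u →
    (∀ x ∈ interactionDomain Ω (a * δ) ∩ Metric.ball x₀ r, u x = 0) →
    radialMoment d G * ∫⁻ x in U ∩ extDomain Ω (a * δ), ENNReal.ofReal (‖u x‖ ^ 2) ≤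
      C * radialEnergy G (extDomain Ω (a * δ)) u

theorem Controls.mono {d : ℕ} {Ω : Set (Sp d)} {a : ℝ} {x₀ : Sp d} {r : ℝ} {U V : Set (Sp d)}
    (h : Controls Ω a x₀ r V) (hUV : U ⊆ V) : Controls Ω a x₀ r U := by
  obtain ⟨C, hC, δ₁, hδ₁, H⟩ := h
  refine ⟨C, hC, δ₁, hδ₁, fun δ hδ G hG hG0 u hu hu0 => le_trans ?_ (H δ hδ G hG hG0 u hu hu0)⟩
  gcongr

theorem controls_empty {d : ℕ} {Ω : Set (Sp d)} {a : ℝ} {x₀ : Sp d} {r : ℝ} :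
    Controls Ω a x₀ r ∅ :=
  ⟨0, by simp, 1, one_pos, fun δ hδ G hG hG0 u hu hu0 => by simp⟩

theorem Controls.union {d : ℕ} {Ω : Set (Sp d)} {a : ℝ} {x₀ : Sp d} {r : ℝ} {U V : Set (Sp d)}
    (hU : Controls Ω a x₀ r U) (hV : Controls Ω a x₀ r V) : Controls Ω a x₀ r (U ∪ V) := by
  obtain ⟨C, hC, δ₁, hδ₁, H⟩ := hU
  obtain ⟨C', hC', δ₁', hδ₁', H'⟩ := hV
  refine ⟨C + C', by simp [hC, hC'], min δ₁ δ₁', lt_min hδ₁ hδ₁',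
    fun δ hδ G hG hG0 u hu hu0 => ?_⟩
  have h1 := H δ ⟨hδ.1, hδ.2.trans (min_le_left _ _)⟩ G hG hG0 u hu hu0
  have h2 := H' δ ⟨hδ.1, hδ.2.trans (min_le_right _ _)⟩ G hG hG0 u hu hu0
  rw [union_inter_distrib_right, add_mul]
  refine le_trans ?_ (add_le_add h1 h2)
  rw [← mul_add]
  gcongr
  exact lintegral_union_le _ _ _

/-- Control is inherited along the lines in an open cone of directions. -/
theorem Controls.transfer {d : ℕ} (hd : 1 ≤ d) {Ω : Set (Sp d)} {a : ℝ} (ha : 0 < a) {x₀ : Sp d}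
    {r : ℝ} {U B : Set (Sp d)} (hB : Controls Ω a x₀ r B) (hBm : MeasurableSet B)
    (hUm : MeasurableSet U) {e : Sp d} (he : ‖e‖ = 1) {κ : ℝ} (hκ : 0 < κ) {l : ℝ} (hl : 0 ≤ l)
    (H : ∃ δ₁ : ℝ, 0 < δ₁ ∧ ∀ δ ∈ Ioc 0 δ₁, ∀ x ∈ U ∩ extDomain Ω (a * δ), ∀ z ∈ openCone e κ,
      0 < ‖z‖ → ‖z‖ < δ → ∃ n ≤ ⌊l / ‖z‖⌋₊,
        (∀ k : ℕ, k ≤ n → x + (k : ℝ) • z ∈ extDomain Ω (a * δ)) ∧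
        (x + (n : ℝ) • z ∈ interactionDomain Ω (a * δ) ∩ Metric.ball x₀ r ∨
          (n = ⌊l / ‖z‖⌋₊ ∧ x + (n : ℝ) • z ∈ B))) :
    Controls Ω a x₀ r U := by
  obtain ⟨C, hC, δ₁, hδ₁, HB⟩ := hB
  obtain ⟨δ₂, hδ₂, H⟩ := H
  obtain ⟨c, hc0, hct, hcb⟩ := exists_cone_average_bound hd he hκ
  refine ⟨c⁻¹ * (2 * C + 2 * ENNReal.ofReal (l ^ 2)), ?_, min δ₁ δ₂, lt_min hδ₁ hδ₂, ?_⟩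
  · exact ENNReal.mul_ne_top (ENNReal.inv_ne_top.2 hc0)
      (by simp [ENNReal.mul_eq_top, hC])
  intro δ hδ G hG hG0 u hu hu0
  have hδ1 : δ ∈ Ioc 0 δ₁ := ⟨hδ.1, hδ.2.trans (min_le_left _ _)⟩
  have hδ2 : δ ∈ Ioc 0 δ₂ := ⟨hδ.1, hδ.2.trans (min_le_right _ _)⟩
  have hIB := HB δ hδ1 G hG hG0 u hu hu0
  have H := H δ hδ2
  have hD : MeasurableSet (extDomain Ω (a * δ)) := measurableSet_extDomain Ω (mul_pos ha hδ.1)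
  set D := extDomain Ω (a * δ) with hDdef
  set m := radialMoment d G with hm
  set IU := ∫⁻ x in U ∩ D, ENNReal.ofReal (‖u x‖ ^ 2) with hIU
  set IB := ∫⁻ x in B ∩ D, ENNReal.ofReal (‖u x‖ ^ 2) with hIBdef
  -- The estimate for a single step vector, before averaging over directions.
  have key : ∀ z ∈ openCone e κ, G ‖z‖ * ∫⁻ x in U ∩ D, ENNReal.ofReal (⟪u x, z⟫ ^ 2) ≤
      2 * IB * (G ‖z‖ * ENNReal.ofReal (‖z‖ ^ 2)) + 2 * ENNReal.ofReal (l ^ 2) *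
        (G ‖z‖ * ENNReal.ofReal ((‖z‖ ^ 2)⁻¹) * ∫⁻ x, stepSq D u z x) := by
    intro z hz
    rcases lt_or_ge ‖z‖ δ with hzδ | hzδ
    swap
    · simp [hG0 _ hzδ]
    have hz0 : 0 < ‖z‖ := by
      rcases (norm_nonneg z).eq_or_lt with h | h
      · simp only [openCone, mem_ofPred_eq, ← h, mul_zero] at hz
        exact absurd hz (not_lt.2 (norm_nonneg _))
      · exact h
    set N := ⌊l / ‖z‖⌋₊ with hN
    have hNl : (N : ℝ) * ‖z‖ ≤ l := by
      have := Nat.floor_le (a := l / ‖z‖) (by positivity)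
      rwa [le_div_iff₀ hz0] at this
    have h1 : ∫⁻ x in U ∩ D, ENNReal.ofReal (⟪u x, z⟫ ^ 2) ≤
        ∫⁻ x, (2 * ENNReal.ofReal (‖z‖ ^ 2) *
          (B ∩ D).indicator (fun y => ENNReal.ofReal (‖u y‖ ^ 2)) (x + (N : ℝ) • z) +
          2 * (N : ℝ≥0∞) * ∑ k ∈ Finset.range N, stepSq D u z (x + (k : ℝ) • z)) := by
      rw [← lintegral_indicator (hUm.inter hD)]
      refine lintegral_mono fun x => ?_
      by_cases hx : x ∈ U ∩ D
      · rw [indicator_of_mem hx]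
        obtain ⟨n, hn, hnD, hend⟩ := H x hx z hz hz0 hzδ
        refine ofReal_inner_sq_le_telescope hn hnD ?_
        exact hend.imp (fun h => hu0 _ h) id
      · simp [hx]
    -- By translation invariance each of the N steps costs the same integral; with the
    -- Cauchy–Schwarz factor N the total is N².
    have h2 : ∀ k : ℕ, ∫⁻ x, stepSq D u z (x + (k : ℝ) • z) = ∫⁻ x, stepSq D u z x :=
      fun k => lintegral_add_right_eq_self (fun x => stepSq D u z x) _
    have hsz : Measurable fun x => stepSq D u z x := 
      measurable_stepSq hD hu measurable_const measurable_id
    have h3 : ∫⁻ x, (2 * ENNReal.ofReal (‖z‖ ^ 2) *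
          (B ∩ D).indicator (fun y => ENNReal.ofReal (‖u y‖ ^ 2)) (x + (N : ℝ) • z) +
          2 * (N : ℝ≥0∞) * ∑ k ∈ Finset.range N, stepSq D u z (x + (k : ℝ) • z)) =
        2 * ENNReal.ofReal (‖z‖ ^ 2) * IB +
          2 * (N : ℝ≥0∞) * (N * ∫⁻ x, stepSq D u z x) := by
      have hind : Measurable ((B ∩ D).indicator fun y => ENNReal.ofReal (‖u y‖ ^ 2)) :=
        Measurable.indicator (by fun_prop) (hBm.inter hD)
      rw [lintegral_add_left, lintegral_const_mul, lintegral_const_mul, lintegral_finsetSum]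
      · simp_rw [h2]
        rw [lintegral_add_right_eq_self
          ((B ∩ D).indicator (fun y => ENNReal.ofReal (‖u y‖ ^ 2))),
          lintegral_indicator (hBm.inter hD)]
        simp [hIBdef]
      · intro k _; exact hsz.comp (measurable_id.add_const _)
      · exact Finset.measurable_sum _ fun k _ => hsz.comp (measurable_id.add_const _)
      · exact hind.comp (measurable_id.add_const _)
      · exact (hind.comp (measurable_id.add_const _)).const_mul _
    rw [h3] at h1
    -- The loss N² is at most l²/‖z‖², and ‖z‖⁻² is the weight in `radialEnergy_eq`. Hence the
    -- constant does not deteriorate as the horizon shrinks.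
    have h4 : (N : ℝ≥0∞) * N ≤ ENNReal.ofReal (l ^ 2) * ENNReal.ofReal ((‖z‖ ^ 2)⁻¹) := by
      rw [← ENNReal.ofReal_mul (by positivity), ← ENNReal.ofReal_natCast,
        ← ENNReal.ofReal_mul (by positivity)]
      apply ENNReal.ofReal_le_ofReal
      rw [← div_eq_mul_inv, le_div_iff₀ (by positivity)]
      calc (N : ℝ) * N * ‖z‖ ^ 2 = (N * ‖z‖) ^ 2 := by ring
        _ ≤ l ^ 2 := by gcongr
    calc G ‖z‖ * ∫⁻ x in U ∩ D, ENNReal.ofReal (⟪u x, z⟫ ^ 2)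
        ≤ G ‖z‖ * (2 * ENNReal.ofReal (‖z‖ ^ 2) * IB +
          2 * (N : ℝ≥0∞) * (N * ∫⁻ x, stepSq D u z x)) := by gcongr
      _ = 2 * IB * (G ‖z‖ * ENNReal.ofReal (‖z‖ ^ 2)) +
          2 * (N * N) * (G ‖z‖ * ∫⁻ x, stepSq D u z x) := by ring
      _ ≤ 2 * IB * (G ‖z‖ * ENNReal.ofReal (‖z‖ ^ 2)) +
          2 * (ENNReal.ofReal (l ^ 2) * ENNReal.ofReal ((‖z‖ ^ 2)⁻¹)) *
            (G ‖z‖ * ∫⁻ x, stepSq D u z x) := by gcongr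
      _ = _ := by ring
  -- The cone average replaces the projections ⟪u x, z⟫ by the full norm of u x.
  have hmain : c * (m * IU) ≤ (2 * C + 2 * ENNReal.ofReal (l ^ 2)) * radialEnergy G D u := by
    calc c * (m * IU) = ∫⁻ x in U ∩ D, c * m * ENNReal.ofReal (‖u x‖ ^ 2) := by
          rw [lintegral_const_mul _ (by fun_prop), mul_assoc]
      _ ≤ ∫⁻ x in U ∩ D, ∫⁻ z in openCone e κ, G ‖z‖ * ENNReal.ofReal (⟪u x, z⟫ ^ 2) :=
          lintegral_mono fun x => hcb G hG (u x)
      _ = ∫⁻ z in openCone e κ, G ‖z‖ * ∫⁻ x in U ∩ D, ENNReal.ofReal (⟪u x, z⟫ ^ 2) := by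
          rw [lintegral_lintegral_swap (by apply Measurable.aemeasurable; fun_prop)]
          refine lintegral_congr fun z => ?_
          rw [lintegral_const_mul _ (by fun_prop)]
      _ ≤ ∫⁻ z in openCone e κ, (2 * IB * (G ‖z‖ * ENNReal.ofReal (‖z‖ ^ 2)) +
          2 * ENNReal.ofReal (l ^ 2) *
          (G ‖z‖ * ENNReal.ofReal ((‖z‖ ^ 2)⁻¹) * ∫⁻ x, stepSq D u z x)) :=
          setLIntegral_mono' (measurableSet_openCone e κ) key
      _ ≤ ∫⁻ z, (2 * IB * (G ‖z‖ * ENNReal.ofReal (‖z‖ ^ 2)) +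
          2 * ENNReal.ofReal (l ^ 2) *
          (G ‖z‖ * ENNReal.ofReal ((‖z‖ ^ 2)⁻¹) * ∫⁻ x, stepSq D u z x)) :=
          setLIntegral_le_lintegral _ _
      _ = 2 * IB * m + 2 * ENNReal.ofReal (l ^ 2) * radialEnergy G D u := by
          have hms : Measurable fun z => ∫⁻ x, stepSq D u z x := 
            (measurable_stepSq hD hu measurable_fst measurable_snd).lintegral_prod_right'
          rw [lintegral_add_left (by fun_prop), lintegral_const_mul _ (by fun_prop),
            lintegral_const_mul _ (by fun_prop), radialEnergy_eq hG hD hu, hm, radialMoment]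
      _ = 2 * (m * IB) + 2 * ENNReal.ofReal (l ^ 2) * radialEnergy G D u := by ring
      _ ≤ 2 * (C * radialEnergy G D u) + 2 * ENNReal.ofReal (l ^ 2) * radialEnergy G D u := by
          gcongr
      _ = _ := by ring
  calc m * IU = c⁻¹ * (c * (m * IU)) := by
        rw [← mul_assoc, ENNReal.inv_mul_cancel hc0 hct, one_mul]
    _ ≤ c⁻¹ * ((2 * C + 2 * ENNReal.ofReal (l ^ 2)) * radialEnergy G D u) := by gcongr
    _ = _ := by ring

/-- Control of a ball is inherited by the balls from which it is seen inside the domain. -/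
theorem Controls.of_rays {d : ℕ} (hd : 1 ≤ d) {Ω : Set (Sp d)} {a : ℝ} (ha : 0 < a) {x₀ : Sp d}
    {r : ℝ} {p e : Sp d} (he : ‖e‖ = 1) {l κ ε ε' : ℝ} (hl : 0 ≤ l) (hκ : 0 < κ) (hε : 0 < ε)
    (hε' : ε' ≤ ε / 4) (hκl : κ * l ≤ ε / 4)
    (hB : Controls Ω a x₀ r (Metric.ball (p + l • e) ε))
    (H : ∃ δ₁ : ℝ, 0 < δ₁ ∧ ∀ δ ∈ Ioc 0 δ₁, ∀ x ∈ Metric.ball p ε' ∩ extDomain Ω (a * δ),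
      ∀ (t : ℝ) (v : Sp d), 0 ≤ t → t ≤ l → ‖v - t • e‖ ≤ κ * t → x + v ∈ extDomain Ω (a * δ)) :
    Controls Ω a x₀ r (Metric.ball p ε') := by
  obtain ⟨δ₁, hδ₁, H⟩ := H
  refine hB.transfer hd ha measurableSet_ball measurableSet_ball he hκ hl
    ⟨min δ₁ (ε / 4), by positivity, fun δ hδ x hx z hz hz0 hzδ =>
      ⟨⌊l / ‖z‖⌋₊, le_rfl, fun k hk => ?_, Or.inr ⟨rfl, ?_⟩⟩⟩
  all_goals
    have hcone : ∀ k : ℕ, ‖(k : ℝ) • z - ((k : ℝ) * ‖z‖) • e‖ ≤ κ * (k * ‖z‖) := fun k => by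
      rw [mul_smul, ← smul_sub, norm_smul, Real.norm_natCast]
      calc (k : ℝ) * ‖z - ‖z‖ • e‖ ≤ k * (κ * ‖z‖) := by gcongr; exact le_of_lt hz
        _ = _ := by ring
    have hNl : (⌊l / ‖z‖⌋₊ : ℝ) * ‖z‖ ≤ l := by
      have := Nat.floor_le (a := l / ‖z‖) (by positivity)
      rwa [le_div_iff₀ hz0] at this
  · refine H δ ⟨hδ.1, hδ.2.trans (min_le_left _ _)⟩ x hx (k * ‖z‖) _ (by positivity) ?_ (hcone k)
    refine le_trans ?_ hNl
    gcongr
  -- The endpoint misses p + l e by three errors: the starting offset, below ε/4; the deviation from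
  -- the axis, at most κl ≤ ε/4; and the rounding of l to a multiple of ‖z‖, at most ‖z‖ < δ ≤ ε/4.
  · have hN2 : l - ‖z‖ < (⌊l / ‖z‖⌋₊ : ℝ) * ‖z‖ := by
      have := Nat.lt_floor_add_one (l / ‖z‖)
      rw [div_lt_iff₀ hz0] at this
      linarith
    have hδε := hδ.2.trans (min_le_right _ _)
    have hx1 := hx.1
    rw [Metric.mem_ball, dist_eq_norm] at hx1 ⊢
    set N := ⌊l / ‖z‖⌋₊
    have h1 := hcone N
    have h2 : ‖((N : ℝ) * ‖z‖ - l) • e‖ ≤ ‖z‖ := by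
      rw [norm_smul, he, mul_one, Real.norm_eq_abs, abs_le]
      constructor <;> linarith
    have h3 : x + (N : ℝ) • z - (p + l • e) = (x - p) + ((N : ℝ) • z - ((N : ℝ) * ‖z‖) • e) +
        ((N : ℝ) * ‖z‖ - l) • e := by module
    have h4 : κ * (N * ‖z‖) ≤ κ * l := by gcongr
    rw [h3]
    refine (norm_add₃_le).trans_lt ?_
    linarith

/-- Rays from a small ball around x towards y stay in the ball of radius 2η, hence in Ω, so control
at y is handed to x. The opening (ε/4)/‖y - x‖ keeps the lateral deviation below ε/4 over the length
‖y - x‖. -/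
theorem exists_controls_ball_of_near {d : ℕ} (hd : 1 ≤ d) {Ω : Set (Sp d)} {a : ℝ} (ha : 0 < a)
    {x₀ : Sp d} {r : ℝ} {x y : Sp d} {η ε : ℝ} (hη : Metric.ball x (2 * η) ⊆ Ω) (hε : 0 < ε)
    (hεη : ε ≤ η) (hxy : ‖y - x‖ < η) (hy : Controls Ω a x₀ r (Metric.ball y ε)) :
    Controls Ω a x₀ r (Metric.ball x (ε / 4)) := by
  by_cases hne : y - x = 0
  · rw [sub_eq_zero] at hne
    subst hne
    exact hy.mono (Metric.ball_subset_ball (by linarith))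
  have hl : 0 < ‖y - x‖ := norm_pos_iff.2 hne
  have hye : x + ‖y - x‖ • (‖y - x‖⁻¹ • (y - x)) = y := by
    rw [smul_smul, mul_inv_cancel₀ hl.ne', one_smul]; abel
  have hκl : ε / 4 / ‖y - x‖ * ‖y - x‖ = ε / 4 := by field_simp
  refine Controls.of_rays hd ha (e := ‖y - x‖⁻¹ • (y - x)) (norm_smul_inv_norm hne) hl.le
    (κ := ε / 4 / ‖y - x‖) (by positivity) hε le_rfl hκl.le (by rwa [hye])
    ⟨1, one_pos, fun δ hδ x' hx' t v ht htl hv => Or.inl (hη ?_)⟩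
  have hx1 := hx'.1
  rw [Metric.mem_ball, dist_eq_norm] at hx1 ⊢
  have h1 : ‖t • (‖y - x‖⁻¹ • (y - x))‖ = t := by
    have he : ‖‖y - x‖⁻¹ • (y - x)‖ = 1 := norm_smul_inv_norm hne
    rw [norm_smul, he, Real.norm_eq_abs, abs_of_nonneg ht, mul_one]
  have h2 : ε / 4 / ‖y - x‖ * t ≤ ε / 4 := by
    calc ε / 4 / ‖y - x‖ * t ≤ ε / 4 / ‖y - x‖ * ‖y - x‖ := by gcongr
      _ = ε / 4 := hκl
  have h3 : x' + v - x = (x' - x) + (v - t • (‖y - x‖⁻¹ • (y - x))) +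
      t • (‖y - x‖⁻¹ • (y - x)) := by module
  rw [h3]
  refine norm_add₃_le.trans_lt ?_
  linarith

/-- The starting point of the propagation. Walks from near x₀ in directions close to -e must leave
Ω, and their first point outside lies in the interaction domain near x₀, where u = 0. No previously
controlled set is needed, so the transfer starts from the empty set. -/
theorem exists_controls_ball_near_patch {d : ℕ} (hd : 1 ≤ d) {Ω : Set (Sp d)}
    (hΩ : IsLipschitzDomain Ω) {a : ℝ} (ha : 1 ≤ a) {x₀ : Sp d} (hx₀ : x₀ ∈ frontier Ω) {r : ℝ}
    (hr : 0 < r) :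
    ∃ y ∈ Ω, ∃ ε : ℝ, 0 < ε ∧ Controls Ω a x₀ r (Metric.ball y ε) := by
  obtain ⟨r₁, hr₁, e, he, κ, hκ, hκ1, hcone⟩ := exists_cone_of_mem_frontier hΩ.lipschitz hx₀
  have hx₀Ω : x₀ ∉ Ω := by
    rw [hΩ.isOpen.frontier_eq] at hx₀; exact hx₀.2
  set R := min r r₁ with hR
  have hRpos : 0 < R := lt_min hr hr₁
  set l := R / 4 with hl
  have hlpos : 0 < l := by positivity
  obtain ⟨y, hyΩ, hy⟩ := Metric.mem_closure_iff.1 (frontier_subset_closure hx₀) (κ * l / 8)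
    (by positivity)
  obtain ⟨ε₁, hε₁, hball⟩ := Metric.isOpen_iff.1 hΩ.isOpen y hyΩ
  refine ⟨y, hyΩ, min ε₁ (κ * l / 8), by positivity, ?_⟩
  have hclose : ∀ x ∈ Metric.ball y (min ε₁ (κ * l / 8)), ‖x₀ - x‖ ≤ κ * l / 4 := by
    intro x hx
    have h1 := Metric.mem_ball.1 (Metric.ball_subset_ball (min_le_right _ _) hx)
    have h2 := dist_triangle x₀ y x
    rw [dist_comm y x, dist_eq_norm] at h2
    linarith
  have he' : ‖-e‖ = 1 := by rwa [norm_neg]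
  refine (controls_empty).transfer hd (by linarith) MeasurableSet.empty measurableSet_ball he'
    (κ := κ / 2) (by positivity) hlpos.le
    ⟨l / 2, by positivity, fun δ hδ x hx z hz hz0 hzδ => ?_⟩
  have hxΩ : x ∈ Ω := hball (Metric.ball_subset_ball (min_le_left _ _) hx.1)
  have hx1 := hclose x hx.1
  have hconez : ∀ k : ℕ, ‖(k : ℝ) • z + ((k : ℝ) * ‖z‖) • e‖ ≤ κ / 2 * (k * ‖z‖) := fun k => by
    have hz' : ‖z - ‖z‖ • -e‖ < κ / 2 * ‖z‖ := hz
    have : (k : ℝ) • z + ((k : ℝ) * ‖z‖) • e = (k : ℝ) • (z - ‖z‖ • -e) := by module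
    rw [this, norm_smul, Real.norm_natCast]
    calc (k : ℝ) * ‖z - ‖z‖ • -e‖ ≤ k * (κ / 2 * ‖z‖) := by gcongr
      _ = _ := by ring
  have hNl : (⌊l / ‖z‖⌋₊ : ℝ) * ‖z‖ ≤ l := by
    have := Nat.floor_le (a := l / ‖z‖) (by positivity)
    rwa [le_div_iff₀ hz0] at this
  have hN2 : l - ‖z‖ < (⌊l / ‖z‖⌋₊ : ℝ) * ‖z‖ := by
    have := Nat.lt_floor_add_one (l / ‖z‖)
    rw [div_lt_iff₀ hz0] at this
    linarith
  have hnear : ∀ k : ℕ, k ≤ ⌊l / ‖z‖⌋₊ → x + (k : ℝ) • z ∈ Metric.ball x₀ R := by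
    intro k hk
    have hkl : (k : ℝ) * ‖z‖ ≤ l := le_trans (by gcongr) hNl
    rw [Metric.mem_ball, dist_eq_norm]
    have h3 : x + (k : ℝ) • z - x₀ = -(x₀ - x) + (k : ℝ) • z := by module
    rw [h3]
    have h4 : ‖(k : ℝ) • z‖ ≤ l := by rwa [norm_smul, Real.norm_natCast]
    refine (norm_add_le _ _).trans_lt ?_
    rw [norm_neg]
    nlinarith
  -- If the endpoint were in Ω, the interior cone at it would contain x₀, which is not in the open
  -- set Ω. The aperture κ is split: κ/2 for the walk, and the rest for the offset of x from x₀, at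
  -- most κl/4, which fits because the walk has length at least l/2.
  have hout : x + ((⌊l / ‖z‖⌋₊ : ℕ) : ℝ) • z ∉ Ω := by
    intro hmem
    set N := ⌊l / ‖z‖⌋₊
    apply hx₀Ω
    have h5 := hcone (x + (N : ℝ) • z) ⟨hmem, Metric.ball_subset_ball (min_le_right _ _)
      (hnear N le_rfl)⟩ (N * ‖z‖) (x₀ - (x + (N : ℝ) • z)) (by positivity) ?_ ?_
    · simpa using h5
    · have h6 : x₀ - (x + (N : ℝ) • z) - ((N : ℝ) * ‖z‖) • e =
          (x₀ - x) - ((N : ℝ) • z + ((N : ℝ) * ‖z‖) • e) := by module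
      rw [h6]
      refine (norm_sub_le _ _).trans ?_
      have h7 := hconez N
      have h8 : l / 2 ≤ N * ‖z‖ := by linarith [hδ.2]
      nlinarith
    · simpa using hr₁
  classical
  have hex : ∃ n : ℕ, x + (n : ℝ) • z ∉ Ω := ⟨_, hout⟩
  have hfind : x + ((Nat.find hex : ℕ) : ℝ) • z ∉ Ω := Nat.find_spec hex
  have hbelow : ∀ k < Nat.find hex, x + (k : ℝ) • z ∈ Ω := fun k hk => by
    simpa using Nat.find_min hex hk
  have hle : Nat.find hex ≤ ⌊l / ‖z‖⌋₊ := Nat.find_min' hex hout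
  set n := Nat.find hex
  have hn0 : n ≠ 0 := by
    intro h
    rw [h] at hfind
    simp only [Nat.cast_zero, zero_smul, add_zero] at hfind
    exact hfind hxΩ
  obtain ⟨m, hm⟩ := Nat.exists_eq_succ_of_ne_zero hn0
  -- The preceding point of the walk is in Ω at distance ‖z‖ < δ ≤ aδ; this uses a ≥ 1.
  have hint : x + (n : ℝ) • z ∈ interactionDomain Ω (a * δ) := by
    refine ⟨hfind, x + (m : ℝ) • z, hbelow m (by omega), ?_⟩
    have : x + (n : ℝ) • z - (x + (m : ℝ) • z) = z := by
      rw [hm]; push_cast; module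
    rw [this]
    nlinarith [hδ.1]
  refine ⟨n, hle, fun k hk => ?_, Or.inl ⟨hint, ?_⟩⟩
  · rcases hk.eq_or_lt with h | h
    · rw [h]; exact Or.inr hint
    · exact Or.inl (hbelow k h)
  · exact Metric.ball_subset_ball (min_le_left _ _) (hnear n hle)

/-- Connectedness of Ω: the set of points with a controlled neighbourhood is open, meets Ω near the
patch, and is relatively closed in Ω because control passes from y to any x that is close to y
compared with the distance from x to the complement. -/
theorem exists_controls_ball_of_mem {d : ℕ} (hd : 1 ≤ d) {Ω : Set (Sp d)}
    (hΩ : IsLipschitzDomain Ω) {a : ℝ} (ha : 1 ≤ a) {x₀ : Sp d} (hx₀ : x₀ ∈ frontier Ω) {r : ℝ}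
    (hr : 0 < r) : ∀ x ∈ Ω, ∃ ε : ℝ, 0 < ε ∧ Controls Ω a x₀ r (Metric.ball x ε) := by
  set V : Set (Sp d) := {x | ∃ ε : ℝ, 0 < ε ∧ Controls Ω a x₀ r (Metric.ball x ε)} with hV
  have hVo : IsOpen V := by
    rw [Metric.isOpen_iff]
    rintro x ⟨ε, hε, hx⟩
    refine ⟨ε / 2, by positivity, fun y hy => ⟨ε / 2, by positivity, hx.mono ?_⟩⟩
    apply Metric.ball_subset_ball'
    rw [Metric.mem_ball] at hy
    linarith
  obtain ⟨y, hyΩ, ε, hε, hy⟩ := exists_controls_ball_near_patch hd hΩ ha hx₀ hr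
  refine hΩ.isConnected.isPreconnected.subset_of_closure_inter_subset hVo ⟨y, hyΩ, ε, hε, hy⟩ ?_
  rintro x ⟨hxV, hxΩ⟩
  obtain ⟨η, hη, hball⟩ := Metric.isOpen_iff.1 hΩ.isOpen x hxΩ
  obtain ⟨y, ⟨ε, hε, hy⟩, hxy⟩ := Metric.mem_closure_iff.1 hxV (η / 2) (by positivity)
  refine ⟨min ε (η / 2) / 4, by positivity, ?_⟩
  refine exists_controls_ball_of_near hd (by linarith) (η := η / 2) (y := y)
    (by rwa [mul_div_cancel₀ _ two_ne_zero]) (by positivity) (min_le_right _ _) ?_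
    (hy.mono (Metric.ball_subset_ball (min_le_left _ _)))
  rwa [← dist_eq_norm, dist_comm]

/-- Going inward from p along the cone axis reaches a point of Ω, where control is known. Walks that
start in the boundary layer stay in the extended domain: a point x there has a companion y in Ω at
distance below aδ, and the cone condition moves y, and x with it, inward. -/
theorem exists_controls_ball_of_mem_frontier {d : ℕ} (hd : 1 ≤ d) {Ω : Set (Sp d)}
    (hΩ : IsLipschitzDomain Ω) {a : ℝ} (ha : 1 ≤ a) {x₀ : Sp d} (hx₀ : x₀ ∈ frontier Ω) {r : ℝ}
    (hr : 0 < r) {p : Sp d} (hp : p ∈ frontier Ω) :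
    ∃ ε : ℝ, 0 < ε ∧ Controls Ω a x₀ r (Metric.ball p ε) := by
  obtain ⟨R, hR, e, he, κ, hκ, hκ1, hcone⟩ := exists_cone_of_mem_frontier hΩ.lipschitz hp
  set l := R / 4 with hl
  have hlpos : 0 < l := by positivity
  have hq : p + l • e ∈ Ω := by
    obtain ⟨y, hyΩ, hy⟩ := Metric.mem_closure_iff.1 (frontier_subset_closure hp) (κ * l)
      (by positivity)
    have hyR : y ∈ Metric.ball p R := by
      rw [Metric.mem_ball, dist_comm]; nlinarith
    have h := hcone y ⟨hyΩ, hyR⟩ l (p + l • e - y) hlpos.le ?_ ?_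
    · simpa using h
    · have : p + l • e - y - l • e = p - y := by abel
      rw [this, ← dist_eq_norm]; exact hy.le
    · rw [add_sub_cancel, Metric.mem_ball, dist_eq_norm, add_sub_cancel_left, norm_smul, he,
        Real.norm_eq_abs, abs_of_pos hlpos]
      linarith
  obtain ⟨ε, hε, hB⟩ := exists_controls_ball_of_mem hd hΩ ha hx₀ hr _ hq
  refine ⟨min (ε / 4) (R / 8), by positivity, ?_⟩
  have ha0 : 0 < a := by linarith
  have hκ' : 0 < min κ (ε / 4 / l) := by positivity
  refine hB.of_rays hd ha0 he hlpos.le hκ' hε (min_le_left _ _) ?_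
    ⟨R / 8 / a, by positivity, fun δ hδ x hx t v ht htl hv => ?_⟩
  · calc min κ (ε / 4 / l) * l ≤ ε / 4 / l * l := by gcongr; exact min_le_right _ _
      _ = ε / 4 := by field_simp
  · have haδ : 0 < a * δ := mul_pos ha0 hδ.1
    have haδ2 : a * δ ≤ R / 8 := by
      have := hδ.2
      rwa [le_div_iff₀ ha0, mul_comm] at this
    obtain ⟨hx1, hx2⟩ := hx
    rw [extDomain_eq_thickening Ω haδ, Metric.mem_thickening_iff] at hx2 ⊢
    obtain ⟨y, hyΩ, hxy⟩ := hx2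
    have hx3 := Metric.mem_ball.1 (Metric.ball_subset_ball (min_le_right _ _) hx1)
    have hyp : dist y p < R / 8 + R / 8 := by
      have := dist_triangle y x p
      rw [dist_comm y x] at this
      linarith
    have hv' : ‖v - t • e‖ ≤ κ * t := hv.trans (by gcongr; exact min_le_left _ _)
    have hvn : ‖v‖ ≤ 2 * l := by
      have h1 := norm_add_le (v - t • e) (t • e)
      rw [sub_add_cancel, norm_smul t e, he, Real.norm_eq_abs, abs_of_nonneg ht] at h1
      nlinarith
    -- Translating both points by v preserves their distance, so y + v witnesses that x + v is in
    -- the extended domain.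
    refine ⟨y + v, hcone y ⟨hyΩ, ?_⟩ t v ht hv' ?_, ?_⟩
    · rw [Metric.mem_ball]; linarith
    · rw [Metric.mem_ball]
      have h1 := dist_triangle (y + v) y p
      rw [dist_eq_norm (y + v) y, add_sub_cancel_left] at h1
      linarith
    · rwa [dist_add_right]

/-- **Nonlocal Korn–Poincaré inequality** for radial weights, uniform in the horizon, for fields
that vanish on a patch of the interaction domain. -/
theorem exists_korn_poincare {d : ℕ} (hd : 1 ≤ d) {Ω : Set (Sp d)} (hΩ : IsLipschitzDomain Ω)
    {a : ℝ} (ha : 1 ≤ a) {x₀ : Sp d} (hx₀ : x₀ ∈ frontier Ω) {r : ℝ} (hr : 0 < r) :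
    ∃ C : ℝ≥0∞, C ≠ ∞ ∧ ∃ δ₁ : ℝ, 0 < δ₁ ∧ ∀ δ ∈ Ioc 0 δ₁, ∀ G : ℝ → ℝ≥0∞, Measurable G →
      (∀ t, δ ≤ t → G t = 0) → ∀ u : Sp d → Sp d, Measurable u →
      (∀ x ∈ interactionDomain Ω (a * δ) ∩ Metric.ball x₀ r, u x = 0) →
      radialMoment d G * ∫⁻ x in extDomain Ω (a * δ), ENNReal.ofReal (‖u x‖ ^ 2) ≤
        C * radialEnergy G (extDomain Ω (a * δ)) u := by
  have hcomp : IsCompact (closure Ω) :=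
    Metric.isCompact_of_isClosed_isBounded isClosed_closure hΩ.isBounded.closure
  -- Compactness of the closure reduces the local constants and local horizon thresholds to finitely
  -- many.
  have hcover : ∃ V, IsOpen V ∧ closure Ω ⊆ V ∧ Controls Ω a x₀ r V := by
    refine hcomp.induction_on (p := fun s => ∃ V, IsOpen V ∧ s ⊆ V ∧ Controls Ω a x₀ r V)
      ⟨∅, isOpen_empty, subset_rfl, controls_empty⟩ ?_ ?_ ?_
    · rintro s t hst ⟨V, hV, htV, hc⟩
      exact ⟨V, hV, hst.trans htV, hc⟩
    · rintro s t ⟨V, hV, hsV, hc⟩ ⟨W, hW, htW, hc'⟩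
      exact ⟨V ∪ W, hV.union hW, union_subset_union hsV htW, hc.union hc'⟩
    · intro x hx
      obtain ⟨ε, hε, hc⟩ : ∃ ε : ℝ, 0 < ε ∧ Controls Ω a x₀ r (Metric.ball x ε) := by
        by_cases hxΩ : x ∈ Ω
        · exact exists_controls_ball_of_mem hd hΩ ha hx₀ hr x hxΩ
        · refine exists_controls_ball_of_mem_frontier hd hΩ ha hx₀ hr ?_
          rw [hΩ.isOpen.frontier_eq]; exact ⟨hx, hxΩ⟩
      exact ⟨Metric.ball x ε, mem_nhdsWithin_of_mem_nhds (Metric.ball_mem_nhds x hε),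
        Metric.ball x ε, Metric.isOpen_ball, subset_rfl, hc⟩
  obtain ⟨V, hVo, hV, C, hC, δ₁, hδ₁, H⟩ := hcover
  obtain ⟨δ₂, hδ₂, hthick⟩ := hcomp.exists_thickening_subset_open hVo hV
  have ha0 : 0 < a := by linarith
  refine ⟨C, hC, min δ₁ (δ₂ / a), by positivity, fun δ hδ G hG hG0 u hu hu0 => ?_⟩
  have h1 := H δ ⟨hδ.1, hδ.2.trans (min_le_left _ _)⟩ G hG hG0 u hu hu0
  -- For small δ the extended domain lies in the open neighbourhood V of the closure, so no part of
  -- it is left uncontrolled.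
  have h2 : extDomain Ω (a * δ) ⊆ V := by
    rw [extDomain_eq_thickening Ω (mul_pos ha0 hδ.1)]
    refine (Metric.thickening_mono ?_ Ω).trans
      ((Metric.thickening_subset_of_subset δ₂ subset_closure).trans hthick)
    have := hδ.2.trans (min_le_right _ _)
    rwa [le_div_iff₀ ha0, mul_comm] at this
  rwa [inter_eq_self_of_subset_right h2] at h1

/-! ### Symmetric kernels and the measures they define on pairs of points -/

/-- A symmetric nonnegative kernel whose rows have bounded mass. -/
structure IsPairKernel {X : Type*} [MeasurableSpace X] (μ : Measure X) (k : X → X → ℝ)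
    (B : ℝ≥0∞) : Prop where
  measurable : Measurable (Function.uncurry k)
  nonneg : ∀ x y, 0 ≤ k x y
  symm : ∀ x y, k x y = k y x
  ne_top : B ≠ ∞
  bound : ∀ᵐ x ∂μ, ∫⁻ y, ENNReal.ofReal (k x y) ∂μ ≤ B

/-- The measure `k(x, y) dμ(x) dμ(y)`. -/
def pairMeasure {X : Type*} [MeasurableSpace X] (μ : Measure X) (k : X → X → ℝ) :
    Measure (X × X) :=
  (μ.prod μ).withDensity fun p => ENNReal.ofReal (k p.1 p.2)

namespace IsPairKernel

theorem measurable_density {X : Type*} [MeasurableSpace X] {μ : Measure X} {k : X → X → ℝ}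
    {B : ℝ≥0∞} (hk : IsPairKernel μ k B) :
    Measurable fun p : X × X => ENNReal.ofReal (k p.1 p.2) :=
  hk.measurable.ennreal_ofReal

variable {X : Type*} [MeasurableSpace X] {μ : Measure X} [SFinite μ] {k : X → X → ℝ} {B : ℝ≥0∞}
  {F : Type*} [NormedAddCommGroup F]

theorem lintegral_eq (hk : IsPairKernel μ k B) {f : X × X → ℝ≥0∞}
    (hf : AEMeasurable f (μ.prod μ)) :
    ∫⁻ p, f p ∂(pairMeasure μ k) = ∫⁻ x, ∫⁻ y, ENNReal.ofReal (k x y) * f (x, y) ∂μ ∂μ := by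
  rw [pairMeasure, lintegral_withDensity_eq_lintegral_mul₀ hk.measurable_density.aemeasurable hf,
    lintegral_prod _ (hk.measurable_density.aemeasurable.mul hf)]
  rfl

theorem measurePreserving_swap (hk : IsPairKernel μ k B) :
    MeasurePreserving Prod.swap (pairMeasure μ k) (pairMeasure μ k) := by
  refine ⟨measurable_swap, ?_⟩
  ext s hs
  rw [Measure.map_apply measurable_swap hs, pairMeasure,
    withDensity_apply _ (measurable_swap hs), withDensity_apply _ hs,
    ← lintegral_indicator (measurable_swap hs), ← lintegral_indicator hs,
    ← lintegral_prod_swap]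
  refine lintegral_congr fun p => ?_
  by_cases hp : p ∈ s
  · have : p.swap ∈ Prod.swap ⁻¹' s := by simpa using hp
    rw [indicator_of_mem this, indicator_of_mem hp]
    simp [hk.symm p.1 p.2]
  · have : p.swap ∉ Prod.swap ⁻¹' s := by simpa using hp
    rw [indicator_of_notMem this, indicator_of_notMem hp]

/-- The marginal of the pair measure has density the row mass, which is at most B. Hence an Lᵖ
function of one variable is also Lᵖ for the pair measure, the source of the integrability needed
below. -/
theorem map_fst_le (hk : IsPairKernel μ k B) : (pairMeasure μ k).map Prod.fst ≤ B • μ := by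
  refine Measure.le_iff.2 fun s hs => ?_
  rw [Measure.map_apply measurable_fst hs, pairMeasure, withDensity_apply _ (measurable_fst hs),
    Measure.smul_apply, smul_eq_mul, ← lintegral_indicator (measurable_fst hs),
    lintegral_prod _ (hk.measurable_density.indicator (measurable_fst hs)).aemeasurable]
  calc ∫⁻ x, ∫⁻ y, (Prod.fst ⁻¹' s).indicator (fun p => ENNReal.ofReal (k p.1 p.2)) (x, y) ∂μ ∂μ
      = ∫⁻ x in s, ∫⁻ y, ENNReal.ofReal (k x y) ∂μ ∂μ := by
        rw [← lintegral_indicator hs]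
        refine lintegral_congr fun x => ?_
        by_cases hx : x ∈ s
        · rw [indicator_of_mem hx]
          refine lintegral_congr fun y => ?_
          rw [indicator_of_mem (show (x, y) ∈ Prod.fst ⁻¹' s from hx)]
        · rw [indicator_of_notMem hx]
          refine (lintegral_congr fun y => ?_).trans lintegral_zero
          exact indicator_of_notMem (show (x, y) ∉ Prod.fst ⁻¹' s from hx) _
    _ ≤ ∫⁻ x in s, B ∂μ := lintegral_mono_ae (ae_restrict_of_ae hk.bound)
    _ = B * μ s := by simp

theorem memLp_fst (hk : IsPairKernel μ k B) {p : ℝ≥0∞} {u : X → F} (hu : MemLp u p μ) :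
    MemLp (fun q : X × X => u q.1) p (pairMeasure μ k) :=
  (hu.of_measure_le_smul hk.ne_top hk.map_fst_le).comp_of_map measurable_fst.aemeasurable

theorem memLp_snd (hk : IsPairKernel μ k B) {p : ℝ≥0∞} {u : X → F} (hu : MemLp u p μ) :
    MemLp (fun q : X × X => u q.2) p (pairMeasure μ k) :=
  (hk.memLp_fst hu).comp_measurePreserving hk.measurePreserving_swap

theorem integral_swap [NormedSpace ℝ F] (hk : IsPairKernel μ k B) (f : X × X → F) :
    ∫ p, f p.swap ∂(pairMeasure μ k) = ∫ p, f p ∂(pairMeasure μ k) :=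
  hk.measurePreserving_swap.integral_comp MeasurableEquiv.prodComm.measurableEmbedding f

theorem integrable_iff [NormedSpace ℝ F] (hk : IsPairKernel μ k B) {f : X × X → F} :
    Integrable f (pairMeasure μ k) ↔ Integrable (fun p : X × X => k p.1 p.2 • f p) (μ.prod μ) := by
  rw [pairMeasure, integrable_withDensity_iff_integrable_smul' hk.measurable_density
    (ae_of_all _ fun _ => ENNReal.ofReal_lt_top)]
  simp only [ENNReal.toReal_ofReal (hk.nonneg _ _)]

theorem integral_eq [NormedSpace ℝ F] (hk : IsPairKernel μ k B) {f : X × X → F}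
    (hf : Integrable f (pairMeasure μ k)) :
    ∫ p, f p ∂(pairMeasure μ k) = ∫ x, ∫ y, k x y • f (x, y) ∂μ ∂μ := by
  rw [pairMeasure, integral_withDensity_eq_integral_toReal_smul hk.measurable_density
    (ae_of_all _ fun _ => ENNReal.ofReal_lt_top)]
  simp only [ENNReal.toReal_ofReal (hk.nonneg _ _)]
  rw [integral_prod _ (hk.integrable_iff.1 hf)]

theorem ae_integrable [NormedSpace ℝ F] (hk : IsPairKernel μ k B) {f : X × X → F}
    (hf : Integrable f (pairMeasure μ k)) :
    ∀ᵐ x ∂μ, Integrable (fun y => k x y • f (x, y)) μ :=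
  (hk.integrable_iff.1 hf).prod_right_ae

theorem integrable_integral [NormedSpace ℝ F] (hk : IsPairKernel μ k B) {f : X × X → F}
    (hf : Integrable f (pairMeasure μ k)) :
    Integrable (fun x => ∫ y, k x y • f (x, y) ∂μ) μ :=
  (hk.integrable_iff.1 hf).integral_prod_left

theorem isFiniteMeasure [IsFiniteMeasure μ] (hk : IsPairKernel μ k B) :
    IsFiniteMeasure (pairMeasure μ k) := by
  refine ⟨?_⟩
  have h := hk.map_fst_le univ
  rw [Measure.map_apply measurable_fst MeasurableSet.univ, preimage_univ] at h
  refine h.trans_lt ?_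
  rw [Measure.smul_apply, smul_eq_mul]
  exact ENNReal.mul_lt_top hk.ne_top.lt_top (measure_lt_top _ _)

/-- Symmetrization of an antisymmetric form. -/
theorem integral_mul_fst_of_antisymm (hk : IsPairKernel μ k B) {f : X × X → ℝ} {e : X × X → ℝ}
    (hf : ∀ p, f p.swap = -f p)
    (hfe : Integrable (fun p => f p * e p) (pairMeasure μ k)) :
    2 * ∫ p, f p * e p ∂(pairMeasure μ k) =
      -∫ p, f p * (e p.swap - e p) ∂(pairMeasure μ k) := by
  have h1 := hk.integral_swap (fun p => f p * e p)
  simp only [hf] at h1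
  have h2 : Integrable (fun p => f p * e p.swap) (pairMeasure μ k) := by
    have := hk.measurePreserving_swap.integrable_comp_of_integrable hfe
    refine this.neg.congr (ae_of_all _ fun p => ?_)
    simp [hf]
  simp only [mul_sub]
  rw [integral_sub h2 hfe, ← h1]
  simp only [neg_mul, integral_neg]
  ring

end IsPairKernel

/-! ### From energy estimates to bounds of the L² norm. -/

theorem sq_le_of_le_mul {N A : ℝ≥0∞} (hN : N ≠ ∞) (h : N ^ 2 ≤ A * N) : N ≤ A := by
  rcases eq_or_ne N 0 with h0 | h0
  · simp [h0]
  · rw [sq] at h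
    exact (ENNReal.mul_le_mul_iff_left h0 hN).1 h

theorem eLpNorm_two_sq {X F : Type*} [MeasurableSpace X] [NormedAddCommGroup F] (μ : Measure X)
    (f : X → F) : (eLpNorm f 2 μ) ^ 2 = ∫⁻ x, ENNReal.ofReal (‖f x‖ ^ 2) ∂μ := by
  have h := eLpNorm_nnreal_pow_eq_lintegral (f := f) (μ := μ) (p := 2) (by norm_num)
  have h2 : ((2 : ℝ≥0) : ℝ≥0∞) = 2 := rfl
  rw [h2] at h
  have h3 : ((2 : ℝ≥0) : ℝ) = ((2 : ℕ) : ℝ) := by norm_num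
  rw [h3, ENNReal.rpow_natCast] at h
  rw [h]
  refine lintegral_congr fun x => ?_
  rw [ENNReal.rpow_natCast, ← ofReal_norm, ENNReal.ofReal_pow (norm_nonneg _)]

/-- A quadratic functional bounded by the `L¹` norm bounds the `L²` norm. -/
theorem eLpNorm_two_le_of_sq_le {X F : Type*} [MeasurableSpace X] [NormedAddCommGroup F]
    {μ : Measure X} {f : X → F} (hf : MemLp f 2 μ) {A : ℝ≥0∞}
    (h : (eLpNorm f 2 μ) ^ 2 ≤ A * ∫⁻ x, ‖f x‖ₑ ∂μ) :
    eLpNorm f 2 μ ≤ A * μ univ ^ (1 / 2 : ℝ) := by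
  refine sq_le_of_le_mul hf.2.ne (h.trans ?_)
  -- Cauchy–Schwarz against the constant function: the L¹ norm is at most the L² norm times
  -- μ(univ)^(1/2). One factor of the finite L² norm can then be cancelled.
  have h1 := eLpNorm_le_eLpNorm_mul_rpow_measure_univ (p := 1) (q := 2) (by norm_num) hf.1
  rw [eLpNorm_one_eq_lintegral_enorm] at h1
  have h2 : (1 / (1 : ℝ≥0∞).toReal - 1 / (2 : ℝ≥0∞).toReal) = (1 / 2 : ℝ) := by norm_num
  rw [h2] at h1
  calc A * ∫⁻ x, ‖f x‖ₑ ∂μ ≤ A * (eLpNorm f 2 μ * μ univ ^ (1 / 2 : ℝ)) := by gcongr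
    _ = _ := by ring

/-! ### Energy estimates for the nonlocal Poisson model -/

theorem energySq_eq_ofReal_integral_sq {d : ℕ} {D : Set (Sp d)} {k : Sp d → Sp d → ℝ} {B : ℝ≥0∞}
    (hk : IsPairKernel (volume.restrict D) k B) {e : Sp d → ℝ}
    (he : MemLp e 2 (volume.restrict D)) :
    energySq k D e = ENNReal.ofReal
      (∫ p : Sp d × Sp d, (e p.2 - e p.1) ^ 2 ∂(pairMeasure (volume.restrict D) k)) := by
  have hf : MemLp (fun p : Sp d × Sp d => e p.2 - e p.1) 2 (pairMeasure (volume.restrict D) k) :=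
    (hk.memLp_snd he).sub (hk.memLp_fst he)
  rw [ofReal_integral_eq_lintegral_ofReal hf.integrable_sq (ae_of_all _ fun p => sq_nonneg _),
    hk.lintegral_eq, energySq]
  · refine lintegral_congr fun x => lintegral_congr fun y => ?_
    rw [mul_comm, ENNReal.ofReal_mul (hk.nonneg _ _)]
  · have h1 : AEMeasurable (fun p : Sp d × Sp d => e p.1)
        ((volume.restrict D).prod (volume.restrict D)) := he.1.aemeasurable.comp_fst
    have h2 : AEMeasurable (fun p : Sp d × Sp d => e p.2)
        ((volume.restrict D).prod (volume.restrict D)) := he.1.aemeasurable.comp_snd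
    exact ((h2.sub h1).pow_const 2).ennreal_ofReal

/-- Green's identity: testing the flux with a function. -/
theorem integral_mul_flux_eq {d : ℕ} {D : Set (Sp d)} {k : Sp d → Sp d → ℝ} {B : ℝ≥0∞}
    (hk : IsPairKernel (volume.restrict D) k B) {φ h : Sp d → ℝ}
    (hi : Integrable (fun p : Sp d × Sp d => (φ p.2 - φ p.1) * h p.1)
      (pairMeasure (volume.restrict D) k)) :
    ∫ p : Sp d × Sp d, (φ p.2 - φ p.1) * (h p.2 - h p.1) ∂(pairMeasure (volume.restrict D) k) =
      ∫ x in D, h x * (2 * nonlocalFlux k D φ x) := by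
  have h1 := hk.integral_mul_fst_of_antisymm (f := fun p => φ p.2 - φ p.1) (e := fun p => h p.1)
    (fun p => by simp) hi
  rw [hk.integral_eq hi] at h1
  have h2 : ∀ x, h x * (2 * nonlocalFlux k D φ x) =
      -(2 * ∫ y in D, k x y • ((φ y - φ x) * h x)) := by
    intro x
    have : ∀ y, k x y • ((φ y - φ x) * h x) = h x * ((φ y - φ x) * k x y) := fun y => by
      simp only [smul_eq_mul]; ring
    simp only [this, integral_const_mul, nonlocalFlux]
    ring
  simp only [h2, integral_neg, integral_const_mul]
  rw [h1]
  simp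

theorem integrable_mul_flux {d : ℕ} {D : Set (Sp d)} {k : Sp d → Sp d → ℝ} {B : ℝ≥0∞}
    (hk : IsPairKernel (volume.restrict D) k B) {φ h : Sp d → ℝ}
    (hi : Integrable (fun p : Sp d × Sp d => (φ p.2 - φ p.1) * h p.1)
      (pairMeasure (volume.restrict D) k)) :
    Integrable (fun x => h x * (2 * nonlocalFlux k D φ x)) (volume.restrict D) := by
  refine ((hk.integrable_integral hi).const_mul (-2)).congr (ae_of_all _ fun x => ?_)
  have : ∀ y, k x y • ((φ y - φ x) * h x) = h x * ((φ y - φ x) * k x y) := fun y => by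
    simp only [smul_eq_mul]; ring
  simp only [this, integral_const_mul, nonlocalFlux]
  ring

theorem energySq_eq_ofReal_integral_flux {d : ℕ} {D : Set (Sp d)} {k : Sp d → Sp d → ℝ}
    {B : ℝ≥0∞} (hk : IsPairKernel (volume.restrict D) k B) {e : Sp d → ℝ}
    (he : MemLp e 2 (volume.restrict D)) :
    energySq k D e = ENNReal.ofReal (∫ x in D, e x * (2 * nonlocalFlux k D e x)) := by
  rw [energySq_eq_ofReal_integral_sq hk he, ← integral_mul_flux_eq hk]
  · simp only [sq]
  · exact ((hk.memLp_snd he).sub (hk.memLp_fst he)).integrable_mul (hk.memLp_fst he)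

/-- Only almost everywhere: the row integrals of L² functions are known to converge for almost every
x, and additivity of the integral needs that. -/
theorem nonlocalFlux_sub {d : ℕ} {D : Set (Sp d)} {k : Sp d → Sp d → ℝ}
    {B : ℝ≥0∞} (hk : IsPairKernel (volume.restrict D) k B)
    [IsFiniteMeasure (volume.restrict D)] {u v : Sp d → ℝ}
    (hu : MemLp u 2 (volume.restrict D)) (hv : MemLp v 2 (volume.restrict D)) :
    ∀ᵐ x ∂(volume.restrict D), nonlocalFlux k D (fun y => u y - v y) x =
      nonlocalFlux k D u x - nonlocalFlux k D v x := by
  have := hk.isFiniteMeasure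
  have hI : ∀ {w : Sp d → ℝ}, MemLp w 2 (volume.restrict D) →
      ∀ᵐ x ∂(volume.restrict D), Integrable (fun y => (w y - w x) * k x y) (volume.restrict D) := by
    intro w hw
    have h := hk.ae_integrable (((hk.memLp_snd hw).sub (hk.memLp_fst hw)).integrable (by norm_num))
    filter_upwards [h] with x hx
    simpa [mul_comm] using hx
  filter_upwards [hI hu, hI hv] with x hxu hxv
  rw [nonlocalFlux, nonlocalFlux, nonlocalFlux, neg_sub_neg, ← integral_sub hxv hxu,
    ← integral_neg]
  congr 1; ext y; ring

/-- An `L²` bound from a Poincaré inequality and a bound of the residual. -/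
theorem eLpNorm_le_of_residual_le {d : ℕ} {D : Set (Sp d)} {k : Sp d → Sp d → ℝ}
    {B : ℝ≥0∞} (hk : IsPairKernel (volume.restrict D) k B) {e : Sp d → ℝ}
    (he : MemLp e 2 (volume.restrict D)) {A : ℝ} {P : ℝ≥0∞}
    (hres : ∀ᵐ x ∂(volume.restrict D), |e x * (2 * nonlocalFlux k D e x)| ≤ A * |e x|)
    (hP : (eLpNorm e 2 (volume.restrict D)) ^ 2 ≤ P * energySq k D e) :
    eLpNorm e 2 (volume.restrict D) ≤ P * ENNReal.ofReal A * volume D ^ (1 / 2 : ℝ) := by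
  rw [← Measure.restrict_apply_univ D]
  refine eLpNorm_two_le_of_sq_le he (hP.trans ?_)
  rw [mul_assoc]
  gcongr
  rw [energySq_eq_ofReal_integral_flux hk he, ← lintegral_const_mul'' _ he.1.enorm]
  refine (Real.ofReal_le_enorm _).trans ((enorm_integral_le_lintegral_enorm _).trans ?_)
  refine lintegral_mono_ae ?_
  filter_upwards [hres] with x hx
  rw [← ofReal_norm, ← ofReal_norm, Real.norm_eq_abs, Real.norm_eq_abs,
    ← ENNReal.ofReal_mul' (abs_nonneg _)]
  exact ENNReal.ofReal_le_ofReal hx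

/-- Picone's inequality; the difference of the two sides is the square (φb - ψa)²/(φψ). -/
theorem picone_le {φ ψ a b : ℝ} (hφ : 0 < φ) (hψ : 0 < ψ) :
    (ψ - φ) * (b ^ 2 / ψ - a ^ 2 / φ) ≤ (b - a) ^ 2 := by
  have h : (b - a) ^ 2 - (ψ - φ) * (b ^ 2 / ψ - a ^ 2 / φ) = (φ * b - ψ * a) ^ 2 / (φ * ψ) := by
    field_simp; ring
  have : 0 ≤ (φ * b - ψ * a) ^ 2 / (φ * ψ) := by positivity
  linarith

/-- A positive bounded supersolution gives a Poincaré inequality. -/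
theorem poincare_of_supersolution {d : ℕ} {D : Set (Sp d)} {k : Sp d → Sp d → ℝ} {B : ℝ≥0∞}
    (hk : IsPairKernel (volume.restrict D) k B) {e φ : Sp d → ℝ}
    (he : MemLp e 2 (volume.restrict D)) (hD : MeasurableSet D) (hφ : Measurable φ) {A : ℝ}
    (hφ1 : ∀ x ∈ D, 1 ≤ φ x) (hφA : ∀ x ∈ D, φ x ≤ A)
    (hsup : ∀ᵐ x ∂(volume.restrict D), e x = 0 ∨ 1 ≤ 2 * nonlocalFlux k D φ x) :
    (eLpNorm e 2 (volume.restrict D)) ^ 2 ≤ ENNReal.ofReal A * energySq k D e := by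
  rcases D.eq_empty_or_nonempty with hDe | ⟨x₀, hx₀⟩
  · simp [hDe]
  have hA : 1 ≤ A := (hφ1 x₀ hx₀).trans (hφA x₀ hx₀)
  set μ := volume.restrict D
  -- The supersolution φ is tested with e²/φ. By Picone the resulting form is at most the energy of
  -- e, while the supersolution property bounds it below by the integral of e²/A.
  set h : Sp d → ℝ := fun x => e x ^ 2 / φ x
  have hmem : ∀ᵐ x ∂μ, x ∈ D := ae_restrict_mem hD
  have hh : Integrable h μ := by
    refine he.integrable_sq.mono (he.1.pow 2 |>.mul hφ.inv.aestronglyMeasurable) ?_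
    filter_upwards [hmem] with x hx
    have h1 := hφ1 x hx
    rw [Real.norm_eq_abs, Real.norm_eq_abs, abs_of_nonneg (by positivity),
      abs_of_nonneg (by positivity)]
    exact div_le_self (sq_nonneg _) h1
  have hφtop : MemLp φ ∞ μ := by
    refine memLp_top_of_bound hφ.aestronglyMeasurable A ?_
    filter_upwards [hmem] with x hx
    rw [Real.norm_eq_abs, abs_of_nonneg (zero_le_one.trans (hφ1 x hx))]
    exact hφA x hx
  have hφd : MemLp (fun p : Sp d × Sp d => φ p.2 - φ p.1) ∞ (pairMeasure μ k) :=
    (hk.memLp_snd hφtop).sub (hk.memLp_fst hφtop)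
  have hh1 : MemLp (fun p : Sp d × Sp d => h p.1) 1 (pairMeasure μ k) :=
    hk.memLp_fst (memLp_one_iff_integrable.2 hh)
  have hh2 : MemLp (fun p : Sp d × Sp d => h p.2) 1 (pairMeasure μ k) :=
    hk.memLp_snd (memLp_one_iff_integrable.2 hh)
  have hi : Integrable (fun p : Sp d × Sp d => (φ p.2 - φ p.1) * h p.1) (pairMeasure μ k) :=
    memLp_one_iff_integrable.1 (hh1.mul hφd)
  have hi2 : Integrable (fun p : Sp d × Sp d => (φ p.2 - φ p.1) * (h p.2 - h p.1))
      (pairMeasure μ k) := memLp_one_iff_integrable.1 ((hh2.sub hh1).mul hφd)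
  have hpos : ∀ᵐ p ∂(pairMeasure μ k), p.1 ∈ D ∧ p.2 ∈ D := by
    have hac : pairMeasure μ k ≪ μ.prod μ := withDensity_absolutelyContinuous _ _
    refine hac.ae_le ?_
    have hs : (D ×ˢ D) ∈ ae (μ.prod μ) := by
      rw [Measure.prod_restrict]
      exact ae_restrict_mem (hD.prod hD)
    exact hs
  have hpic : ∫ p : Sp d × Sp d, (φ p.2 - φ p.1) * (h p.2 - h p.1) ∂(pairMeasure μ k) ≤
      ∫ p : Sp d × Sp d, (e p.2 - e p.1) ^ 2 ∂(pairMeasure μ k) := by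
    refine integral_mono_ae hi2 ((hk.memLp_snd he).sub (hk.memLp_fst he)).integrable_sq ?_
    filter_upwards [hpos] with p hp
    exact picone_le (one_pos.trans_le (hφ1 _ hp.1)) (one_pos.trans_le (hφ1 _ hp.2))
  rw [integral_mul_flux_eq hk hi] at hpic
  -- Where the flux of φ has no lower bound, e vanishes and so does the test function; elsewhere the
  -- flux term is at least 1 and φ ≤ A.
  have hlow : ∫ x, e x ^ 2 / A ∂μ ≤ ∫ x in D, h x * (2 * nonlocalFlux k D φ x) := by
    refine integral_mono_ae (he.integrable_sq.div_const A) (integrable_mul_flux hk hi) ?_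
    filter_upwards [hmem, hsup] with x hx hs
    have h1 := hφ1 x hx
    rcases hs with h0 | hs
    · simp [h, h0]
    · have h2 : e x ^ 2 / A ≤ h x := by
        apply div_le_div_of_nonneg_left (sq_nonneg _) (by linarith) (hφA x hx)
      have h3 : 0 ≤ h x := by positivity
      nlinarith
  rw [integral_div, div_le_iff₀ (by linarith)] at hlow
  have hfin : ∫ x, e x ^ 2 ∂μ ≤
      A * ∫ p : Sp d × Sp d, (e p.2 - e p.1) ^ 2 ∂(pairMeasure μ k) := by
    calc _ ≤ _ := hlow
      _ ≤ _ := by rw [mul_comm]; gcongr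
  rw [eLpNorm_two_sq, energySq_eq_ofReal_integral_sq hk he, ← ENNReal.ofReal_mul (by linarith)]
  simp only [Real.norm_eq_abs, sq_abs]
  rw [← ofReal_integral_eq_lintegral_ofReal he.integrable_sq (ae_of_all _ fun _ => sq_nonneg _)]
  exact ENNReal.ofReal_le_ofReal hfin

/-! ### Energy estimates for the LPS model -/

/-- The standing assumptions on the weight `g`, the normalization `m` and the set `D` under which
the LPS operator is studied. -/
structure IsLPSWeight {d : ℕ} (g : ℝ → ℝ) (m : ℝ) (D : Set (Sp d)) (B : ℝ≥0∞) : Prop where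
  measurableSet : MeasurableSet D
  finite : IsFiniteMeasure (volume.restrict D)
  diam : ∃ R : ℝ, ∀ x ∈ D, ∀ y ∈ D, ‖y - x‖ ≤ R
  pair : IsPairKernel (volume.restrict D) (fun x y : Sp d => g ‖y - x‖) B
  pos : 0 < m
  moment_le : ∀ x ∈ D, ∫ y in D, g ‖y - x‖ * ‖y - x‖ ^ 2 ≤ m

/-- The increment of `u` projected on the difference vector. -/
def projInc {d : ℕ} (u : Sp d → Sp d) (p : Sp d × Sp d) : ℝ := ⟪p.2 - p.1, u p.2 - u p.1⟫

theorem projInc_swap {d : ℕ} (u : Sp d → Sp d) (p : Sp d × Sp d) :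
    projInc u p.swap = projInc u p := by
  simp only [projInc, Prod.fst_swap, Prod.snd_swap]
  rw [← neg_sub p.2 p.1, ← neg_sub (u p.2) (u p.1), inner_neg_neg]

/-- The measure on pairs of points of `D` with density `g ‖y - x‖`. -/
def lpsMeasure {d : ℕ} (g : ℝ → ℝ) (D : Set (Sp d)) : Measure (Sp d × Sp d) :=
  pairMeasure (volume.restrict D) fun x y => g ‖y - x‖

theorem integrable_inner_of_memLp {X : Type*} [MeasurableSpace X] {μ : Measure X} {d : ℕ}
    {u v : X → Sp d} (hu : MemLp u 2 μ) (hv : MemLp v 2 μ) :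
    Integrable (fun x => ⟪u x, v x⟫) μ :=
  (hu.norm.integrable_mul hv.norm).mono' (hu.1.inner hv.1)
    (ae_of_all _ fun _ => norm_inner_le_norm _ _)

theorem memLp_smul_of_top {X F : Type*} [MeasurableSpace X] {μ : Measure X}
    [NormedAddCommGroup F] [NormedSpace ℝ F] {f : X → ℝ} {v : X → F} (hf : MemLp f 2 μ)
    (hv : MemLp v ∞ μ) : MemLp (fun x => f x • v x) 2 μ :=
  hv.smul hf

namespace IsLPSWeight

variable {d : ℕ} {g : ℝ → ℝ} {m : ℝ} {D : Set (Sp d)} {B : ℝ≥0∞}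

theorem memLp_top_diff (h : IsLPSWeight g m D B) :
    MemLp (fun p : Sp d × Sp d => p.2 - p.1) ∞ (lpsMeasure g D) := by
  obtain ⟨R, hR⟩ := h.diam
  refine memLp_top_of_bound (by apply Continuous.aestronglyMeasurable; fun_prop) R ?_
  have hac : lpsMeasure g D ≪ (volume.restrict D).prod (volume.restrict D) :=
    withDensity_absolutelyContinuous _ _
  refine hac.ae_le ?_
  have hs : (D ×ˢ D) ∈ ae ((volume.restrict D).prod (volume.restrict D)) := by
    rw [Measure.prod_restrict]
    exact ae_restrict_mem (h.measurableSet.prod h.measurableSet)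
  filter_upwards [hs] with p hp
  exact hR _ hp.1 _ hp.2

theorem memLp_inner_diff (h : IsLPSWeight g m D B) {f : Sp d × Sp d → Sp d}
    (hf : MemLp f 2 (lpsMeasure g D)) :
    MemLp (fun p => ⟪p.2 - p.1, f p⟫) 2 (lpsMeasure g D) := by
  obtain ⟨hz1, hz2⟩ := h.memLp_top_diff
  refine ⟨hz1.inner hf.1, ?_⟩
  have hm : MemLp (fun p => ‖p.2 - p.1‖ * ‖f p‖) 2 (lpsMeasure g D) :=
    hf.norm.mul (h.memLp_top_diff).norm
  refine (eLpNorm_mono fun p => ?_).trans_lt hm.2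
  rw [Real.norm_of_nonneg (by positivity : 0 ≤ ‖p.2 - p.1‖ * ‖f p‖)]
  exact norm_inner_le_norm _ _

theorem memLp_inner_diff_div (h : IsLPSWeight g m D B) {f : Sp d × Sp d → Sp d}
    (hf : MemLp f 2 (lpsMeasure g D)) :
    MemLp (fun p => ⟪p.2 - p.1, f p⟫ / ‖p.2 - p.1‖) 2 (lpsMeasure g D) := by
  have hm : AEStronglyMeasurable (fun p : Sp d × Sp d => ‖p.2 - p.1‖⁻¹) (lpsMeasure g D) := by
    apply Measurable.aestronglyMeasurable; fun_prop
  refine hf.of_le (((h.memLp_inner_diff hf).1.mul hm).congr (ae_of_all _ fun p => ?_))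
    (ae_of_all _ fun p => ?_)
  · simp [div_eq_mul_inv]
  · rw [norm_div, norm_norm]
    apply div_le_of_le_mul₀ (norm_nonneg _) (norm_nonneg _)
    rw [mul_comm]
    exact norm_inner_le_norm _ _

theorem memLp_inc (h : IsLPSWeight g m D B) {u : Sp d → Sp d}
    (hu : MemLp u 2 (volume.restrict D)) :
    MemLp (fun p : Sp d × Sp d => u p.2 - u p.1) 2 (lpsMeasure g D) :=
  (h.pair.memLp_snd hu).sub (h.pair.memLp_fst hu)

theorem memLp_projInc (h : IsLPSWeight g m D B) {u : Sp d → Sp d}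
    (hu : MemLp u 2 (volume.restrict D)) : MemLp (projInc u) 2 (lpsMeasure g D) :=
  h.memLp_inner_diff (h.memLp_inc hu)

theorem memLp_projInc_div (h : IsLPSWeight g m D B) {u : Sp d → Sp d}
    (hu : MemLp u 2 (volume.restrict D)) :
    MemLp (fun p => projInc u p / ‖p.2 - p.1‖) 2 (lpsMeasure g D) :=
  h.memLp_inner_diff_div (h.memLp_inc hu)

theorem isFiniteMeasure (h : IsLPSWeight g m D B) : IsFiniteMeasure (lpsMeasure g D) := by
  have := h.finite
  exact h.pair.isFiniteMeasure

theorem dilatation_eq (u : Sp d → Sp d) (x : Sp d) :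
    dilatation g m D u x = 2 / m * ∫ y in D, g ‖y - x‖ • projInc u (x, y) := rfl

/-- Cauchy–Schwarz in y: write projInc as ‖z‖ times projInc/‖z‖. The second moment over D is at most
m, and the prefactor (2/m)² · m gives 4/m. The constant 4 matters: it produces the condition dλ + 2μ
> 0. -/
theorem dilatation_sq_le (h : IsLPSWeight g m D B) {u : Sp d → Sp d}
    (hu : MemLp u 2 (volume.restrict D)) :
    ∀ᵐ x ∂(volume.restrict D), dilatation g m D u x ^ 2 ≤
      4 / m * ∫ y in D, g ‖y - x‖ • (projInc u (x, y) / ‖y - x‖) ^ 2 := by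
  have := h.isFiniteMeasure
  have h1 := h.pair.ae_integrable ((h.memLp_projInc hu).integrable (by norm_num))
  have h2 := h.pair.ae_integrable ((h.memLp_projInc_div hu).integrable_sq)
  have h3 := h.pair.ae_integrable
    ((h.memLp_top_diff.norm.mono_exponent le_top : MemLp _ 2 _).integrable_sq)
  filter_upwards [h1, h2, h3, ae_restrict_mem h.measurableSet] with x h1 h2 h3 hx
  set I := ∫ y in D, g ‖y - x‖ • projInc u (x, y) with hI
  set Q := ∫ y in D, g ‖y - x‖ • (projInc u (x, y) / ‖y - x‖) ^ 2 with hQ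
  have hM := h.moment_le x hx
  have hm := h.pos
  set s := I / m with hs
  -- The integrand is the square g(s‖z‖ - projInc/‖z‖)² multiplied out. The choice s = I/m gives s²m
  -- ≤ Q even where the truncated moment is smaller than m.
  have hnn : 0 ≤ ∫ y in D, (s ^ 2 * (g ‖y - x‖ • ‖y - x‖ ^ 2) - 2 * s * (g ‖y - x‖ •
      projInc u (x, y)) + g ‖y - x‖ • (projInc u (x, y) / ‖y - x‖) ^ 2) := by
    refine integral_nonneg fun y => ?_
    have hg := h.pair.nonneg x y
    simp only [smul_eq_mul, Pi.zero_apply]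
    rcases eq_or_ne (y - x) 0 with h0 | h0
    · simp [h0, projInc]
    · have hn : 0 < ‖y - x‖ := norm_pos_iff.2 h0
      have : s ^ 2 * (g ‖y - x‖ * ‖y - x‖ ^ 2) - 2 * s * (g ‖y - x‖ * projInc u (x, y)) +
          g ‖y - x‖ * (projInc u (x, y) / ‖y - x‖) ^ 2 =
          g ‖y - x‖ * (s * ‖y - x‖ - projInc u (x, y) / ‖y - x‖) ^ 2 := by
        field_simp; ring
      rw [this]
      positivity
  have i3 : Integrable (fun y => s ^ 2 * (g ‖y - x‖ • ‖y - x‖ ^ 2)) (volume.restrict D) :=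
    h3.const_mul _
  have i1 : Integrable (fun y => 2 * s * (g ‖y - x‖ • projInc u (x, y))) (volume.restrict D) :=
    h1.const_mul _
  have i31 : Integrable (fun y => s ^ 2 * (g ‖y - x‖ • ‖y - x‖ ^ 2) -
      2 * s * (g ‖y - x‖ • projInc u (x, y))) (volume.restrict D) := i3.sub i1
  rw [integral_add i31 h2, integral_sub i3 i1, integral_const_mul, integral_const_mul,
    ← hI, ← hQ] at hnn
  simp only [smul_eq_mul] at hnn
  have h4 : s * m = I := by rw [hs]; field_simp
  have h5 : s ^ 2 * (∫ y in D, g ‖y - x‖ * ‖y - x‖ ^ 2) ≤ s ^ 2 * m := by gcongr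
  have h6 : s ^ 2 * m ≤ Q := by rw [← h4] at hnn; linarith
  rw [dilatation_eq, ← hI, ← h4]
  calc (2 / m * (s * m)) ^ 2 = 4 / m * (s ^ 2 * m) := by field_simp; ring
    _ ≤ 4 / m * Q := by gcongr

theorem memLp_dilatation (h : IsLPSWeight g m D B) {u : Sp d → Sp d}
    (hu : MemLp u 2 (volume.restrict D)) :
    MemLp (dilatation g m D u) 2 (volume.restrict D) := by
  have := h.isFiniteMeasure
  have h1 := h.pair.integrable_integral ((h.memLp_projInc hu).integrable (by norm_num))
  have h2 := h.pair.integrable_integral ((h.memLp_projInc_div hu).integrable_sq)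
  have hmeas : AEStronglyMeasurable (dilatation g m D u) (volume.restrict D) :=
    h1.1.const_mul (2 / m)
  rw [memLp_two_iff_integrable_sq hmeas]
  refine (h2.const_mul (4 / m)).mono' (hmeas.pow 2) ?_
  filter_upwards [h.dilatation_sq_le hu] with x hx
  rw [Real.norm_of_nonneg (sq_nonneg _)]
  exact hx

theorem integral_dilatation_sq_le (h : IsLPSWeight g m D B) {u : Sp d → Sp d}
    (hu : MemLp u 2 (volume.restrict D)) :
    ∫ x in D, dilatation g m D u x ^ 2 ≤
      4 / m * ∫ p, (projInc u p / ‖p.2 - p.1‖) ^ 2 ∂(lpsMeasure g D) := by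
  have h2 := (h.memLp_projInc_div hu).integrable_sq
  rw [lpsMeasure, h.pair.integral_eq h2, ← integral_const_mul]
  exact integral_mono_ae (h.memLp_dilatation hu).integrable_sq
    ((h.pair.integrable_integral h2).const_mul _) (h.dilatation_sq_le hu)

theorem lpsEnergySq_eq (h : IsLPSWeight g m D B) {δ : ℝ} (hδ : ∀ t, δ ≤ t → g t = 0)
    {u : Sp d → Sp d} (hu : MemLp u 2 (volume.restrict D)) :
    lpsEnergySq g δ m D u = ENNReal.ofReal
      (1 / m * ∫ p, (projInc u p / ‖p.2 - p.1‖) ^ 2 ∂(lpsMeasure g D)) := by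
  have h2 := h.memLp_projInc_div hu
  rw [lpsEnergySq, ENNReal.ofReal_mul (by have := h.pos; positivity),
    ofReal_integral_eq_lintegral_ofReal h2.integrable_sq (ae_of_all _ fun p => sq_nonneg _),
    lpsMeasure, h.pair.lintegral_eq]
  · congr 1
    refine lintegral_congr fun x => ?_
    rw [inter_comm, ← Measure.restrict_restrict measurableSet_ball,
      ← lintegral_indicator measurableSet_ball]
    refine lintegral_congr fun y => ?_
    by_cases hy : y ∈ Metric.ball x δ
    · rw [indicator_of_mem hy, ← ENNReal.ofReal_mul (h.pair.nonneg x y)]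
      congr 1
      simp only [projInc]
      rw [real_inner_comm]
      ring
    · rw [indicator_of_notMem hy]
      rw [Metric.mem_ball, dist_eq_norm, not_lt] at hy
      simp [hδ _ hy]
  · have h1 : AEMeasurable (fun p : Sp d × Sp d => u p.1)
        ((volume.restrict D).prod (volume.restrict D)) := hu.1.aemeasurable.comp_fst
    have h2 : AEMeasurable (fun p : Sp d × Sp d => u p.2)
        ((volume.restrict D).prod (volume.restrict D)) := hu.1.aemeasurable.comp_snd
    have h3 : AEMeasurable (projInc u) ((volume.restrict D).prod (volume.restrict D)) :=
      AEMeasurable.inner (by fun_prop) (h2.sub h1)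
    exact ((h3.div (by fun_prop)).pow_const 2).ennreal_ofReal

theorem two_mul_integral (h : IsLPSWeight g m D B) {f : Sp d × Sp d → ℝ}
    (hf : Integrable f (lpsMeasure g D)) :
    2 * ∫ p, f p ∂(lpsMeasure g D) = ∫ p, (f p + f p.swap) ∂(lpsMeasure g D) := by
  have h1 : ∫ p, f p.swap ∂(lpsMeasure g D) = ∫ p, f p ∂(lpsMeasure g D) := h.pair.integral_swap f
  have h2 : Integrable (fun p => f p.swap) (lpsMeasure g D) :=
    h.pair.measurePreserving_swap.integrable_comp_of_integrable hf
  rw [integral_add hf h2, h1]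
  ring

/-- The integrand of the dilatation term of the LPS operator. -/
def dilTerm (g : ℝ → ℝ) (m : ℝ) (D : Set (Sp d)) (u : Sp d → Sp d) (p : Sp d × Sp d) : Sp d :=
  (dilatation g m D u p.1 + dilatation g m D u p.2) • (p.2 - p.1)

/-- The integrand of the deviatoric term of the LPS operator. -/
def devTerm (u : Sp d → Sp d) (p : Sp d × Sp d) : Sp d :=
  (projInc u p / ‖p.2 - p.1‖ ^ 2) • (p.2 - p.1)

theorem lpsOperator_eq (lam mu : ℝ) (u : Sp d → Sp d) (x : Sp d) :
    lpsOperator lam mu g m D u x =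
      (lpsC₁ d / m * (lam - mu)) • (∫ y in D, g ‖y - x‖ • dilTerm g m D u (x, y)) +
      (lpsC₂ d / m * mu) • ∫ y in D, g ‖y - x‖ • devTerm u (x, y) := by
  rw [lpsOperator, mul_smul, mul_smul, ← integral_smul (lam - mu), ← integral_smul mu]
  simp only [dilTerm, devTerm, projInc, smul_smul, mul_assoc]

theorem memLp_dilTerm (h : IsLPSWeight g m D B) {u : Sp d → Sp d}
    (hu : MemLp u 2 (volume.restrict D)) : MemLp (dilTerm g m D u) 2 (lpsMeasure g D) := by
  have h1 := h.memLp_dilatation hu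
  have h2 : MemLp (fun p : Sp d × Sp d => dilatation g m D u p.1) 2 (lpsMeasure g D) :=
    h.pair.memLp_fst h1
  have h3 : MemLp (fun p : Sp d × Sp d => dilatation g m D u p.2) 2 (lpsMeasure g D) :=
    h.pair.memLp_snd h1
  exact memLp_smul_of_top (h2.add h3) h.memLp_top_diff

theorem memLp_devTerm (h : IsLPSWeight g m D B) {u : Sp d → Sp d}
    (hu : MemLp u 2 (volume.restrict D)) : MemLp (devTerm u) 2 (lpsMeasure g D) := by
  have h1 := h.memLp_projInc_div hu
  refine h1.of_le ?_ (ae_of_all _ fun p => ?_)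
  · have hm : AEStronglyMeasurable (fun p : Sp d × Sp d => (‖p.2 - p.1‖ ^ 2)⁻¹)
      (lpsMeasure g D) := by apply Measurable.aestronglyMeasurable; fun_prop
    have hs : AEStronglyMeasurable (fun p => projInc u p / ‖p.2 - p.1‖ ^ 2) (lpsMeasure g D) := by
      simp only [div_eq_mul_inv]
      exact (h.memLp_projInc hu).1.mul hm
    exact hs.smul h.memLp_top_diff.1
  · rw [devTerm, norm_smul, norm_div, norm_div, norm_pow, norm_norm]
    rcases (norm_nonneg (p.2 - p.1)).eq_or_lt with h0 | h0
    · simp [← h0]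
    · apply le_of_eq; field_simp

/-- Almost everywhere for the reason of converging row integrals, and needed at two levels: the
operator at x contains the dilatation at almost every y, which is itself such an integral. -/
theorem lpsOperator_sub (h : IsLPSWeight g m D B) (lam mu : ℝ) {u v : Sp d → Sp d}
    (hu : MemLp u 2 (volume.restrict D)) (hv : MemLp v 2 (volume.restrict D)) :
    ∀ᵐ x ∂(volume.restrict D), lpsOperator lam mu g m D (fun y => u y - v y) x =
      lpsOperator lam mu g m D u x - lpsOperator lam mu g m D v x := by
  have := h.isFiniteMeasure
  have hproj : ∀ p, projInc (fun y => u y - v y) p = projInc u p - projInc v p := fun p => by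
    simp only [projInc]
    rw [← inner_sub_right]; congr 1; abel
  have hI : ∀ {w : Sp d → Sp d}, MemLp w 2 (volume.restrict D) → ∀ᵐ x ∂(volume.restrict D),
      Integrable (fun y => g ‖y - x‖ • projInc w (x, y)) (volume.restrict D) ∧
      Integrable (fun y => g ‖y - x‖ • dilTerm g m D w (x, y)) (volume.restrict D) ∧
      Integrable (fun y => g ‖y - x‖ • devTerm w (x, y)) (volume.restrict D) := fun hw =>
    (h.pair.ae_integrable ((h.memLp_projInc hw).integrable (by norm_num))).and
      ((h.pair.ae_integrable ((h.memLp_dilTerm hw).integrable (by norm_num))).and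
        (h.pair.ae_integrable ((h.memLp_devTerm hw).integrable (by norm_num))))
  have hdil : ∀ᵐ x ∂(volume.restrict D), dilatation g m D (fun y => u y - v y) x =
      dilatation g m D u x - dilatation g m D v x := by
    filter_upwards [hI hu, hI hv] with x hxu hxv
    simp only [dilatation_eq, hproj, smul_sub]
    rw [integral_sub hxu.1 hxv.1, mul_sub]
  filter_upwards [hI hu, hI hv, hdil] with x hxu hxv hx
  have h1 : ∫ y in D, g ‖y - x‖ • dilTerm g m D (fun y => u y - v y) (x, y) =
      (∫ y in D, g ‖y - x‖ • dilTerm g m D u (x, y)) -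
        ∫ y in D, g ‖y - x‖ • dilTerm g m D v (x, y) := by
    rw [← integral_sub hxu.2.1 hxv.2.1]
    refine integral_congr_ae ?_
    filter_upwards [hdil] with y hy
    simp only [dilTerm, hx, hy]
    module
  have h2 : ∫ y in D, g ‖y - x‖ • devTerm (fun y => u y - v y) (x, y) =
      (∫ y in D, g ‖y - x‖ • devTerm u (x, y)) - ∫ y in D, g ‖y - x‖ • devTerm v (x, y) := by
    rw [← integral_sub hxu.2.2 hxv.2.2]
    congr 1; ext1 y
    simp only [devTerm, hproj, sub_div]
    module
  rw [lpsOperator_eq, lpsOperator_eq, lpsOperator_eq, h1, h2]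
  module

/-- Testing the LPS operator with the field itself. -/
theorem integral_inner_lpsOperator (h : IsLPSWeight g m D B) (lam mu : ℝ) {e : Sp d → Sp d}
    (he : MemLp e 2 (volume.restrict D)) :
    Integrable (fun x => ⟪e x, lpsOperator lam mu g m D e x⟫) (volume.restrict D) ∧
    ∫ x in D, ⟪e x, lpsOperator lam mu g m D e x⟫ =
      -(lpsC₁ d / 2 * (lam - mu) * ∫ x in D, dilatation g m D e x ^ 2) -
      lpsC₂ d / 2 * mu *
        (1 / m * ∫ p, (projInc e p / ‖p.2 - p.1‖) ^ 2 ∂(lpsMeasure g D)) := by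
  have := h.isFiniteMeasure
  have hm := h.pos
  have he1 : MemLp (fun p : Sp d × Sp d => e p.1) 2 (lpsMeasure g D) := h.pair.memLp_fst he
  set F1 : Sp d × Sp d → ℝ := fun p => ⟪e p.1, dilTerm g m D e p⟫ with hF1def
  set F2 : Sp d × Sp d → ℝ := fun p => ⟪e p.1, devTerm e p⟫ with hF2def
  have hF1 : Integrable F1 (lpsMeasure g D) :=
    integrable_inner_of_memLp he1 (h.memLp_dilTerm he)
  have hF2 : Integrable F2 (lpsMeasure g D) :=
    integrable_inner_of_memLp he1 (h.memLp_devTerm he)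
  have hae : ∀ᵐ x ∂(volume.restrict D), ⟪e x, lpsOperator lam mu g m D e x⟫ =
      (lpsC₁ d / m * (lam - mu)) * (∫ y in D, g ‖y - x‖ • F1 (x, y)) +
      (lpsC₂ d / m * mu) * ∫ y in D, g ‖y - x‖ • F2 (x, y) := by
    filter_upwards [h.pair.ae_integrable ((h.memLp_dilTerm he).integrable (by norm_num)),
      h.pair.ae_integrable ((h.memLp_devTerm he).integrable (by norm_num))] with x hx1 hx2
    rw [lpsOperator_eq, inner_add_right, inner_smul_right, inner_smul_right,
      ← integral_inner hx1, ← integral_inner hx2]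
    simp only [inner_smul_right, hF1def, hF2def, smul_eq_mul]
  have hi1 := h.pair.integrable_integral hF1
  have hi2 := h.pair.integrable_integral hF2
  refine ⟨((hi1.const_mul _).add (hi2.const_mul _)).congr (hae.mono fun x hx => hx.symm), ?_⟩
  rw [integral_congr_ae hae, integral_add (hi1.const_mul _) (hi2.const_mul _), integral_const_mul,
    integral_const_mul, ← h.pair.integral_eq hF1, ← h.pair.integral_eq hF2]
  have hθ1 : MemLp (fun p : Sp d × Sp d => dilatation g m D e p.1) 2 (lpsMeasure g D) :=
    h.pair.memLp_fst (h.memLp_dilatation he)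
  have hθ2 : MemLp (fun p : Sp d × Sp d => dilatation g m D e p.2) 2 (lpsMeasure g D) :=
    h.pair.memLp_snd (h.memLp_dilatation he)
  -- Symmetrizing in x and y turns the test value e(x) into minus the projected increment of e,
  -- since the rest of both integrands is odd under the swap.
  have hinner : ∀ p : Sp d × Sp d,
      ⟪e p.1, p.2 - p.1⟫ + ⟪e p.2, p.1 - p.2⟫ = -projInc e p := fun p => by
    simp only [projInc]
    rw [← neg_sub p.2 p.1, inner_neg_right, real_inner_comm (p.2 - p.1),
      real_inner_comm (p.2 - p.1) (e p.2), inner_sub_right]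
    ring
  have hI1 : Integrable (fun p => dilatation g m D e p.1 * projInc e p) (lpsMeasure g D) :=
    hθ1.integrable_mul (h.memLp_projInc he)
  have hI2 : Integrable (fun p => dilatation g m D e p.2 * projInc e p) (lpsMeasure g D) :=
    hθ2.integrable_mul (h.memLp_projInc he)
  have hs : ∫ p, dilatation g m D e p.2 * projInc e p ∂(lpsMeasure g D) =
      ∫ p, dilatation g m D e p.1 * projInc e p ∂(lpsMeasure g D) := by
    rw [lpsMeasure, ← h.pair.integral_swap]
    simp only [projInc_swap, Prod.snd_swap]
  -- For fixed x, the y-integral of projInc is m/2 times the dilatation by definition, which is how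
  -- θ² appears.
  have hθθ : ∫ p, dilatation g m D e p.1 * projInc e p ∂(lpsMeasure g D) =
      m / 2 * ∫ x in D, dilatation g m D e x ^ 2 := by
    rw [lpsMeasure, h.pair.integral_eq hI1, ← integral_const_mul]
    congr 1; ext1 x
    have h1 : ∀ y, g ‖y - x‖ • (dilatation g m D e x * projInc e (x, y)) =
        dilatation g m D e x * (g ‖y - x‖ • projInc e (x, y)) := fun y => by
      simp only [smul_eq_mul]; ring
    simp only [h1]
    rw [integral_const_mul]
    have h2 := dilatation_eq (g := g) (m := m) (D := D) e x
    have h3 : ∫ y in D, g ‖y - x‖ • projInc e (x, y) = m / 2 * dilatation g m D e x := by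
      rw [h2]; field_simp
    rw [h3]; ring
  have hA : ∫ p, F1 p ∂(lpsMeasure g D) = -(m / 2 * ∫ x in D, dilatation g m D e x ^ 2) := by
    have h1 := h.two_mul_integral hF1
    have h2 : ∀ p, F1 p + F1 p.swap = -(dilatation g m D e p.1 * projInc e p) -
        dilatation g m D e p.2 * projInc e p := fun p => by
      simp only [hF1def, dilTerm, Prod.fst_swap, Prod.snd_swap, inner_smul_right]
      linear_combination (dilatation g m D e p.1 + dilatation g m D e p.2) * hinner p
    simp only [h2] at h1
    have h3 : ∫ p, (-(dilatation g m D e p.1 * projInc e p) -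
        dilatation g m D e p.2 * projInc e p) ∂(lpsMeasure g D) =
        -∫ p, dilatation g m D e p.1 * projInc e p ∂(lpsMeasure g D) -
        ∫ p, dilatation g m D e p.2 * projInc e p ∂(lpsMeasure g D) := by
      rw [← integral_neg]; exact integral_sub hI1.neg hI2
    rw [h3, hs, hθθ] at h1
    linarith
  have hB : ∫ p, F2 p ∂(lpsMeasure g D) =
      -(1 / 2 * ∫ p, (projInc e p / ‖p.2 - p.1‖) ^ 2 ∂(lpsMeasure g D)) := by
    have h1 := h.two_mul_integral hF2
    have h2 : ∀ p, F2 p + F2 p.swap = -(projInc e p / ‖p.2 - p.1‖) ^ 2 := fun p => by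
      simp only [hF2def, devTerm, Prod.fst_swap, Prod.snd_swap, inner_smul_right, projInc_swap]
      rw [norm_sub_rev p.1 p.2]
      linear_combination (projInc e p / ‖p.2 - p.1‖ ^ 2) * hinner p
    simp only [h2] at h1
    rw [integral_neg] at h1
    linarith
  have hA' : ∫ p, F1 p ∂(pairMeasure (volume.restrict D) fun x y => g ‖y - x‖) = _ := hA
  have hB' : ∫ p, F2 p ∂(pairMeasure (volume.restrict D) fun x y => g ‖y - x‖) = _ := hB
  rw [hA', hB']
  field_simp
  ring

/-- Coercivity of the LPS form, with the sharp condition on the Lamé constants. -/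
theorem exists_coercive (hd : 1 ≤ d) {lam mu : ℝ} (hmu : 0 < mu) (hlam : 0 < d * lam + 2 * mu) :
    ∃ c : ℝ, 0 < c ∧ ∀ (g : ℝ → ℝ) (m : ℝ) (D : Set (Sp d)) (B : ℝ≥0∞), IsLPSWeight g m D B →
      ∀ e : Sp d → Sp d, MemLp e 2 (volume.restrict D) →
      c * (1 / m * ∫ p, (projInc e p / ‖p.2 - p.1‖) ^ 2 ∂(lpsMeasure g D)) ≤
        -∫ x in D, ⟪e x, lpsOperator lam mu g m D e x⟫ := by
  have hd' : (0 : ℝ) < d := by exact_mod_cast hd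
  -- With E the energy and T the integral of θ², the form is d²(λ-μ)T/4 + d(d+2)μE. If λ ≥ μ the
  -- first term is dropped; if λ ≤ μ the bound T ≤ 4E leaves d(dλ+2μ)E.
  refine ⟨min (d * (d + 2) * mu) (d * (d * lam + 2 * mu)), by positivity,
    fun g m D B h e he => ?_⟩
  rw [(h.integral_inner_lpsOperator lam mu he).2]
  have h1 := h.integral_dilatation_sq_le he
  have hm := h.pos
  have hQ : 0 ≤ ∫ p, (projInc e p / ‖p.2 - p.1‖) ^ 2 ∂(lpsMeasure g D) :=
    integral_nonneg fun p => sq_nonneg _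
  have hθ : 0 ≤ ∫ x in D, dilatation g m D e x ^ 2 := integral_nonneg fun p => sq_nonneg _
  set Q := ∫ p, (projInc e p / ‖p.2 - p.1‖) ^ 2 ∂(lpsMeasure g D)
  set T := ∫ x in D, dilatation g m D e x ^ 2
  have hE : 0 ≤ 1 / m * Q := by positivity
  have hT : T ≤ 4 * (1 / m * Q) := by
    calc T ≤ 4 / m * Q := h1
      _ = _ := by ring
  set E := 1 / m * Q
  rw [lpsC₁, lpsC₂]
  rcases le_total mu lam with hle | hle
  · have h2 : min (d * (d + 2) * mu) (d * (d * lam + 2 * mu)) * E ≤ d * (d + 2) * mu * E := by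
      gcongr; exact min_le_left _ _
    have h3 : 0 ≤ (d : ℝ) ^ 2 / 2 / 2 * (lam - mu) * T := by
      have : 0 ≤ lam - mu := by linarith
      positivity
    linarith
  · have h2 : min (d * (d + 2) * mu) (d * (d * lam + 2 * mu)) * E ≤
        d * (d * lam + 2 * mu) * E := by
      gcongr; exact min_le_right _ _
    have h3 : (d : ℝ) ^ 2 / 2 / 2 * (mu - lam) * T ≤
        (d : ℝ) ^ 2 / 2 / 2 * (mu - lam) * (4 * E) := by
      have : 0 ≤ mu - lam := by linarith
      gcongr
    nlinarith

/-- An `L²` bound from a Poincaré inequality and a bound of the residual. -/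
theorem eLpNorm_le_of_residual_le (h : IsLPSWeight g m D B) {lam mu c : ℝ} (hc : 0 < c)
    {δ : ℝ} (hδ : ∀ t, δ ≤ t → g t = 0) {e : Sp d → Sp d}
    (he : MemLp e 2 (volume.restrict D))
    (hcoer : c * (1 / m * ∫ p, (projInc e p / ‖p.2 - p.1‖) ^ 2 ∂(lpsMeasure g D)) ≤
        -∫ x in D, ⟪e x, lpsOperator lam mu g m D e x⟫) {A : ℝ} {P : ℝ≥0∞}
    (hres : ∀ᵐ x ∂(volume.restrict D), |⟪e x, lpsOperator lam mu g m D e x⟫| ≤ A * ‖e x‖)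
    (hP : (eLpNorm e 2 (volume.restrict D)) ^ 2 ≤ P * lpsEnergySq g δ m D e) :
    eLpNorm e 2 (volume.restrict D) ≤
      P * ENNReal.ofReal (c⁻¹ * A) * volume D ^ (1 / 2 : ℝ) := by
  rw [← Measure.restrict_apply_univ D]
  refine eLpNorm_two_le_of_sq_le he (hP.trans ?_)
  rw [mul_assoc]
  gcongr
  rw [h.lpsEnergySq_eq hδ he, ← lintegral_const_mul'' _ he.1.enorm]
  have h1 : 1 / m * ∫ p, (projInc e p / ‖p.2 - p.1‖) ^ 2 ∂(lpsMeasure g D) ≤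
      ∫ x in D, -(c⁻¹ * ⟪e x, lpsOperator lam mu g m D e x⟫) := by
    rw [integral_neg, integral_const_mul, ← mul_neg, ← div_eq_inv_mul, le_div_iff₀ hc, mul_comm]
    exact hcoer
  refine (ENNReal.ofReal_le_ofReal h1).trans ((Real.ofReal_le_enorm _).trans
    ((enorm_integral_le_lintegral_enorm _).trans (lintegral_mono_ae ?_)))
  filter_upwards [hres] with x hx
  rw [← ofReal_norm, ← ofReal_norm, norm_neg, norm_mul, Real.norm_eq_abs, Real.norm_eq_abs,
    ← ENNReal.ofReal_mul' (norm_nonneg _), abs_of_pos (inv_pos.2 hc), mul_assoc]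
  exact ENNReal.ofReal_le_ofReal (by gcongr)

end IsLPSWeight

/-! ### Taylor expansion -/

theorem IsC4Bounded.contDiffAt {d : ℕ} {F : Type*} [NormedAddCommGroup F] [NormedSpace ℝ F]
    {D : Set (Sp d)} {M : ℝ} {u : Sp d → F} (hu : IsC4Bounded D M u) (hD : IsOpen D) {x : Sp d}
    (hx : x ∈ D) : ContDiffAt ℝ 4 u x :=
  hu.contDiffOn.contDiffAt (hD.mem_nhds hx)

theorem IsC4Bounded.norm_le {d : ℕ} {F : Type*} [NormedAddCommGroup F] [NormedSpace ℝ F]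
    {D : Set (Sp d)} {M : ℝ} {u : Sp d → F} (hu : IsC4Bounded D M u) {x : Sp d} (hx : x ∈ D) :
    ‖u x‖ ≤ M := by
  simpa using hu.bound 0 (by norm_num) x hx

theorem IsC4Bounded.aestronglyMeasurable {d : ℕ} {F : Type*} [NormedAddCommGroup F]
    [NormedSpace ℝ F] {D : Set (Sp d)} {M : ℝ} {u : Sp d → F}
    (hu : IsC4Bounded D M u) (hD : IsOpen D) : AEStronglyMeasurable u (volume.restrict D) :=
  hu.contDiffOn.continuousOn.aestronglyMeasurable hD.measurableSet

theorem IsC4Bounded.memLp {d : ℕ} {F : Type*} [NormedAddCommGroup F]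
    [NormedSpace ℝ F] {D : Set (Sp d)} {M : ℝ} {u : Sp d → F}
    (hu : IsC4Bounded D M u) (hD : IsOpen D) [IsFiniteMeasure (volume.restrict D)] (p : ℝ≥0∞) :
    MemLp u p (volume.restrict D) := by
  refine MemLp.of_bound (hu.aestronglyMeasurable hD) M ?_
  filter_upwards [ae_restrict_mem hD.measurableSet] with x hx using hu.norm_le hx

/-- Taylor's inequality for a function with bounded derivatives. -/
theorem norm_sub_taylor_le {E F : Type*} [NormedAddCommGroup E] [NormedSpace ℝ E]
    [NormedAddCommGroup F] [NormedSpace ℝ F] [CompleteSpace F] {u : E → F} {x z : E} {n : ℕ}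
    {M : ℝ} (hu : ∀ t ∈ Icc (0 : ℝ) 1, ContDiffAt ℝ (n + 1) u (x + t • z))
    (hM : ∀ t ∈ Icc (0 : ℝ) 1, ‖iteratedFDeriv ℝ (n + 1) u (x + t • z)‖ ≤ M) :
    ‖u (x + z) - ∑ k ∈ Finset.range (n + 1),
      (k.factorial : ℝ)⁻¹ • iteratedFDeriv ℝ k u x (fun _ => z)‖ ≤ M * ‖z‖ ^ (n + 1) := by
  rw [map_add_eq_sum_add_integral_iteratedFDeriv hu, add_sub_cancel_left, norm_smul]
  have hM0 : 0 ≤ M := (norm_nonneg _).trans (hM 0 (by simp))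
  have h1 : ‖∫ t in (0 : ℝ)..1, (1 - t) ^ n • iteratedFDeriv ℝ (n + 1) u (x + t • z)
      (fun _ => z)‖ ≤ M * ‖z‖ ^ (n + 1) * |1 - 0| := by
    refine intervalIntegral.norm_integral_le_of_norm_le_const fun t ht => ?_
    rw [uIoc_of_le zero_le_one] at ht
    have ht' : t ∈ Icc (0 : ℝ) 1 := ⟨ht.1.le, ht.2⟩
    rw [norm_smul, Real.norm_eq_abs, abs_of_nonneg (pow_nonneg (by linarith [ht'.2]) n)]
    have h2 : (1 - t) ^ n ≤ 1 := pow_le_one₀ (by linarith [ht'.2]) (by linarith [ht'.1])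
    have h3 : ‖iteratedFDeriv ℝ (n + 1) u (x + t • z) (fun _ => z)‖ ≤ M * ‖z‖ ^ (n + 1) := by
      refine (ContinuousMultilinearMap.le_opNorm _ _).trans ?_
      simp only [Finset.prod_const, Finset.card_univ, Fintype.card_fin]
      gcongr
      exact hM t ht'
    calc _ ≤ 1 * (M * ‖z‖ ^ (n + 1)) := by gcongr
      _ = _ := one_mul _
  rw [sub_zero, abs_one, mul_one] at h1
  have h2 : ‖((n.factorial : ℝ))⁻¹‖ ≤ 1 := by
    rw [norm_inv, Real.norm_natCast]
    exact inv_le_one_of_one_le₀ (by exact_mod_cast n.factorial_pos)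
  calc _ ≤ 1 * (M * ‖z‖ ^ (n + 1)) := by gcongr
    _ = _ := one_mul _

theorem IsC4Bounded.taylor {d : ℕ} {F : Type*} [NormedAddCommGroup F] [NormedSpace ℝ F]
    [CompleteSpace F] {D : Set (Sp d)} {M : ℝ} {u : Sp d → F} (hu : IsC4Bounded D M u)
    (hD : IsOpen D) {x z : Sp d} {r : ℝ} (hx : Metric.ball x r ⊆ D) (hz : ‖z‖ < r) {n : ℕ}
    (hn : n + 1 ≤ 4) :
    ‖u (x + z) - ∑ k ∈ Finset.range (n + 1),
      (k.factorial : ℝ)⁻¹ • iteratedFDeriv ℝ k u x (fun _ => z)‖ ≤ M * ‖z‖ ^ (n + 1) := by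
  have hseg : ∀ t ∈ Icc (0 : ℝ) 1, x + t • z ∈ D := fun t ht => hx (by
    rw [Metric.mem_ball, dist_eq_norm, add_sub_cancel_left, norm_smul, Real.norm_eq_abs,
      abs_of_nonneg ht.1]
    nlinarith [ht.2, norm_nonneg z])
  refine norm_sub_taylor_le (fun t ht => ?_) fun t ht => hu.bound _ hn _ (hseg t ht)
  exact (hu.contDiffAt hD (hseg t ht)).of_le (by exact_mod_cast hn)

/-! ### Consistency of the nonlocal Laplacian -/

/-- Expanding a Taylor term in coordinates reduces its integral to the coordinate moments that the
scaling hypothesis controls. -/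
theorem apply_diag_eq_sum {d k : ℕ} {F : Type*} [NormedAddCommGroup F] [NormedSpace ℝ F]
    (A : (Sp d) [×k]→L[ℝ] F) (z : Sp d) :
    A (fun _ => z) = ∑ i : Fin k → Fin d,
      (∏ j, z (i j)) • A (fun j => EuclideanSpace.single (i j) 1) := by
  have hz : z = ∑ i : Fin d, z i • (EuclideanSpace.single i (1 : ℝ) : Sp d) := by
    simpa using ((EuclideanSpace.basisFun (Fin d) ℝ).sum_repr z).symm
  conv_lhs => rw [hz]
  rw [A.map_sum]
  refine Finset.sum_congr rfl fun i _ => ?_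
  exact A.map_smul_univ _ _

theorem norm_apply_single_le {d k : ℕ} {F : Type*} [NormedAddCommGroup F] [NormedSpace ℝ F]
    (A : (Sp d) [×k]→L[ℝ] F) (i : Fin k → Fin d) :
    ‖A (fun j => EuclideanSpace.single (i j) 1)‖ ≤ ‖A‖ := by
  refine (A.le_opNorm _).trans ?_
  simp

namespace IsPoissonKernel

variable {d : ℕ} {Ω : Set (Sp d)} {δ₀ : ℝ} {γ : ℝ → Sp d → Sp d → ℝ}

/-- The assumed bound is on the squares of the rows; t ≤ 1 + t² and the finite volume of the
extended domain convert it into a bound of the row mass. -/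
theorem isPairKernel (hγ : IsPoissonKernel Ω δ₀ γ) (hΩ : Bornology.IsBounded Ω) {δ : ℝ}
    (hδ : δ ∈ Ioc 0 δ₀) : ∃ B, IsPairKernel (volume.restrict (extDomain Ω δ)) (γ δ) B := by
  obtain ⟨γ₁, γ₂, -, -, -, h2⟩ := hγ.integrable δ hδ
  refine ⟨volume (extDomain Ω δ) + ENNReal.ofReal (γ₂ ^ 2), hγ.measurable δ hδ, hγ.nonneg δ hδ,
    hγ.symm δ hδ, ?_, ?_⟩
  · exact ENNReal.add_ne_top.2 ⟨(isBounded_extDomain hΩ hδ.1).measure_lt_top.ne,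
      ENNReal.ofReal_ne_top⟩
  · filter_upwards [ae_restrict_mem (measurableSet_extDomain Ω hδ.1)] with x hx
    calc ∫⁻ y in extDomain Ω δ, ENNReal.ofReal (γ δ x y)
        ≤ ∫⁻ y in extDomain Ω δ, (1 + ENNReal.ofReal (γ δ x y ^ 2)) := by
          refine lintegral_mono fun y => ?_
          rw [← ENNReal.ofReal_one, ← ENNReal.ofReal_add zero_le_one (sq_nonneg _)]
          exact ENNReal.ofReal_le_ofReal (by nlinarith [sq_nonneg (γ δ x y - 1)])
      _ = volume (extDomain Ω δ) + ∫⁻ y in extDomain Ω δ, ENNReal.ofReal (γ δ x y ^ 2) := by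
          rw [lintegral_add_left measurable_const]; simp
      _ ≤ _ := by gcongr; exact h2 x hx

theorem measurable_row (hγ : IsPoissonKernel Ω δ₀ γ) {δ : ℝ} (hδ : δ ∈ Ioc 0 δ₀) (x : Sp d) :
    Measurable (γ δ x) := (hγ.measurable δ hδ).of_uncurry_left

theorem eq_zero_of_notMem (hγ : IsPoissonKernel Ω δ₀ γ) {δ : ℝ} (hδ : δ ∈ Ioc 0 δ₀) {x : Sp d}
    (hx : x ∈ Ω) {y : Sp d} (hy : y ∉ extDomain Ω δ) : γ δ x y = 0 :=
  hγ.eq_zero δ hδ x hx y fun h => hy (ball_subset_extDomain hδ.1 hx h)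

theorem setIntegral_eq (hγ : IsPoissonKernel Ω δ₀ γ) {δ : ℝ} (hδ : δ ∈ Ioc 0 δ₀) {x : Sp d}
    (hx : x ∈ Ω) (f : Sp d → ℝ) :
    ∫ y in extDomain Ω δ, f y * γ δ x y = ∫ y, f y * γ δ x y :=
  setIntegral_eq_integral_of_forall_compl_eq_zero fun y hy => by
    rw [hγ.eq_zero_of_notMem hδ hx hy, mul_zero]

/-- For x in Ω the kernel row is supported in the extended domain. So the equation in Ω and the flux
condition in Ω_loc concern one operator, the one that the energy identity tests. -/
theorem nonlocalLaplacian_eq (hγ : IsPoissonKernel Ω δ₀ γ) {δ : ℝ} (hδ : δ ∈ Ioc 0 δ₀)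
    {x : Sp d} (hx : x ∈ Ω) (u : Sp d → ℝ) :
    -(nonlocalLaplacian (γ δ) u x) = 2 * nonlocalFlux (γ δ) (extDomain Ω δ) u x := by
  rw [nonlocalLaplacian, nonlocalFlux, hγ.setIntegral_eq hδ hx fun y => u y - u x]
  ring

theorem integrable_row (hγ : IsPoissonKernel Ω δ₀ γ) (hΩ : Bornology.IsBounded Ω) {δ : ℝ}
    (hδ : δ ∈ Ioc 0 δ₀) {x : Sp d} (hx : x ∈ Ω) :
    Integrable (γ δ x) (volume.restrict (extDomain Ω δ)) := by
  obtain ⟨γ₁, γ₂, -, -, -, h2⟩ := hγ.integrable δ hδ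
  have : IsFiniteMeasure (volume.restrict (extDomain Ω δ)) :=
    ⟨by simpa using (isBounded_extDomain hΩ hδ.1).measure_lt_top⟩
  have hm := (hγ.measurable_row hδ x).aestronglyMeasurable (μ := volume.restrict (extDomain Ω δ))
  have hmem : MemLp (γ δ x) 2 (volume.restrict (extDomain Ω δ)) := by
    rw [memLp_two_iff_integrable_sq hm]
    refine ⟨hm.pow 2, ?_⟩
    rw [hasFiniteIntegral_iff_ofReal (ae_of_all _ fun _ => sq_nonneg _)]
    exact (h2 x (Or.inl hx)).trans_lt ENNReal.ofReal_lt_top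
  exact hmem.integrable (by norm_num)

theorem integrable_mul_row (hγ : IsPoissonKernel Ω δ₀ γ) (hΩ : Bornology.IsBounded Ω) {δ : ℝ}
    (hδ : δ ∈ Ioc 0 δ₀) {x : Sp d} (hx : x ∈ Ω) {f : Sp d → ℝ}
    (hf : AEStronglyMeasurable f (volume.restrict (extDomain Ω δ))) {c : ℝ}
    (hc : ∀ y ∈ Metric.ball x δ, |f y| ≤ c) :
    Integrable (fun y => f y * γ δ x y) (volume.restrict (extDomain Ω δ)) := by
  refine ((hγ.integrable_row hΩ hδ hx).const_mul c).mono'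
    (hf.mul (hγ.measurable_row hδ x).aestronglyMeasurable) (ae_of_all _ fun y => ?_)
  rw [norm_mul, Real.norm_eq_abs, Real.norm_eq_abs, abs_of_nonneg (hγ.nonneg δ hδ x y)]
  by_cases hy : y ∈ Metric.ball x δ
  · have := hγ.nonneg δ hδ x y
    gcongr
    exact hc y hy
  · simp [hγ.eq_zero δ hδ x hx y hy]

theorem integrable_prod_row (hγ : IsPoissonKernel Ω δ₀ γ) (hΩ : Bornology.IsBounded Ω) {δ : ℝ}
    (hδ : δ ∈ Ioc 0 δ₀) {x : Sp d} (hx : x ∈ Ω) {k : ℕ} (i : Fin k → Fin d) :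
    Integrable (fun y => (∏ j, (y - x) (i j)) * γ δ x y)
      (volume.restrict (extDomain Ω δ)) := by
  refine hγ.integrable_mul_row hΩ hδ hx (c := δ ^ k) ?_ fun y hy => ?_
  · apply Continuous.aestronglyMeasurable; fun_prop
  · rw [Metric.mem_ball, dist_eq_norm] at hy
    rw [Finset.abs_prod]
    calc ∏ j, |(y - x) (i j)| ≤ ∏ _j : Fin k, δ :=
          Finset.prod_le_prod (fun _ _ => abs_nonneg _) fun j _ =>
            (PiLp.norm_apply_le (y - x) (i j)).trans hy.le
      _ = δ ^ k := by simp

theorem integral_apply_diag (hγ : IsPoissonKernel Ω δ₀ γ) (hΩ : Bornology.IsBounded Ω) {δ : ℝ}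
    (hδ : δ ∈ Ioc 0 δ₀) {x : Sp d} (hx : x ∈ Ω) {k : ℕ} (A : (Sp d) [×k]→L[ℝ] ℝ) :
    Integrable (fun y => A (fun _ => y - x) * γ δ x y) (volume.restrict (extDomain Ω δ)) ∧
    ∫ y in extDomain Ω δ, A (fun _ => y - x) * γ δ x y = ∑ i : Fin k → Fin d,
      (∫ y, (∏ j, (y - x) (i j)) * γ δ x y) * A (fun j => EuclideanSpace.single (i j) 1) := by
  have h1 : ∀ y, A (fun _ => y - x) * γ δ x y = ∑ i : Fin k → Fin d,
      ((∏ j, (y - x) (i j)) * γ δ x y) * A (fun j => EuclideanSpace.single (i j) 1) := fun y => by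
    rw [apply_diag_eq_sum, Finset.sum_mul]
    refine Finset.sum_congr rfl fun i _ => ?_
    rw [smul_eq_mul]; ring
  simp only [h1]
  have h2 := fun i : Fin k → Fin d => (hγ.integrable_prod_row hΩ hδ hx i).mul_const
    (A (fun j => EuclideanSpace.single (i j) 1))
  refine ⟨integrable_finsetSum _ fun i _ => h2 i, ?_⟩
  rw [integral_finsetSum _ fun i _ => h2 i]
  refine Finset.sum_congr rfl fun i _ => ?_
  rw [integral_mul_const, hγ.setIntegral_eq hδ hx fun y => ∏ j, (y - x) (i j)]

theorem integral_norm_sq_row (hγ : IsPoissonKernel Ω δ₀ γ) (hΩ : Bornology.IsBounded Ω) {δ : ℝ}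
    (hδ : δ ∈ Ioc 0 δ₀) {x : Sp d} (hx : x ∈ Ω) :
    Integrable (fun y => ‖y - x‖ ^ 2 * γ δ x y) (volume.restrict (extDomain Ω δ)) ∧
    ∫ y in extDomain Ω δ, ‖y - x‖ ^ 2 * γ δ x y =
      ∑ i, ∫ y, (y i - x i) * (y i - x i) * γ δ x y := by
  have h1 : ∀ y, ‖y - x‖ ^ 2 * γ δ x y =
      ∑ i : Fin d, (∏ j : Fin 2, (y - x) ((fun _ => i) j)) * γ δ x y := fun y => by
    rw [EuclideanSpace.real_norm_sq_eq, Finset.sum_mul]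
    simp [sq]
  simp only [h1]
  have h2 := fun i : Fin d => hγ.integrable_prod_row hΩ hδ hx (fun _ : Fin 2 => i)
  refine ⟨integrable_finsetSum _ fun i _ => h2 i, ?_⟩
  rw [integral_finsetSum _ fun i _ => h2 i]
  refine Finset.sum_congr rfl fun i _ => ?_
  rw [hγ.setIntegral_eq hδ hx fun y => ∏ j : Fin 2, (y - x) ((fun _ => i) j)]
  simp [sq]

/-- The nonlocal Laplacian is a second order approximation of the Laplacian. -/
theorem exists_consistency (hγ : IsPoissonKernel Ω δ₀ γ) (hΩ : Bornology.IsBounded Ω) :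
    ∃ C : ℝ, ∀ δ ∈ Ioc 0 δ₀, ∀ (M : ℝ) (u : Sp d → ℝ), IsC4Bounded (extDomain Ω δ) M u →
      ∀ x ∈ Ω, |nonlocalLaplacian (γ δ) u x - Laplacian.laplacian u x| ≤ C * M * δ ^ 2 := by
  obtain ⟨K, hK⟩ := hγ.scaled
  -- Twice the Taylor weights 1, 1/2, 1/6 on the d, d², d³ moments (the last one rounded up from 1/3
  -- to 1), plus twice the fourth-order remainder.
  refine ⟨2 * (d * K) + d ^ 2 * K + d ^ 3 * K + 2 * (d * (1 + K * δ₀ ^ 2)),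
    fun δ hδ M u hu x hx => ?_⟩
  obtain ⟨hK1, hK2, hK3⟩ := hK δ hδ x hx
  have hD : IsOpen (extDomain Ω δ) := isOpen_extDomain Ω hδ.1
  set D := extDomain Ω δ with hDdef
  have hball : Metric.ball x δ ⊆ D := ball_subset_extDomain hδ.1 hx
  have hxD : x ∈ D := Or.inl hx
  have hM0 : 0 ≤ M := (norm_nonneg _).trans (hu.norm_le hxD)
  set A := fun k : ℕ => iteratedFDeriv ℝ k u x with hA
  have hAM : ∀ k, k ≤ 4 → ‖A k‖ ≤ M := fun k hk => hu.bound k hk x hxD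
  have hAi : ∀ k, k ≤ 4 → ∀ i : Fin k → Fin d,
      |A k (fun j => EuclideanSpace.single (i j) 1)| ≤ M := fun k hk i =>
    (norm_apply_single_le (A k) i).trans (hAM k hk)
  obtain ⟨i1, e1⟩ := hγ.integral_apply_diag hΩ hδ hx (A 1)
  obtain ⟨i2, e2⟩ := hγ.integral_apply_diag hΩ hδ hx (A 2)
  obtain ⟨i3, e3⟩ := hγ.integral_apply_diag hΩ hδ hx (A 3)
  obtain ⟨in2, en2⟩ := hγ.integral_norm_sq_row hΩ hδ hx
  rw [← hDdef] at i1 i2 i3 e1 e2 e3 in2 en2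
  -- the three polynomial terms
  set I1 := ∫ y in D, A 1 (fun _ => y - x) * γ δ x y
  set I2 := ∫ y in D, A 2 (fun _ => y - x) * γ δ x y
  set I3 := ∫ y in D, A 3 (fun _ => y - x) * γ δ x y
  have hI1 : |I1| ≤ d * (K * δ ^ 2 * M) := by
    rw [e1]
    refine (Finset.abs_sum_le_sum_abs _ _).trans ?_
    calc _ ≤ ∑ i : Fin 1 → Fin d, K * δ ^ 2 * M := by
          refine Finset.sum_le_sum fun i _ => ?_
          rw [abs_mul]
          have h := hK1 (i 0)
          refine mul_le_mul ?_ (hAi 1 (by norm_num) i) (abs_nonneg _) ((abs_nonneg _).trans h)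
          simpa using h
      _ = _ := by simp
  have hI3 : |I3| ≤ d ^ 3 * (K * δ ^ 2 * M) := by
    rw [e3]
    refine (Finset.abs_sum_le_sum_abs _ _).trans ?_
    calc _ ≤ ∑ i : Fin 3 → Fin d, K * δ ^ 2 * M := by
          refine Finset.sum_le_sum fun i _ => ?_
          rw [abs_mul]
          have h := hK3 (i 0) (i 1) (i 2)
          refine mul_le_mul ?_ (hAi 3 (by norm_num) i) (abs_nonneg _) ((abs_nonneg _).trans h)
          simpa [Fin.prod_univ_three] using h
      _ = _ := by simp
  -- The Laplacian as the contraction of the Hessian with the identity, to be matched with the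
  -- second-moment matrix.
  have hlap : Laplacian.laplacian u x = ∑ i : Fin 2 → Fin d,
      (if i 0 = i 1 then 1 else 0) * A 2 (fun j => EuclideanSpace.single (i j) 1) := by
    rw [congrFun (InnerProductSpace.laplacian_eq_iteratedFDeriv_orthonormalBasis u
      (EuclideanSpace.basisFun (Fin d) ℝ)) x]
    rw [← Equiv.sum_comp (finTwoArrowEquiv (Fin d)).symm, Fintype.sum_prod_type]
    simp only [finTwoArrowEquiv_symm_apply, Matrix.cons_val_zero, Matrix.cons_val_one, ite_mul,
      one_mul, zero_mul, Finset.sum_ite_eq, Finset.mem_univ, if_true, hA]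
    refine Finset.sum_congr rfl fun i _ => ?_
    congr 1
    ext j : 1
    fin_cases j <;> simp
  have hI2 : |I2 - Laplacian.laplacian u x| ≤ d ^ 2 * (K * δ ^ 2 * M) := by
    rw [e2, hlap, ← Finset.sum_sub_distrib]
    refine (Finset.abs_sum_le_sum_abs _ _).trans ?_
    calc _ ≤ ∑ i : Fin 2 → Fin d, K * δ ^ 2 * M := by
          refine Finset.sum_le_sum fun i _ => ?_
          rw [← sub_mul, abs_mul]
          have h := hK2 (i 0) (i 1)
          refine mul_le_mul ?_ (hAi 2 (by norm_num) i) (abs_nonneg _) ((abs_nonneg _).trans h)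
          simpa [Fin.prod_univ_two] using h
      _ = _ := by simp
  -- the remainder
  have hud : Integrable (fun y => (u y - u x) * γ δ x y) (volume.restrict D) := by
    refine hγ.integrable_mul_row hΩ hδ hx (c := M + M)
      ((hu.aestronglyMeasurable hD).sub aestronglyMeasurable_const) fun y hy => ?_
    exact (abs_sub _ _).trans (add_le_add (hu.norm_le (hball hy)) (hu.norm_le hxD))
  set I := ∫ y in D, (u y - u x) * γ δ x y with hI
  -- No fourth moment is assumed: M‖z‖⁴ ≤ Mδ²‖z‖² on the support, and the trace of the second
  -- moments is at most d(1 + Kδ₀²).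
  have hrem : |I - I1 - 1 / 2 * I2 - 1 / 6 * I3| ≤ M * δ ^ 2 * (d * (1 + K * δ₀ ^ 2)) := by
    have hsplit : I - I1 - 1 / 2 * I2 - 1 / 6 * I3 = ∫ y in D, ((u y - u x) * γ δ x y -
        A 1 (fun _ => y - x) * γ δ x y - 1 / 2 * (A 2 (fun _ => y - x) * γ δ x y) -
        1 / 6 * (A 3 (fun _ => y - x) * γ δ x y)) := by
      have j1 : Integrable (fun y => (u y - u x) * γ δ x y -
          A 1 (fun _ => y - x) * γ δ x y) (volume.restrict D) := hud.sub i1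
      have j2 : Integrable (fun y => (u y - u x) * γ δ x y - A 1 (fun _ => y - x) * γ δ x y -
          1 / 2 * (A 2 (fun _ => y - x) * γ δ x y)) (volume.restrict D) :=
        j1.sub (i2.const_mul _)
      rw [integral_sub j2 (i3.const_mul _), integral_sub j1 (i2.const_mul _),
        integral_sub hud i1, integral_const_mul, integral_const_mul]
    rw [hsplit, ← Real.norm_eq_abs]
    have hn2 : ∫ y in D, ‖y - x‖ ^ 2 * γ δ x y ≤ d * (1 + K * δ₀ ^ 2) := by
      rw [en2]
      calc _ ≤ ∑ _i : Fin d, (1 + K * δ₀ ^ 2) := by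
            refine Finset.sum_le_sum fun i _ => ?_
            have h := hK2 i i
            rw [if_pos rfl] at h
            have hK0 : 0 ≤ K := nonneg_of_mul_nonneg_left ((abs_nonneg _).trans h)
              (pow_pos hδ.1 2)
            have h2 : K * δ ^ 2 ≤ K * δ₀ ^ 2 := by
              have := hδ.2; have := hδ.1; gcongr
            linarith [(abs_le.1 h).2]
        _ = _ := by rw [Finset.sum_const, Finset.card_fin, nsmul_eq_mul]
    calc _ ≤ ∫ y in D, M * δ ^ 2 * (‖y - x‖ ^ 2 * γ δ x y) := by
          refine norm_integral_le_of_norm_le (in2.const_mul _) (ae_of_all _ fun y => ?_)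
          by_cases hy : y ∈ Metric.ball x δ
          · have hy' := hy
            rw [Metric.mem_ball, dist_eq_norm] at hy'
            have ht := hu.taylor hD hball hy' (n := 3) le_rfl
            rw [add_sub_cancel] at ht
            have hsum : ∑ k ∈ Finset.range (3 + 1), (k.factorial : ℝ)⁻¹ •
                iteratedFDeriv ℝ k u x (fun _ => y - x) = u x + A 1 (fun _ => y - x) +
                1 / 2 * A 2 (fun _ => y - x) + 1 / 6 * A 3 (fun _ => y - x) := by
              simp [Finset.sum_range_succ, hA, Nat.factorial]
            rw [hsum] at ht
            have hγ0 := hγ.nonneg δ hδ x y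
            have hre : (u y - u x) * γ δ x y - A 1 (fun _ => y - x) * γ δ x y -
                1 / 2 * (A 2 (fun _ => y - x) * γ δ x y) -
                1 / 6 * (A 3 (fun _ => y - x) * γ δ x y) =
                (u y - (u x + A 1 (fun _ => y - x) + 1 / 2 * A 2 (fun _ => y - x) +
                  1 / 6 * A 3 (fun _ => y - x))) * γ δ x y := by ring
            rw [hre, norm_mul, Real.norm_of_nonneg hγ0]
            calc _ ≤ M * ‖y - x‖ ^ (3 + 1) * γ δ x y := by gcongr
              _ = M * ‖y - x‖ ^ 2 * (‖y - x‖ ^ 2 * γ δ x y) := by ring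
              _ ≤ _ := by gcongr
          · simp [hγ.eq_zero δ hδ x hx y hy]
      _ ≤ _ := by
          rw [integral_const_mul]
          gcongr
  have hL : nonlocalLaplacian (γ δ) u x = 2 * I := by
    rw [nonlocalLaplacian, hI, hγ.setIntegral_eq hδ hx fun y => u y - u x]
  rw [hL]
  rw [abs_le] at *
  have hd3 : 0 ≤ d ^ 3 * (K * δ ^ 2 * M) := by linarith [hI3.1, hI3.2]
  constructor <;> nlinarith [hI1.1, hI1.2, hI2.1, hI2.2, hI3.1, hI3.2, hrem.1, hrem.2]

/-- The function `A - ‖x‖²` is a supersolution for small horizons. -/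
theorem exists_supersolution (hd : 1 ≤ d) (hγ : IsPoissonKernel Ω δ₀ γ)
    (hΩ : Bornology.IsBounded Ω) :
    ∃ δ₁ : ℝ, 0 < δ₁ ∧ ∀ δ ∈ Ioc 0 δ₀, δ ≤ δ₁ → ∀ A : ℝ, ∀ x ∈ Ω,
      1 ≤ 2 * nonlocalFlux (γ δ) (extDomain Ω δ) (fun y => A - ‖y‖ ^ 2) x := by
  obtain ⟨K, hK⟩ := hγ.scaled
  obtain ⟨R, hR⟩ := hΩ.exists_norm_le
  have hden : 0 < 2 * (|K| * (1 + 2 * |R|)) + 1 := by positivity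
  -- Chosen so that |K|(1+2|R|)δ² ≤ 1/2, with R a bound of Ω. Each coordinate then contributes at
  -- least 1/2, and twice the sum is at least d ≥ 1.
  refine ⟨min 1 (1 / (2 * (|K| * (1 + 2 * |R|)) + 1)), by positivity, fun δ hδ hδ1 A x hx => ?_⟩
  obtain ⟨hK1, hK2, -⟩ := hK δ hδ x hx
  have hδsq : |K| * (1 + 2 * |R|) * δ ^ 2 ≤ 1 / 2 := by
    have h1 : δ ≤ 1 := hδ1.trans (min_le_left _ _)
    have h2 : δ ≤ 1 / (2 * (|K| * (1 + 2 * |R|)) + 1) := hδ1.trans (min_le_right _ _)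
    rw [le_div_iff₀ hden] at h2
    have h3 : δ ^ 2 ≤ δ := by nlinarith [hδ.1]
    have h4 : 0 ≤ |K| * (1 + 2 * |R|) := by positivity
    nlinarith [hδ.1]
  -- From ‖y‖² - ‖x‖² = ‖z‖² + 2⟪x, z⟫ with z = y - x: only first and second moments occur, and the
  -- constant A cancels.
  have hflux : 2 * nonlocalFlux (γ δ) (extDomain Ω δ) (fun y => A - ‖y‖ ^ 2) x =
      2 * ∑ i, ((∫ y, (y i - x i) * (y i - x i) * γ δ x y) +
        2 * x i * ∫ y, (y i - x i) * γ δ x y) := by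
    rw [nonlocalFlux, ← integral_neg]
    have h1 : ∀ y : Sp d, -((A - ‖y‖ ^ 2 - (A - ‖x‖ ^ 2)) * γ δ x y) =
        ∑ i : Fin d, ((∏ j : Fin 2, (y - x) ((fun _ => i) j)) * γ δ x y +
          2 * x i * ((∏ j : Fin 1, (y - x) ((fun _ => i) j)) * γ δ x y)) := fun y => by
      rw [EuclideanSpace.real_norm_sq_eq, EuclideanSpace.real_norm_sq_eq, sub_sub_sub_cancel_left,
        ← Finset.sum_sub_distrib, ← neg_mul, ← Finset.sum_neg_distrib, Finset.sum_mul]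
      refine Finset.sum_congr rfl fun i _ => ?_
      simp only [Fin.prod_univ_two, Fin.prod_univ_one, PiLp.sub_apply]
      ring
    simp only [h1]
    have j2 := fun i : Fin d => hγ.integrable_prod_row hΩ hδ hx (fun _ : Fin 2 => i)
    have j1 := fun i : Fin d => (hγ.integrable_prod_row hΩ hδ hx (fun _ : Fin 1 => i)).const_mul
      (2 * x i)
    have j12 : ∀ i : Fin d, Integrable (fun y => (∏ j : Fin 2, (y - x) ((fun _ => i) j)) *
        γ δ x y + 2 * x i * ((∏ j : Fin 1, (y - x) ((fun _ => i) j)) * γ δ x y))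
        (volume.restrict (extDomain Ω δ)) := fun i => (j2 i).add (j1 i)
    rw [integral_finsetSum _ fun i _ => j12 i]
    congr 1
    refine Finset.sum_congr rfl fun i _ => ?_
    rw [integral_add (j2 i) (j1 i), integral_const_mul,
      hγ.setIntegral_eq hδ hx fun y => ∏ j : Fin 2, (y - x) ((fun _ => i) j),
      hγ.setIntegral_eq hδ hx fun y => ∏ j : Fin 1, (y - x) ((fun _ => i) j)]
    simp [sq]
  rw [hflux]
  have hterm : ∀ i : Fin d, (1 / 2 : ℝ) ≤ (∫ y, (y i - x i) * (y i - x i) * γ δ x y) +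
        2 * x i * ∫ y, (y i - x i) * γ δ x y := fun i => by
    have h1 := hK1 i
    have h2 := hK2 i i
    rw [if_pos rfl] at h2
    have hxi : |x i| ≤ |R| := (PiLp.norm_apply_le x i).trans ((hR x hx).trans (le_abs_self _))
    have hKδ : K * δ ^ 2 ≤ |K| * δ ^ 2 := by gcongr; exact le_abs_self _
    have h3 : |2 * x i * ∫ y, (y i - x i) * γ δ x y| ≤ 2 * |R| * (|K| * δ ^ 2) := by
      rw [abs_mul, abs_mul, abs_two]
      have := h1.trans hKδ
      gcongr
    have h4 := (abs_le.1 h3).1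
    have h5 := (abs_le.1 (h2.trans hKδ)).1
    nlinarith
  have hsum : (d : ℝ) * (1 / 2) ≤ ∑ i : Fin d, ((∫ y, (y i - x i) * (y i - x i) * γ δ x y) +
        2 * x i * ∫ y, (y i - x i) * γ δ x y) := by
    have := Finset.card_nsmul_le_sum Finset.univ _ _ fun i _ => hterm i
    simpa using this
  have hd' : (1 : ℝ) ≤ d := by exact_mod_cast hd
  linarith

end IsPoissonKernel

/-! ### Moments of radial measures -/

/-- Integrable radial weights supported in the ball of radius `δ`. -/
structure IsRadialWeight (d : ℕ) (g : ℝ → ℝ) (δ : ℝ) : Prop where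
  measurable : Measurable g
  nonneg : ∀ r, 0 ≤ g r
  eq_zero : ∀ r, δ ≤ r → g r = 0
  integrable : Integrable (fun z : Sp d => g ‖z‖)

/-- The measure with density `g ‖z‖`. -/
def radialMeasure (d : ℕ) (g : ℝ → ℝ) : Measure (Sp d) :=
  volume.withDensity fun z => ENNReal.ofReal (g ‖z‖)

namespace IsRadialWeight

variable {d : ℕ} {g : ℝ → ℝ} {δ : ℝ}

theorem measurable_density (h : IsRadialWeight d g δ) :
    Measurable fun z : Sp d => ENNReal.ofReal (g ‖z‖) :=
  (h.measurable.comp measurable_norm).ennreal_ofReal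

theorem isFiniteMeasure (h : IsRadialWeight d g δ) : IsFiniteMeasure (radialMeasure d g) := by
  refine isFiniteMeasure_withDensity ?_
  exact h.integrable.lintegral_lt_top.ne

theorem integral_eq {F : Type*} [NormedAddCommGroup F] [NormedSpace ℝ F]
    (h : IsRadialWeight d g δ) (f : Sp d → F) :
    ∫ z, f z ∂(radialMeasure d g) = ∫ z, g ‖z‖ • f z := by
  rw [radialMeasure, integral_withDensity_eq_integral_toReal_smul h.measurable_density
    (ae_of_all _ fun _ => ENNReal.ofReal_lt_top)]
  simp only [ENNReal.toReal_ofReal (h.nonneg _)]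

theorem absolutelyContinuous (h : IsRadialWeight d g δ) :
    radialMeasure d g ≪ volume.restrict (Metric.ball 0 δ) := by
  refine Measure.AbsolutelyContinuous.mk fun s hs h0 => ?_
  rw [Measure.restrict_apply hs] at h0
  rw [radialMeasure, withDensity_apply _ hs, ← lintegral_indicator hs]
  rw [lintegral_eq_zero_iff (h.measurable_density.indicator hs)]
  have h1 : ∀ᵐ z : Sp d, z ∉ s ∩ Metric.ball 0 δ := measure_eq_zero_iff_ae_notMem.1 h0
  filter_upwards [h1] with z hz
  by_cases hzs : z ∈ s
  · have : δ ≤ ‖z‖ := by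
      by_contra hlt
      exact hz ⟨hzs, by simpa using lt_of_not_ge hlt⟩
    simp [hzs, h.eq_zero _ this]
  · simp [hzs]

theorem ae_norm_lt (h : IsRadialWeight d g δ) : ∀ᵐ z ∂(radialMeasure d g), ‖z‖ < δ := by
  refine h.absolutelyContinuous.ae_le ?_
  filter_upwards [ae_restrict_mem (measurableSet_ball (x := (0 : Sp d)) (ε := δ))] with z hz
  simpa using hz

theorem integrable_of_bound {F : Type*} [NormedAddCommGroup F] (h : IsRadialWeight d g δ)
    {f : Sp d → F} (hf : AEStronglyMeasurable f (radialMeasure d g)) {c : ℝ}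
    (hc : ∀ z, ‖z‖ < δ → ‖f z‖ ≤ c) : Integrable f (radialMeasure d g) := by
  have := h.isFiniteMeasure
  exact Integrable.of_bound hf c (h.ae_norm_lt.mono hc)

/-- Applied to z ↦ -z, which removes odd parts, and to reflections, which make the moments
isotropic. -/
theorem measurePreserving (h : IsRadialWeight d g δ) (e : Sp d ≃ₗᵢ[ℝ] Sp d) :
    MeasurePreserving e (radialMeasure d g) (radialMeasure d g) := by
  refine ⟨e.continuous.measurable, ?_⟩
  ext s hs
  have hm : Measurable e := e.continuous.measurable
  rw [Measure.map_apply hm hs, radialMeasure, withDensity_apply _ (hm hs), withDensity_apply _ hs,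
    ← (e.measurePreserving.setLIntegral_comp_preimage hs h.measurable_density)]
  simp only [e.norm_map]

theorem integral_comp {F : Type*} [NormedAddCommGroup F] [NormedSpace ℝ F]
    (h : IsRadialWeight d g δ) (e : Sp d ≃ₗᵢ[ℝ] Sp d) (f : Sp d → F) :
    ∫ z, f (e z) ∂(radialMeasure d g) = ∫ z, f z ∂(radialMeasure d g) :=
  (h.measurePreserving e).integral_comp e.toHomeomorph.measurableEmbedding f

theorem integral_comp_neg {F : Type*} [NormedAddCommGroup F] [NormedSpace ℝ F]
    (h : IsRadialWeight d g δ) (f : Sp d → F) :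
    ∫ z, f (-z) ∂(radialMeasure d g) = ∫ z, f z ∂(radialMeasure d g) :=
  h.integral_comp (LinearIsometryEquiv.neg ℝ) f

/-- A reflection carries ‖b‖a to b and fixes the radial measure, so the integral depends on b only
through its norm. The factor ψ allows the weight ‖z‖⁻² of the fourth moments. -/
theorem integral_inner_pow (h : IsRadialWeight d g δ) (n : ℕ) (ψ : ℝ → ℝ) {a : Sp d}
    (ha : ‖a‖ = 1) (b : Sp d) :
    ∫ z, ⟪b, z⟫ ^ n * ψ ‖z‖ ∂(radialMeasure d g) =
      ‖b‖ ^ n * ∫ z, ⟪a, z⟫ ^ n * ψ ‖z‖ ∂(radialMeasure d g) := by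
  have hn : ‖‖b‖ • a‖ = ‖b‖ := by rw [norm_smul, norm_norm, ha, mul_one]
  have hr := Submodule.reflection_sub hn
  set e := (ℝ ∙ (‖b‖ • a - b))ᗮ.reflection
  rw [← h.integral_comp e, ← integral_const_mul]
  congr 1; ext1 z
  rw [← hr, e.inner_map_map, e.norm_map, real_inner_smul_left, mul_pow, mul_assoc, hr]

theorem integral_norm_sq_pos_eq (h : IsRadialWeight d g δ) :
    ∫ z, ‖z‖ ^ 2 ∂(radialMeasure d g) = lpsMoment d g δ := by
  rw [h.integral_eq, lpsMoment]
  refine (setIntegral_eq_integral_of_forall_compl_eq_zero fun z hz => ?_).symm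
  rw [Metric.mem_ball, dist_zero_right, not_lt] at hz
  simp [h.eq_zero _ hz]

theorem integrable_coord_prod (h : IsRadialWeight d g δ) {k : ℕ} (i : Fin k → Fin d) :
    Integrable (fun z : Sp d => ∏ j, z (i j)) (radialMeasure d g) := by
  refine h.integrable_of_bound (c := δ ^ k)
    (by apply Continuous.aestronglyMeasurable; fun_prop) fun z hz => ?_
  rw [Real.norm_eq_abs, Finset.abs_prod]
  calc ∏ j, |z (i j)| ≤ ∏ _j : Fin k, δ :=
        Finset.prod_le_prod (fun _ _ => abs_nonneg _) fun j _ =>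
          (PiLp.norm_apply_le z (i j)).trans hz.le
    _ = δ ^ k := by simp

theorem integrable_inner_sq (h : IsRadialWeight d g δ) (b : Sp d) :
    Integrable (fun z : Sp d => ⟪b, z⟫ ^ 2) (radialMeasure d g) := by
  refine h.integrable_of_bound (c := (‖b‖ * δ) ^ 2)
    (by apply Continuous.aestronglyMeasurable; fun_prop) fun z hz => ?_
  rw [norm_pow]
  gcongr
  exact (norm_inner_le_norm _ _).trans (by gcongr)

theorem integrable_inner_pow_four (h : IsRadialWeight d g δ) (b : Sp d) :
    Integrable (fun z : Sp d => ⟪b, z⟫ ^ 4 * (‖z‖ ^ 2)⁻¹) (radialMeasure d g) := by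
  refine h.integrable_of_bound (c := ‖b‖ ^ 4 * δ ^ 2)
    (by apply Measurable.aestronglyMeasurable; fun_prop) fun z hz => ?_
  rw [norm_mul, norm_pow, norm_inv, norm_pow, norm_norm]
  rcases (norm_nonneg z).eq_or_lt with h0 | h0
  · simp [← h0]; positivity
  · calc ‖⟪b, z⟫‖ ^ 4 * (‖z‖ ^ 2)⁻¹ ≤ (‖b‖ * ‖z‖) ^ 4 * (‖z‖ ^ 2)⁻¹ := by
          gcongr; exact norm_inner_le_norm _ _
      _ = ‖b‖ ^ 4 * ‖z‖ ^ 2 := by field_simp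
      _ ≤ _ := by gcongr

theorem sum_integral_coord_sq (h : IsRadialWeight d g δ) :
    ∑ i, ∫ z : Sp d, z i ^ 2 ∂(radialMeasure d g) = lpsMoment d g δ := by
  rw [← h.integral_norm_sq_pos_eq, ← integral_finsetSum]
  · simp only [EuclideanSpace.real_norm_sq_eq]
  · intro i _
    simpa [Fin.prod_univ_two, sq] using h.integrable_coord_prod (fun _ : Fin 2 => i)

theorem inner_single_left (i : Fin d) (z : Sp d) :
    ⟪(EuclideanSpace.single i (1 : ℝ) : Sp d), z⟫ = z i := by
  simp [EuclideanSpace.inner_single_left]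

theorem inner_single_single (i j : Fin d) :
    ⟪(EuclideanSpace.single i (1 : ℝ) : Sp d), EuclideanSpace.single j (1 : ℝ)⟫ =
      if i = j then 1 else 0 := by
  rw [inner_single_left]
  simp

/-- Second moments of a radial measure. -/
theorem integral_coord_mul_coord (h : IsRadialWeight d g δ) (i j : Fin d) :
    ∫ z : Sp d, z i * z j ∂(radialMeasure d g) =
      lpsMoment d g δ / d * if i = j then 1 else 0 := by
  set a : Fin d → Sp d := fun i => EuclideanSpace.single i (1 : ℝ) with ha
  have hd : (0 : ℝ) < d := by exact_mod_cast Fin.pos i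
  have han : ‖a i‖ = 1 := by simp [ha]
  set c := ∫ z, ⟪a i, z⟫ ^ 2 ∂(radialMeasure d g) with hc
  have hpow : ∀ b : Sp d, ∫ z, ⟪b, z⟫ ^ 2 ∂(radialMeasure d g) = ‖b‖ ^ 2 * c := fun b => by
    simpa using h.integral_inner_pow 2 (fun _ => 1) han b
  have hcm : d * c = lpsMoment d g δ := by
    rw [← h.sum_integral_coord_sq]
    have h1 : ∀ k, ∫ z : Sp d, z k ^ 2 ∂(radialMeasure d g) = c := fun k => by
      have := hpow (a k)
      simp only [ha, inner_single_left] at this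
      simpa using this
    simp [h1]
  -- Polarization: mixed second moments come from the moments along the sum and the difference of
  -- two basis vectors.
  have hpol : ∫ z : Sp d, z i * z j ∂(radialMeasure d g) =
      (‖a i + a j‖ ^ 2 * c - ‖a i - a j‖ ^ 2 * c) / 4 := by
    rw [← hpow, ← hpow, ← integral_sub (h.integrable_inner_sq _) (h.integrable_inner_sq _),
      ← integral_div]
    congr 1; ext1 z
    rw [inner_add_left, inner_sub_left, inner_single_left, inner_single_left]
    ring
  rw [hpol, ← hcm, norm_add_sq_real, norm_sub_sq_real, inner_single_single]
  field_simp
  ring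

/-- Quartic polarization. Eight sign combinations, the first sign being fixed, isolate the product
of the four linear forms with coefficient 8 · 4! = 192. The same combination of ‖b‖⁴ = ⟪b, b⟫² gives
64 times the sum over the three pairings, hence the factor 1/3. -/
theorem integral_inner_four (h : IsRadialWeight d g δ) {a : Sp d} (ha : ‖a‖ = 1)
    (b₁ b₂ b₃ b₄ : Sp d) :
    ∫ z, ⟪b₁, z⟫ * ⟪b₂, z⟫ * ⟪b₃, z⟫ * ⟪b₄, z⟫ * (‖z‖ ^ 2)⁻¹ ∂(radialMeasure d g) =
      (∫ z, ⟪a, z⟫ ^ 4 * (‖z‖ ^ 2)⁻¹ ∂(radialMeasure d g)) / 3 *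
        (⟪b₁, b₂⟫ * ⟪b₃, b₄⟫ + ⟪b₁, b₃⟫ * ⟪b₂, b₄⟫ + ⟪b₁, b₄⟫ * ⟪b₂, b₃⟫) := by
  set c := ∫ z, ⟪a, z⟫ ^ 4 * (‖z‖ ^ 2)⁻¹ ∂(radialMeasure d g) with hc
  have hpow : ∀ b : Sp d, ∫ z, ⟪b, z⟫ ^ 4 * (‖z‖ ^ 2)⁻¹ ∂(radialMeasure d g) = ‖b‖ ^ 4 * c :=
    fun b => h.integral_inner_pow 4 (fun r => (r ^ 2)⁻¹) ha b
  set s : Fin 8 → ℝ := ![1, -1, -1, 1, -1, 1, 1, -1] with hs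
  set B : Fin 8 → Sp d := ![b₁ + b₂ + b₃ + b₄, b₁ + b₂ + b₃ - b₄, b₁ + b₂ - b₃ + b₄,
    b₁ + b₂ - b₃ - b₄, b₁ - b₂ + b₃ + b₄, b₁ - b₂ + b₃ - b₄, b₁ - b₂ - b₃ + b₄,
    b₁ - b₂ - b₃ - b₄] with hB
  have hpt : ∀ z, ⟪b₁, z⟫ * ⟪b₂, z⟫ * ⟪b₃, z⟫ * ⟪b₄, z⟫ * (‖z‖ ^ 2)⁻¹ =
      ∑ k, s k / 192 * (⟪B k, z⟫ ^ 4 * (‖z‖ ^ 2)⁻¹) := fun z => by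
    simp only [Fin.sum_univ_eight, hs, hB, Matrix.cons_val, inner_add_left, inner_sub_left]
    ring
  simp only [hpt]
  rw [integral_finsetSum _ fun k _ => (h.integrable_inner_pow_four (B k)).const_mul _]
  simp only [integral_const_mul, hpow]
  have hn : ∀ b : Sp d, ‖b‖ ^ 4 = ⟪b, b⟫ ^ 2 := fun b => by
    rw [real_inner_self_eq_norm_sq]; ring
  simp only [hn]
  simp only [Fin.sum_univ_eight, hs, hB, Matrix.cons_val, inner_add_left, inner_sub_left,
    inner_add_right, inner_sub_right, real_inner_comm b₁ b₂, real_inner_comm b₁ b₃,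
    real_inner_comm b₁ b₄, real_inner_comm b₂ b₃, real_inner_comm b₂ b₄, real_inner_comm b₃ b₄]
  ring

/-- Fourth moments of a radial measure. -/
theorem integral_coord_four (h : IsRadialWeight d g δ) (i j k l : Fin d) :
    ∫ z : Sp d, z i * z j * z k * z l * (‖z‖ ^ 2)⁻¹ ∂(radialMeasure d g) =
      lpsMoment d g δ / (d * (d + 2)) *
        ((if i = j then 1 else 0) * (if k = l then 1 else 0) +
        (if i = k then 1 else 0) * (if j = l then 1 else 0) +
        (if i = l then 1 else 0) * (if j = k then 1 else 0)) := by
  have hd : (0 : ℝ) < d := by exact_mod_cast Fin.pos i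
  set a : Fin d → Sp d := fun i => EuclideanSpace.single i (1 : ℝ) with ha
  have han : ‖a i‖ = 1 := by simp [ha]
  set c := ∫ z, ⟪a i, z⟫ ^ 4 * (‖z‖ ^ 2)⁻¹ ∂(radialMeasure d g) with hc
  have hfour : ∀ i j k l : Fin d,
      ∫ z : Sp d, z i * z j * z k * z l * (‖z‖ ^ 2)⁻¹ ∂(radialMeasure d g) =
      c / 3 * ((if i = j then 1 else 0) * (if k = l then 1 else 0) +
        (if i = k then 1 else 0) * (if j = l then 1 else 0) +
        (if i = l then 1 else 0) * (if j = k then 1 else 0)) := fun i j k l => by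
    have := h.integral_inner_four han (a i) (a j) (a k) (a l)
    rw [← hc] at this
    simp only [ha, inner_single_single] at this
    simpa only [inner_single_left] using this
  -- Contracting both index pairs: the sum of z_p² z_q²/‖z‖² is ‖z‖², and the sum of 1 + 2δ_pq is d²
  -- + 2d.
  have hcm : c / 3 * (d * (d + 2)) = lpsMoment d g δ := by
    rw [← h.integral_norm_sq_pos_eq]
    have hpt : ∀ z : Sp d, ‖z‖ ^ 2 = ∑ p, ∑ q, z p * z p * z q * z q * (‖z‖ ^ 2)⁻¹ := fun z => by
      have h1 : ∑ p, ∑ q, z p * z p * z q * z q * (‖z‖ ^ 2)⁻¹ =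
          (∑ p, z p ^ 2) * (∑ q, z q ^ 2) * (‖z‖ ^ 2)⁻¹ := by
        rw [Finset.sum_mul_sum, Finset.sum_mul]
        refine Finset.sum_congr rfl fun p _ => ?_
        rw [Finset.sum_mul]
        refine Finset.sum_congr rfl fun q _ => ?_
        ring
      rw [h1, ← EuclideanSpace.real_norm_sq_eq]
      rcases (norm_nonneg z).eq_or_lt with h0 | h0
      · simp [← h0]
      · field_simp
    have hint : ∀ p q : Fin d, Integrable (fun z : Sp d => z p * z p * z q * z q * (‖z‖ ^ 2)⁻¹)
        (radialMeasure d g) := fun p q => by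
      refine h.integrable_of_bound (c := δ ^ 2)
        (by apply Measurable.aestronglyMeasurable; fun_prop) fun z hz => ?_
      have hp : ‖z p‖ ≤ ‖z‖ := PiLp.norm_apply_le z p
      have hq : ‖z q‖ ≤ ‖z‖ := PiLp.norm_apply_le z q
      simp only [norm_mul, norm_inv, norm_pow, norm_norm]
      rcases (norm_nonneg z).eq_or_lt with h0 | h0
      · simp [← h0]; positivity
      · calc ‖z p‖ * ‖z p‖ * ‖z q‖ * ‖z q‖ * (‖z‖ ^ 2)⁻¹
            ≤ ‖z‖ * ‖z‖ * ‖z‖ * ‖z‖ * (‖z‖ ^ 2)⁻¹ := by gcongr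
          _ = ‖z‖ ^ 2 := by field_simp
          _ ≤ _ := by gcongr
    have hI : ∫ z : Sp d, ‖z‖ ^ 2 ∂(radialMeasure d g) =
        ∑ p, ∑ q, ∫ z : Sp d, z p * z p * z q * z q * (‖z‖ ^ 2)⁻¹ ∂(radialMeasure d g) := by
      rw [integral_congr_ae (ae_of_all _ hpt), integral_finsetSum _ fun p _ =>
        integrable_finsetSum _ fun q _ => hint p q]
      exact Finset.sum_congr rfl fun p _ => integral_finsetSum _ fun q _ => hint p q
    rw [hI]
    simp only [hfour, if_true, ← Finset.mul_sum]
    congr 1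
    simp [Finset.sum_add_distrib]
    ring
  rw [hfour, ← hcm]
  field_simp

end IsRadialWeight

/-! ### Consistency of the LPS operator -/

/-- The even Taylor terms cancel in the odd difference, so the error after the linear term is
already cubic. -/
theorem norm_odd_taylor_le {E F : Type*} [NormedAddCommGroup E] [NormedSpace ℝ E]
    [NormedAddCommGroup F] [NormedSpace ℝ F] [CompleteSpace F] {f : E → F} {x w : E} {r M : ℝ}
    (hf : ∀ y ∈ Metric.ball x r, ContDiffAt ℝ 3 f y)
    (hM : ∀ y ∈ Metric.ball x r, ‖iteratedFDeriv ℝ 3 f y‖ ≤ M) (hw : ‖w‖ < r) :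
    ‖(1 / 2 : ℝ) • (f (x + w) - f (x - w)) - fderiv ℝ f x w‖ ≤ M * ‖w‖ ^ 3 := by
  have hmem : ∀ v : E, ‖v‖ < r → ∀ t ∈ Icc (0 : ℝ) 1, x + t • v ∈ Metric.ball x r := by
    intro v hv t ht
    rw [Metric.mem_ball, dist_eq_norm, add_sub_cancel_left, norm_smul, Real.norm_eq_abs,
      abs_of_nonneg ht.1]
    nlinarith [ht.2, norm_nonneg v]
  have h1 := norm_sub_taylor_le (u := f) (x := x) (z := w) (n := 2)
    (fun t ht => hf _ (hmem w hw t ht)) (fun t ht => hM _ (hmem w hw t ht))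
  have h2 := norm_sub_taylor_le (u := f) (x := x) (z := -w) (n := 2)
    (fun t ht => hf _ (hmem (-w) (by rwa [norm_neg]) t ht))
    (fun t ht => hM _ (hmem (-w) (by rwa [norm_neg]) t ht))
  have hs : ∀ v : E, ∑ k ∈ Finset.range (2 + 1), (k.factorial : ℝ)⁻¹ •
      iteratedFDeriv ℝ k f x (fun _ => v) =
      f x + fderiv ℝ f x v + (1 / 2 : ℝ) • fderiv ℝ (fderiv ℝ f) x v v := fun v => by
    simp [Finset.sum_range_succ, iteratedFDeriv_two_apply, Nat.factorial]
  rw [hs] at h1 h2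
  rw [norm_neg, ← sub_eq_add_neg] at h2
  simp only [map_neg, neg_apply, neg_neg] at h2
  have heq : (1 / 2 : ℝ) • (f (x + w) - f (x - w)) - fderiv ℝ f x w =
      (1 / 2 : ℝ) • ((f (x + w) - (f x + fderiv ℝ f x w +
        (1 / 2 : ℝ) • fderiv ℝ (fderiv ℝ f) x w w)) -
      (f (x - w) - (f x + -fderiv ℝ f x w + (1 / 2 : ℝ) • fderiv ℝ (fderiv ℝ f) x w w))) := by
    module
  rw [heq, norm_smul]
  have h3 := norm_sub_le (f (x + w) - (f x + fderiv ℝ f x w +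
        (1 / 2 : ℝ) • fderiv ℝ (fderiv ℝ f) x w w))
      (f (x - w) - (f x + -fderiv ℝ f x w + (1 / 2 : ℝ) • fderiv ℝ (fderiv ℝ f) x w w))
  norm_num at h1 h2 h3 ⊢
  linarith

/-- The odd Taylor terms cancel, including the cubic one, so the error after the quadratic term is
quartic. -/
theorem norm_even_taylor_le {E F : Type*} [NormedAddCommGroup E] [NormedSpace ℝ E]
    [NormedAddCommGroup F] [NormedSpace ℝ F] [CompleteSpace F] {f : E → F} {x w : E} {r M : ℝ}
    (hf : ∀ y ∈ Metric.ball x r, ContDiffAt ℝ 4 f y)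
    (hM : ∀ y ∈ Metric.ball x r, ‖iteratedFDeriv ℝ 4 f y‖ ≤ M) (hw : ‖w‖ < r) :
    ‖(1 / 2 : ℝ) • (f (x + w) + f (x - w)) - f x - (1 / 2 : ℝ) • fderiv ℝ (fderiv ℝ f) x w w‖ ≤
      M * ‖w‖ ^ 4 := by
  have hmem : ∀ v : E, ‖v‖ < r → ∀ t ∈ Icc (0 : ℝ) 1, x + t • v ∈ Metric.ball x r := by
    intro v hv t ht
    rw [Metric.mem_ball, dist_eq_norm, add_sub_cancel_left, norm_smul, Real.norm_eq_abs,
      abs_of_nonneg ht.1]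
    nlinarith [ht.2, norm_nonneg v]
  have h1 := norm_sub_taylor_le (u := f) (x := x) (z := w) (n := 3)
    (fun t ht => hf _ (hmem w hw t ht)) (fun t ht => hM _ (hmem w hw t ht))
  have h2 := norm_sub_taylor_le (u := f) (x := x) (z := -w) (n := 3)
    (fun t ht => hf _ (hmem (-w) (by rwa [norm_neg]) t ht))
    (fun t ht => hM _ (hmem (-w) (by rwa [norm_neg]) t ht))
  have hs : ∀ v : E, ∑ k ∈ Finset.range (3 + 1), (k.factorial : ℝ)⁻¹ •
      iteratedFDeriv ℝ k f x (fun _ => v) =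
      f x + fderiv ℝ f x v + (1 / 2 : ℝ) • fderiv ℝ (fderiv ℝ f) x v v +
        (1 / 6 : ℝ) • iteratedFDeriv ℝ 3 f x (fun _ => v) := fun v => by
    simp [Finset.sum_range_succ, iteratedFDeriv_two_apply, Nat.factorial]
  have hcube : iteratedFDeriv ℝ 3 f x (fun _ => -w) = -iteratedFDeriv ℝ 3 f x (fun _ => w) := by
    have := (iteratedFDeriv ℝ 3 f x).map_smul_univ (fun _ => (-1 : ℝ)) (fun _ => w)
    simp only [neg_one_smul] at this
    rw [this]
    norm_num
  rw [hs] at h1 h2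
  rw [norm_neg, ← sub_eq_add_neg, hcube] at h2
  simp only [map_neg, neg_apply, neg_neg] at h2
  set H := fderiv ℝ (fderiv ℝ f) x w w
  set T := iteratedFDeriv ℝ 3 f x (fun _ => w)
  set A := f (x + w) - (f x + fderiv ℝ f x w + (1 / 2 : ℝ) • H + (1 / 6 : ℝ) • T) with hA
  set B := f (x - w) - (f x + -fderiv ℝ f x w + (1 / 2 : ℝ) • H + (1 / 6 : ℝ) • -T) with hB
  have heq : (1 / 2 : ℝ) • (f (x + w) + f (x - w)) - f x - (1 / 2 : ℝ) • H =
      (1 / 2 : ℝ) • (A + B) := by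
    rw [hA, hB]; module
  rw [heq, norm_smul]
  have h3 := norm_add_le A B
  norm_num at h1 h2 h3 ⊢
  linarith

theorem clm_apply_eq_sum {d : ℕ} {F : Type*} [NormedAddCommGroup F] [NormedSpace ℝ F]
    (L : Sp d →L[ℝ] F) (z : Sp d) :
    L z = ∑ k, z k • L (EuclideanSpace.single k 1) := by
  have hz : z = ∑ i : Fin d, z i • (EuclideanSpace.single i (1 : ℝ) : Sp d) := by
    simpa using ((EuclideanSpace.basisFun (Fin d) ℝ).sum_repr z).symm
  conv_lhs => rw [hz]
  simp [map_sum, map_smul]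

/-- The trace of a linear map, in the standard basis. -/
def coordTrace {d : ℕ} (L : Sp d →L[ℝ] Sp d) : ℝ := ∑ j, L (EuclideanSpace.single j 1) j

theorem coordTrace_sub {d : ℕ} (L L' : Sp d →L[ℝ] Sp d) :
    coordTrace (L - L') = coordTrace L - coordTrace L' := by
  simp [coordTrace, Finset.sum_sub_distrib]

theorem coordTrace_smul {d : ℕ} (c : ℝ) (L : Sp d →L[ℝ] Sp d) :
    coordTrace (c • L) = c * coordTrace L := by
  simp [coordTrace, Finset.mul_sum]

theorem abs_coordTrace_le {d : ℕ} (L : Sp d →L[ℝ] Sp d) : |coordTrace L| ≤ d * ‖L‖ := by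
  refine (Finset.abs_sum_le_sum_abs _ _).trans ?_
  calc _ ≤ ∑ _j : Fin d, ‖L‖ := by
        refine Finset.sum_le_sum fun j _ => ?_
        rw [← Real.norm_eq_abs]
        refine (PiLp.norm_apply_le _ j).trans ?_
        simpa using L.le_opNorm (EuclideanSpace.single j 1)
    _ = _ := by simp

theorem continuous_coordTrace {d : ℕ} :
    Continuous (coordTrace : (Sp d →L[ℝ] Sp d) → ℝ) := by
  unfold coordTrace
  refine continuous_finsetSum _ fun j _ => ?_
  exact (EuclideanSpace.proj j : Sp d →L[ℝ] ℝ).continuous.comp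
    ((ContinuousLinearMap.apply ℝ (Sp d) (EuclideanSpace.single j (1 : ℝ))).continuous)

namespace IsRadialWeight

variable {d : ℕ} {g : ℝ → ℝ} {δ : ℝ}

theorem setIntegral_eq {F : Type*} [NormedAddCommGroup F] [NormedSpace ℝ F]
    (h : IsRadialWeight d g δ) {x : Sp d} {D : Set (Sp d)} (hD : Metric.ball x δ ⊆ D)
    (f : Sp d → F) :
    ∫ y in D, g ‖y - x‖ • f y = ∫ z, f (x + z) ∂(radialMeasure d g) := by
  rw [setIntegral_eq_integral_of_forall_compl_eq_zero, h.integral_eq,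
    ← integral_add_left_eq_self _ x]
  · simp only [add_sub_cancel_left]
  · intro y hy
    have : δ ≤ ‖y - x‖ := by
      by_contra hlt
      exact hy (hD (by rw [Metric.mem_ball, dist_eq_norm]; exact lt_of_not_ge hlt))
    rw [h.eq_zero _ this, zero_smul]

theorem aestronglyMeasurable_comp_add {F : Type*} [TopologicalSpace F]
    (h : IsRadialWeight d g δ) {x : Sp d} {D : Set (Sp d)}
    (hD : Metric.ball x δ ⊆ D) {f : Sp d → F}
    (hf : AEStronglyMeasurable f (volume.restrict D)) :
    AEStronglyMeasurable (fun z => f (x + z)) (radialMeasure d g) := by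
  have h1 : MeasurePreserving (fun z => x + z) (volume.restrict (Metric.ball 0 δ))
      (volume.restrict (Metric.ball x δ)) := by
    have h2 := (measurePreserving_add_left (volume : Measure (Sp d)) x).restrict_preimage
      (measurableSet_ball (x := x) (ε := δ))
    have h3 : (fun z => x + z) ⁻¹' Metric.ball x δ = Metric.ball 0 δ := by
      ext z; simp [dist_eq_norm]
    rwa [h3] at h2
  have h4 := (hf.mono_measure (Measure.restrict_mono hD le_rfl)).comp_measurePreserving h1
  exact h4.mono_ac h.absolutelyContinuous

theorem integral_symmetrize {F : Type*} [NormedAddCommGroup F] [NormedSpace ℝ F]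
    (h : IsRadialWeight d g δ) {f : Sp d → F} (hf : Integrable f (radialMeasure d g)) :
    ∫ z, f z ∂(radialMeasure d g) =
      ∫ z, (1 / 2 : ℝ) • (f z + f (-z)) ∂(radialMeasure d g) := by
  have hn : Integrable (fun z => f (-z)) (radialMeasure d g) :=
    (h.measurePreserving (LinearIsometryEquiv.neg ℝ)).integrable_comp_of_integrable hf
  rw [integral_smul, integral_add hf hn, h.integral_comp_neg, ← two_smul ℝ, smul_smul]
  norm_num

theorem integrable_norm_sq (h : IsRadialWeight d g δ) :
    Integrable (fun z : Sp d => ‖z‖ ^ 2) (radialMeasure d g) := by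
  refine h.integrable_of_bound (c := δ ^ 2)
    (by apply Continuous.aestronglyMeasurable; fun_prop) fun z hz => ?_
  rw [norm_pow, norm_norm]
  gcongr

/-- A function of quadratic size has an integral bounded by the second moment. -/
theorem norm_integral_le {F : Type*} [NormedAddCommGroup F] [NormedSpace ℝ F]
    (h : IsRadialWeight d g δ) {f : Sp d → F} {c : ℝ} (hf : ∀ z, ‖z‖ < δ → ‖f z‖ ≤ c * ‖z‖ ^ 2) :
    ‖∫ z, f z ∂(radialMeasure d g)‖ ≤ c * lpsMoment d g δ := by
  rw [← h.integral_norm_sq_pos_eq, ← integral_const_mul]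
  exact norm_integral_le_of_norm_le (h.integrable_norm_sq.const_mul _) (h.ae_norm_lt.mono hf)

theorem integral_inner_clm (h : IsRadialWeight d g δ) (L : Sp d →L[ℝ] Sp d) :
    ∫ z, ⟪z, L z⟫ ∂(radialMeasure d g) = lpsMoment d g δ / d * coordTrace L := by
  have hpt : ∀ z : Sp d, ⟪z, L z⟫ =
      ∑ i, ∑ k, (z i * z k) * L (EuclideanSpace.single k 1) i := fun z => by
    have h1 : ⟪z, L z⟫ = ∑ i, z i * L z i := by
      rw [PiLp.inner_apply]
      simp [mul_comm]
    rw [h1]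
    refine Finset.sum_congr rfl fun i _ => ?_
    rw [clm_apply_eq_sum L z]
    simp [Finset.mul_sum, mul_assoc]
  have hi : ∀ i k : Fin d, Integrable (fun z : Sp d => (z i * z k) *
      L (EuclideanSpace.single k 1) i) (radialMeasure d g) := fun i k => by
    have := h.integrable_coord_prod ![i, k]
    simp only [Fin.prod_univ_two, Matrix.cons_val_zero, Matrix.cons_val_one] at this
    exact this.mul_const _
  simp only [hpt]
  rw [integral_finsetSum _ fun i _ => integrable_finsetSum _ fun k _ => hi i k, coordTrace,
    Finset.mul_sum]
  refine Finset.sum_congr rfl fun i _ => ?_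
  rw [integral_finsetSum _ fun k _ => hi i k]
  simp only [integral_mul_const, h.integral_coord_mul_coord]
  simp

theorem integral_linear_smul_apply (h : IsRadialWeight d g δ) (l : Sp d →L[ℝ] ℝ) (i : Fin d) :
    (∫ z, l z • z ∂(radialMeasure d g)) i =
      lpsMoment d g δ / d * l (EuclideanSpace.single i 1) := by
  have hint : Integrable (fun z : Sp d => l z • z) (radialMeasure d g) := by
    refine h.integrable_of_bound (c := ‖l‖ * δ * δ)
      (by apply Continuous.aestronglyMeasurable; fun_prop) fun z hz => ?_
    rw [norm_smul]
    have hδ : 0 ≤ δ := (norm_nonneg z).trans hz.le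
    gcongr
    exact (l.le_opNorm z).trans (by gcongr)
  have h1 := (EuclideanSpace.proj i : Sp d →L[ℝ] ℝ).integral_comp_comm hint
  refine h1.symm.trans ?_
  simp only [EuclideanSpace.coe_proj]
  have hpt : ∀ z : Sp d, (l z • z) i = ∑ k, (z k * z i) * l (EuclideanSpace.single k 1) :=
    fun z => by
      rw [PiLp.smul_apply, clm_apply_eq_sum l z, smul_eq_mul, Finset.sum_mul]
      refine Finset.sum_congr rfl fun k _ => ?_
      rw [smul_eq_mul]; ring
  simp only [hpt]
  rw [integral_finsetSum]
  · simp only [integral_mul_const, h.integral_coord_mul_coord]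
    simp
  · intro k _
    have := h.integrable_coord_prod ![k, i]
    simp only [Fin.prod_univ_two, Matrix.cons_val_zero, Matrix.cons_val_one] at this
    exact this.mul_const _

/-- Each of the three pairings of the isotropic fourth moment gives one sum. When H is the second
derivative of a field, the first two are the gradient of its divergence and the third is its
Laplacian. -/
theorem integral_bilinear_smul_apply (h : IsRadialWeight d g δ)
    (H : Sp d →L[ℝ] Sp d →L[ℝ] Sp d) (i : Fin d) :
    (∫ z, (⟪z, H z z⟫ / ‖z‖ ^ 2) • z ∂(radialMeasure d g)) i =
      lpsMoment d g δ / (d * (d + 2)) *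
        ((∑ j, H (EuclideanSpace.single j 1) (EuclideanSpace.single i 1) j) +
          (∑ j, H (EuclideanSpace.single i 1) (EuclideanSpace.single j 1) j) +
          ∑ j, H (EuclideanSpace.single j 1) (EuclideanSpace.single j 1) i) := by
  set e : Fin d → Sp d := fun i => EuclideanSpace.single i (1 : ℝ) with he
  have hint : Integrable (fun z : Sp d => (⟪z, H z z⟫ / ‖z‖ ^ 2) • z) (radialMeasure d g) := by
    refine h.integrable_of_bound (c := ‖H‖ * δ * δ) ?_ fun z hz => ?_
    · apply Measurable.aestronglyMeasurable
      have h1 : Measurable fun z : Sp d => ⟪z, H z z⟫ := by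
        apply Continuous.measurable; fun_prop
      fun_prop
    · have hδ : 0 ≤ δ := (norm_nonneg z).trans hz.le
      rw [norm_smul, norm_div, norm_pow, norm_norm]
      rcases (norm_nonneg z).eq_or_lt with h0 | h0
      · rw [← h0]; simp; positivity
      · have h1 : ‖⟪z, H z z⟫‖ ≤ ‖z‖ * (‖H‖ * ‖z‖ * ‖z‖) :=
          (norm_inner_le_norm _ _).trans (by gcongr; exact H.le_opNorm₂ z z)
        calc ‖⟪z, H z z⟫‖ / ‖z‖ ^ 2 * ‖z‖ ≤ ‖z‖ * (‖H‖ * ‖z‖ * ‖z‖) / ‖z‖ ^ 2 * ‖z‖ := by gcongr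
          _ = ‖H‖ * ‖z‖ * ‖z‖ := by field_simp
          _ ≤ _ := by gcongr
  have h1 := (EuclideanSpace.proj i : Sp d →L[ℝ] ℝ).integral_comp_comm hint
  refine h1.symm.trans ?_
  simp only [EuclideanSpace.coe_proj]
  have hpt : ∀ z : Sp d, ((⟪z, H z z⟫ / ‖z‖ ^ 2) • z) i =
      ∑ j, ∑ k, ∑ l, (z i * z j * z k * z l * (‖z‖ ^ 2)⁻¹) * H (e k) (e l) j := fun z => by
    have h2 : ⟪z, H z z⟫ = ∑ j, z j * H z z j := by
      rw [PiLp.inner_apply]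
      simp [mul_comm]
    have h3 : ∀ j, H z z j = ∑ k, ∑ l, z k * z l * H (e k) (e l) j := fun j => by
      rw [clm_apply_eq_sum H z]
      simp only [sum_apply, smul_apply]
      simp only [fun k => clm_apply_eq_sum (H (EuclideanSpace.single k 1)) z]
      simp [Finset.mul_sum, mul_assoc, he]
    rw [PiLp.smul_apply, smul_eq_mul, h2, div_eq_mul_inv, Finset.sum_mul, Finset.sum_mul]
    refine Finset.sum_congr rfl fun j _ => ?_
    rw [h3, Finset.mul_sum, Finset.sum_mul, Finset.sum_mul]
    refine Finset.sum_congr rfl fun k _ => ?_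
    rw [Finset.mul_sum, Finset.sum_mul, Finset.sum_mul]
    refine Finset.sum_congr rfl fun l _ => ?_
    ring
  have hi : ∀ j k l : Fin d, Integrable (fun z : Sp d =>
      (z i * z j * z k * z l * (‖z‖ ^ 2)⁻¹) * H (e k) (e l) j) (radialMeasure d g) :=
    fun j k l => by
      refine Integrable.mul_const ?_ _
      refine h.integrable_of_bound (c := δ ^ 2)
        (by apply Measurable.aestronglyMeasurable; fun_prop) fun z hz => ?_
      have hp : ∀ p, ‖z p‖ ≤ ‖z‖ := fun p => PiLp.norm_apply_le z p
      simp only [norm_mul, norm_inv, norm_pow, norm_norm]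
      rcases (norm_nonneg z).eq_or_lt with h0 | h0
      · simp [← h0]; positivity
      · calc ‖z i‖ * ‖z j‖ * ‖z k‖ * ‖z l‖ * (‖z‖ ^ 2)⁻¹
            ≤ ‖z‖ * ‖z‖ * ‖z‖ * ‖z‖ * (‖z‖ ^ 2)⁻¹ := by gcongr <;> exact hp _
          _ = ‖z‖ ^ 2 := by field_simp
          _ ≤ _ := by gcongr
  simp only [hpt]
  rw [integral_finsetSum _ fun j _ => integrable_finsetSum _ fun k _ =>
    integrable_finsetSum _ fun l _ => hi j k l]
  have h4 : ∀ j, ∫ z, ∑ k, ∑ l, (z i * z j * z k * z l * (‖z‖ ^ 2)⁻¹) * H (e k) (e l) j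
      ∂(radialMeasure d g) = ∑ k, ∑ l, ∫ z : Sp d,
        (z i * z j * z k * z l * (‖z‖ ^ 2)⁻¹) * H (e k) (e l) j ∂(radialMeasure d g) := fun j => by
    rw [integral_finsetSum _ fun k _ => integrable_finsetSum _ fun l _ => hi j k l]
    exact Finset.sum_congr rfl fun k _ => integral_finsetSum _ fun l _ => hi j k l
  simp only [h4, integral_mul_const, h.integral_coord_four]
  simp only [mul_assoc, ← Finset.mul_sum]
  congr 1
  simp only [add_mul, Finset.sum_add_distrib, ite_mul, one_mul, zero_mul,
    Finset.sum_ite_eq, Finset.mem_univ, if_true]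
  simp [Finset.sum_ite_eq]
  ring

end IsRadialWeight

/-! ### The projection on z, and the Navier operator in terms of second derivatives. -/

theorem norm_inner_div_smul_le {E : Type*} [NormedAddCommGroup E] [InnerProductSpace ℝ E]
    (z v : E) : ‖(⟪z, v⟫ / ‖z‖ ^ 2) • z‖ ≤ ‖v‖ := by
  rcases (norm_nonneg z).eq_or_lt with h0 | h0
  · simp [← h0]
  · rw [norm_smul, norm_div, norm_pow, norm_norm]
    calc ‖⟪z, v⟫‖ / ‖z‖ ^ 2 * ‖z‖ ≤ ‖z‖ * ‖v‖ / ‖z‖ ^ 2 * ‖z‖ := by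
          gcongr; exact norm_inner_le_norm _ _
      _ = ‖v‖ := by field_simp

theorem partialDeriv_eq {d : ℕ} {u : Sp d → Sp d} {x : Sp d} (hu : DifferentiableAt ℝ u x)
    (i j : Fin d) : partialDeriv u i j x = fderiv ℝ u x (EuclideanSpace.single j 1) i := by
  have h := ((EuclideanSpace.proj i : Sp d →L[ℝ] ℝ).hasFDerivAt (x := u x)).comp x hu.hasFDerivAt
  have h' : HasFDerivAt (fun y => u y i) ((EuclideanSpace.proj i : Sp d →L[ℝ] ℝ).comp
    (fderiv ℝ u x)) x := h
  rw [partialDeriv, h'.fderiv]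
  rfl

/-- The form (λ+μ)∇div + μΔ. Symmetry of the second derivative merges the divergence of the
transposed gradient with the gradient of the divergence. -/
theorem navier_apply {d : ℕ} (lam mu : ℝ) {u : Sp d → Sp d} {x : Sp d} (hu : ContDiffAt ℝ 4 u x)
    (i : Fin d) :
    navier lam mu u x i =
      (lam + mu) * coordTrace (fderiv ℝ (fderiv ℝ u) x (EuclideanSpace.single i 1)) +
      mu * ∑ j, fderiv ℝ (fderiv ℝ u) x (EuclideanSpace.single j 1)
        (EuclideanSpace.single j 1) i := by
  set e : Fin d → Sp d := fun i => EuclideanSpace.single i (1 : ℝ) with he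
  set H := fderiv ℝ (fderiv ℝ u) x with hH
  have hd2 : HasFDerivAt (fderiv ℝ u) H x :=
    ((hu.fderiv_right (m := 3) (by norm_num)).differentiableAt (by norm_num)).hasFDerivAt
  have hev : ∀ᶠ y in 𝓝 x, DifferentiableAt ℝ u y := by
    filter_upwards [hu.eventually (by simp)] with y hy using hy.differentiableAt (by norm_num)
  have hp : ∀ i j, HasFDerivAt (partialDeriv u i j)
      ((EuclideanSpace.proj i : Sp d →L[ℝ] ℝ).comp
        ((ContinuousLinearMap.apply ℝ (Sp d) (e j)).comp H)) x := fun i j => by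
    have h1 := ((EuclideanSpace.proj i : Sp d →L[ℝ] ℝ).comp
      (ContinuousLinearMap.apply ℝ (Sp d) (e j))).hasFDerivAt (x := fderiv ℝ u x) |>.comp x hd2
    refine h1.congr_of_eventuallyEq ?_
    filter_upwards [hev] with y hy
    exact partialDeriv_eq hy i j
  have hs : ∀ i j, fderiv ℝ (fun y => stress lam mu u y i j) x (e j) =
      lam * (∑ k, H (e j) (e k) k) * (if i = j then 1 else 0) +
        mu * (H (e j) (e j) i + H (e j) (e i) j) := fun i j => by
    have h1 : HasFDerivAt (fun y => ∑ k, partialDeriv u k k y) _ x :=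
      HasFDerivAt.fun_sum fun k _ => hp k k
    have h2 := ((h1.const_mul lam).mul_const (if i = j then (1 : ℝ) else 0)).add
      (((hp i j).add (hp j i)).const_mul mu)
    have h3 : (fun y => stress lam mu u y i j) = fun y =>
        lam * (∑ k, partialDeriv u k k y) * (if i = j then (1 : ℝ) else 0) +
          mu * (partialDeriv u i j y + partialDeriv u j i y) := by
      ext y
      simp only [stress, strain, Matrix.trace, Matrix.add_apply, Matrix.smul_apply,
        Matrix.of_apply, Matrix.diag_apply, Matrix.one_apply, smul_eq_mul, add_self_div_two]
      ring
    rw [h3]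
    refine (congrArg (fun L : Sp d →L[ℝ] ℝ => L (e j)) h2.fderiv).trans ?_
    by_cases hij : i = j
    · simp [hij]; ring
    · simp [hij]; ring
  have hsymm : ∀ v w, H v w = H w v := fun v w =>
    (hu.isSymmSndFDerivAt (by rw [minSmoothness_of_isRCLikeNormedField]; norm_num)).eq v w
  change ∑ j, fderiv ℝ (fun y => stress lam mu u y i j) x (e j) =
    (lam + mu) * (∑ j, H (e i) (e j) j) + mu * ∑ j, H (e j) (e j) i
  simp only [hs]
  have h4 : ∀ j, H (e j) (e i) j = H (e i) (e j) j := fun j => by rw [hsymm]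
  simp only [h4, Finset.sum_add_distrib, mul_ite, mul_one, mul_zero, Finset.sum_ite_eq,
    Finset.mem_univ, if_true, ← Finset.mul_sum]
  ring

namespace IsRadialWeight

variable {d : ℕ} {g : ℝ → ℝ} {δ : ℝ}

/-- Two integrals are close if the even part of the first integrand is close to the second
integrand. -/
theorem norm_integral_sub_le (h : IsRadialWeight d g δ) {F : Type*} [NormedAddCommGroup F]
    [NormedSpace ℝ F] {f b : Sp d → F} (hf : Integrable f (radialMeasure d g))
    (hb : Integrable b (radialMeasure d g)) {c : ℝ}
    (hc : ∀ z, ‖z‖ < δ → ‖(1 / 2 : ℝ) • (f z + f (-z)) - b z‖ ≤ c * ‖z‖ ^ 2) :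
    ‖∫ z, f z ∂(radialMeasure d g) - ∫ z, b z ∂(radialMeasure d g)‖ ≤ c * lpsMoment d g δ := by
  have hn : Integrable (fun z => f (-z)) (radialMeasure d g) :=
    (h.measurePreserving (LinearIsometryEquiv.neg ℝ)).integrable_comp_of_integrable hf
  have hs : Integrable (fun z => (1 / 2 : ℝ) • (f z + f (-z))) (radialMeasure d g) :=
    (hf.add hn).smul _
  rw [h.integral_symmetrize hf, ← integral_sub hs hb]
  exact h.norm_integral_le hc

theorem integrable_inner_div_smul (h : IsRadialWeight d g δ) {v : Sp d → Sp d}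
    (hv : AEStronglyMeasurable v (radialMeasure d g)) {c : ℝ} (hc : ∀ z, ‖z‖ < δ → ‖v z‖ ≤ c) :
    Integrable (fun z => (⟪z, v z⟫ / ‖z‖ ^ 2) • z) (radialMeasure d g) := by
  refine h.integrable_of_bound (c := c) ?_ fun z hz =>
    (norm_inner_div_smul_le z (v z)).trans (hc z hz)
  have h1 : AEStronglyMeasurable (fun z : Sp d => (‖z‖ ^ 2)⁻¹) (radialMeasure d g) := by
    apply Measurable.aestronglyMeasurable; fun_prop
  have h2 : AEStronglyMeasurable (fun z : Sp d => z) (radialMeasure d g) :=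
    continuous_id.aestronglyMeasurable
  simp only [div_eq_mul_inv]
  exact ((h2.inner hv).mul h1).smul h2

theorem integrable_inner (h : IsRadialWeight d g δ) {v : Sp d → Sp d}
    (hv : AEStronglyMeasurable v (radialMeasure d g)) {c : ℝ} (hc : ∀ z, ‖z‖ < δ → ‖v z‖ ≤ c) :
    Integrable (fun z => ⟪z, v z⟫) (radialMeasure d g) := by
  have h2 : AEStronglyMeasurable (fun z : Sp d => z) (radialMeasure d g) :=
    continuous_id.aestronglyMeasurable
  refine h.integrable_of_bound (c := δ * c) (h2.inner hv) fun z hz => ?_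
  have := (norm_nonneg _).trans (hc z hz)
  exact (norm_inner_le_norm _ _).trans (mul_le_mul hz.le (hc z hz) (norm_nonneg _)
    ((norm_nonneg z).trans hz.le))

theorem integrable_smul_self (h : IsRadialWeight d g δ) {a : Sp d → ℝ}
    (ha : AEStronglyMeasurable a (radialMeasure d g)) {c : ℝ} (hc : ∀ z, ‖z‖ < δ → |a z| ≤ c) :
    Integrable (fun z => a z • z) (radialMeasure d g) := by
  have h2 : AEStronglyMeasurable (fun z : Sp d => z) (radialMeasure d g) :=
    continuous_id.aestronglyMeasurable
  refine h.integrable_of_bound (c := c * δ) (ha.smul h2) fun z hz => ?_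
  rw [norm_smul, Real.norm_eq_abs]
  exact mul_le_mul (hc z hz) hz.le (norm_nonneg _) ((abs_nonneg _).trans (hc z hz))

section Consistency

variable {D : Set (Sp d)} {M : ℝ} {u : Sp d → Sp d} {x : Sp d}

theorem dilatation_eq (h : IsRadialWeight d g δ) {m : ℝ} {y : Sp d}
    (hy : Metric.ball y δ ⊆ D) :
    dilatation g m D u y = 2 / m * ∫ w, ⟪w, u (y + w) - u y⟫ ∂(radialMeasure d g) := by
  have := h.setIntegral_eq hy fun y' => ⟪y' - y, u y' - u y⟫
  simp only [smul_eq_mul, add_sub_cancel_left] at this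
  rw [dilatation, this]

/-- The kernel z ⊗ z/‖z‖² is even and does not increase norms, so only the even part of the
increment of u counts, and its error is quartic by `norm_even_taylor_le`. -/
theorem norm_dev_sub_le (h : IsRadialWeight d g δ) (hD : IsOpen D) (hu : IsC4Bounded D M u)
    (hx : Metric.ball x δ ⊆ D) (hδ : 0 < δ) :
    ‖∫ z, (⟪z, u (x + z) - u x⟫ / ‖z‖ ^ 2) • z ∂(radialMeasure d g) -
      (1 / 2 : ℝ) • ∫ z, (⟪z, fderiv ℝ (fderiv ℝ u) x z z⟫ / ‖z‖ ^ 2) • z ∂(radialMeasure d g)‖ ≤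
      M * δ ^ 2 * lpsMoment d g δ := by
  have hxD : x ∈ D := hx (Metric.mem_ball_self hδ)
  have hM : 0 ≤ M := (norm_nonneg _).trans (hu.norm_le hxD)
  set H := fderiv ℝ (fderiv ℝ u) x with hH
  have hmem : ∀ z, ‖z‖ < δ → x + z ∈ D := fun z hz => hx (by simpa [dist_eq_norm] using hz)
  have hf : Integrable (fun z => (⟪z, u (x + z) - u x⟫ / ‖z‖ ^ 2) • z) (radialMeasure d g) := by
    refine h.integrable_inner_div_smul (c := M + M) ?_ fun z hz =>
      (norm_sub_le _ _).trans (add_le_add (hu.norm_le (hmem z hz)) (hu.norm_le hxD))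
    exact (h.aestronglyMeasurable_comp_add hx (hu.aestronglyMeasurable hD)).sub
      aestronglyMeasurable_const
  have hb : Integrable (fun z => (⟪z, H z z⟫ / ‖z‖ ^ 2) • z) (radialMeasure d g) := by
    refine h.integrable_inner_div_smul (c := ‖H‖ * δ * δ)
      (by apply Continuous.aestronglyMeasurable; fun_prop) fun z hz =>
      (H.le_opNorm₂ z z).trans (by gcongr)
  have hb' : Integrable (fun z => (1 / 2 : ℝ) • (⟪z, H z z⟫ / ‖z‖ ^ 2) • z) (radialMeasure d g) :=
    hb.smul (1 / 2 : ℝ)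
  rw [← integral_smul]
  refine h.norm_integral_sub_le hf hb' fun z hz => ?_
  have ht := norm_even_taylor_le (f := u) (x := x) (w := z) (r := δ) (M := M)
    (fun y hy => hu.contDiffAt hD (hx hy)) (fun y hy => hu.bound 4 le_rfl y (hx hy)) hz
  have heq : (1 / 2 : ℝ) • ((⟪z, u (x + z) - u x⟫ / ‖z‖ ^ 2) • z +
      (⟪-z, u (x + -z) - u x⟫ / ‖-z‖ ^ 2) • -z) - (1 / 2 : ℝ) • (⟪z, H z z⟫ / ‖z‖ ^ 2) • z =
      (⟪z, (1 / 2 : ℝ) • (u (x + z) + u (x - z)) - u x - (1 / 2 : ℝ) • H z z⟫ / ‖z‖ ^ 2) • z := by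
    simp only [norm_neg, inner_neg_left, ← sub_eq_add_neg, inner_sub_right, inner_smul_right,
      inner_add_right]
    module
  rw [heq]
  refine (norm_inner_div_smul_le _ _).trans (ht.trans ?_)
  calc M * ‖z‖ ^ 4 = M * ‖z‖ ^ 2 * ‖z‖ ^ 2 := by ring
    _ ≤ M * δ ^ 2 * ‖z‖ ^ 2 := by gcongr

/-- The dilatation is consistent with (2/d) div u up to δ², but its increments are needed with an
extra factor ‖z‖. That factor comes from applying the estimate to the field y ↦ u(y + z) - u(y),
whose third derivative is O(‖z‖) by the fourth-derivative bound. Balls of radius δ around x and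
around x + z must lie in D; this is the reason for the thickness 2δ. -/
theorem abs_dilatation_sub_le (h : IsRadialWeight d g δ) (hD : IsOpen D) (hu : IsC4Bounded D M u)
    (hx : Metric.ball x (2 * δ) ⊆ D) (hδ : 0 < δ) (hm : 0 < lpsMoment d g δ) {z : Sp d}
    (hz : ‖z‖ < δ) :
    |dilatation g (lpsMoment d g δ) D u (x + z) - dilatation g (lpsMoment d g δ) D u x -
      2 / d * coordTrace (fderiv ℝ u (x + z) - fderiv ℝ u x)| ≤ 2 * M * δ ^ 2 * ‖z‖ := by
  set m := lpsMoment d g δ with hmdef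
  have hxD : x ∈ D := hx (Metric.mem_ball_self (by positivity))
  have hM : 0 ≤ M := (norm_nonneg _).trans (hu.norm_le hxD)
  have hb1 : Metric.ball x δ ⊆ D := (Metric.ball_subset_ball (by linarith)).trans hx
  have hb1z : ∀ y ∈ Metric.ball x δ, y + z ∈ Metric.ball x (2 * δ) := fun y hy => by
    rw [Metric.mem_ball, dist_eq_norm] at hy ⊢
    calc ‖y + z - x‖ = ‖(y - x) + z‖ := by congr 1; abel
      _ ≤ ‖y - x‖ + ‖z‖ := norm_add_le _ _
      _ < 2 * δ := by linarith
  have hb2 : Metric.ball (x + z) δ ⊆ D := fun y hy => hx (by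
    have := hb1z (y - z) (by
      rw [Metric.mem_ball, dist_eq_norm] at hy ⊢
      rwa [sub_sub, add_comm z x])
    rwa [sub_add_cancel] at this)
  set φ : Sp d → Sp d := fun y => u (y + z) - u y with hφ
  have hcd : ∀ y ∈ Metric.ball x δ, ContDiffAt ℝ 4 (fun y => u (y + z)) y := fun y hy => by
    have := hu.contDiffAt hD (hx (hb1z y hy))
    exact this.comp y (by fun_prop)
  have hφ3 : ∀ y ∈ Metric.ball x δ, ContDiffAt ℝ 3 φ y := fun y hy =>
    ((hcd y hy).sub (hu.contDiffAt hD (hb1 hy))).of_le (by norm_num)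
  have hφM : ∀ y ∈ Metric.ball x δ, ‖iteratedFDeriv ℝ 3 φ y‖ ≤ M * ‖z‖ := fun y hy => by
    have h1 : iteratedFDeriv ℝ 3 φ y = iteratedFDeriv ℝ 3 u (y + z) - iteratedFDeriv ℝ 3 u y := by
      rw [hφ, fun_iteratedFDeriv_sub_apply ((hcd y hy).of_le (by norm_num))
        ((hu.contDiffAt hD (hb1 hy)).of_le (by norm_num)), iteratedFDeriv_comp_add_right]
    rw [h1]
    -- The mean value inequality for the third derivative, on the ball that contains both y and y +
    -- z.
    have h2 := (convex_ball x (2 * δ)).norm_image_sub_le_of_norm_fderiv_le (𝕜 := ℝ)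
      (f := iteratedFDeriv ℝ 3 u) (C := M)
      (fun w hw => (hu.contDiffAt hD (hx hw)).differentiableAt_iteratedFDeriv (by norm_num))
      (fun w hw => by
        rw [norm_fderiv_iteratedFDeriv]; exact hu.bound 4 le_rfl w (hx hw))
      (Metric.ball_subset_ball (by linarith) hy) (hb1z y hy)
    simpa using h2
  set L := fderiv ℝ φ x with hL
  have hLeq : L = fderiv ℝ u (x + z) - fderiv ℝ u x := by
    rw [hL, hφ, fderiv_fun_sub ((hcd x (Metric.mem_ball_self hδ)).differentiableAt (by norm_num))
      ((hu.contDiffAt hD hxD).differentiableAt (by norm_num)), fderiv_comp_add_right]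
  rw [← hLeq, h.dilatation_eq hb2, h.dilatation_eq hb1, ← mul_sub]
  have hmem1 : ∀ w, ‖w‖ < δ → x + w ∈ D := fun w hw => hb1 (by simpa [dist_eq_norm] using hw)
  have hmem2 : ∀ w, ‖w‖ < δ → x + z + w ∈ D := fun w hw => hb2 (by simpa [dist_eq_norm] using hw)
  have hum := hu.aestronglyMeasurable hD
  have i1 : Integrable (fun w => ⟪w, u (x + w) - u x⟫) (radialMeasure d g) := by
    refine h.integrable_inner (c := M + M) ((h.aestronglyMeasurable_comp_add hb1 hum).sub
      aestronglyMeasurable_const) fun w hw => (norm_sub_le _ _).trans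
      (add_le_add (hu.norm_le (hmem1 w hw)) (hu.norm_le hxD))
  have i2 : Integrable (fun w => ⟪w, u (x + z + w) - u (x + z)⟫) (radialMeasure d g) := by
    refine h.integrable_inner (c := M + M) ((h.aestronglyMeasurable_comp_add hb2 hum).sub
      aestronglyMeasurable_const) fun w hw => (norm_sub_le _ _).trans
      (add_le_add (hu.norm_le (hmem2 w hw)) (hu.norm_le (hmem1 z hz)))
  have i3 : Integrable (fun w => ⟪w, L w⟫) (radialMeasure d g) :=
    h.integrable_inner (c := ‖L‖ * δ) (by apply Continuous.aestronglyMeasurable; fun_prop)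
      fun w hw => (L.le_opNorm w).trans (by gcongr)
  have key := h.norm_integral_sub_le (i2.sub i1) i3 (c := M * δ ^ 2 * ‖z‖) fun w hw => by
    have ht := norm_odd_taylor_le hφ3 hφM hw
    have heq : (1 / 2 : ℝ) • ((⟪w, u (x + z + w) - u (x + z)⟫ - ⟪w, u (x + w) - u x⟫) +
        (⟪-w, u (x + z + -w) - u (x + z)⟫ - ⟪-w, u (x + -w) - u x⟫)) - ⟪w, L w⟫ =
        ⟪w, (1 / 2 : ℝ) • (φ (x + w) - φ (x - w)) - L w⟫ := by
      have e1 : x + z + w = x + w + z := by abel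
      have e2 : x + z + -w = x - w + z := by abel
      simp only [hφ, e1, e2, inner_neg_left, ← sub_eq_add_neg, inner_sub_right, inner_smul_right,
        smul_eq_mul]
      ring
    simp only [Pi.sub_apply]
    rw [heq]
    calc _ ≤ ‖w‖ * (M * ‖z‖ * ‖w‖ ^ 3) := (norm_inner_le_norm _ _).trans (by gcongr)
      _ = M * ‖w‖ ^ 2 * ‖z‖ * ‖w‖ ^ 2 := by ring
      _ ≤ M * δ ^ 2 * ‖z‖ * ‖w‖ ^ 2 := by gcongr
  simp only [Pi.sub_apply] at key
  rw [integral_sub i2 i1, h.integral_inner_clm L, Real.norm_eq_abs, ← hmdef] at key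
  set I := ∫ w, ⟪w, u (x + z + w) - u (x + z)⟫ ∂(radialMeasure d g) -
    ∫ w, ⟪w, u (x + w) - u x⟫ ∂(radialMeasure d g)
  have h3 : 2 / m * I - 2 / d * coordTrace L = 2 / m * (I - m / d * coordTrace L) := by
    field_simp
  rw [h3, abs_mul, abs_of_pos (by positivity : 0 < 2 / m)]
  calc 2 / m * |I - m / d * coordTrace L| ≤ 2 / m * (M * δ ^ 2 * ‖z‖ * m) := by gcongr
    _ = _ := by field_simp

/-- Against the odd factor z the constant θ(x) disappears and only half of θ(x + z) - θ(x - z)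
remains. Of the constant 4, a part 2 comes from replacing θ by the divergence at x ± z, and a part 2
from the odd Taylor expansion of the gradient. -/
theorem norm_dil_sub_le (h : IsRadialWeight d g δ) (hd : 1 ≤ d) (hD : IsOpen D)
    (hu : IsC4Bounded D M u) (hx : Metric.ball x (2 * δ) ⊆ D) (hδ : 0 < δ)
    (hm : 0 < lpsMoment d g δ)
    (hθ : AEStronglyMeasurable (dilatation g (lpsMoment d g δ) D u) (volume.restrict D)) :
    ‖∫ z, (dilatation g (lpsMoment d g δ) D u x + dilatation g (lpsMoment d g δ) D u (x + z)) • z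
        ∂(radialMeasure d g) -
      (2 / d : ℝ) • ∫ z, coordTrace (fderiv ℝ (fderiv ℝ u) x z) • z ∂(radialMeasure d g)‖ ≤
      4 * M * δ ^ 2 * lpsMoment d g δ := by
  set m := lpsMoment d g δ with hmdef
  set θ := dilatation g m D u with hθdef
  set H := fderiv ℝ (fderiv ℝ u) x with hH
  have hd' : (0 : ℝ) < d := by exact_mod_cast hd
  have hxD : x ∈ D := hx (Metric.mem_ball_self (by positivity))
  have hM : 0 ≤ M := (norm_nonneg _).trans (hu.norm_le hxD)
  have hb1 : Metric.ball x δ ⊆ D := (Metric.ball_subset_ball (by linarith)).trans hx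
  have hmem : ∀ w, ‖w‖ < δ → x + w ∈ D := fun w hw => hb1 (by simpa [dist_eq_norm] using hw)
  have hdθ : ∀ z, ‖z‖ < δ → |θ (x + z) - θ x -
      2 / d * coordTrace (fderiv ℝ u (x + z) - fderiv ℝ u x)| ≤ 2 * M * δ ^ 2 * ‖z‖ :=
    fun z hz => h.abs_dilatation_sub_le hD hu hx hδ hm hz
  have hfd : ∀ y ∈ D, ‖fderiv ℝ u y‖ ≤ M := fun y hy => by
    rw [← norm_iteratedFDeriv_one]
    exact hu.bound 1 (by norm_num) y hy
  have htr : ∀ A : Sp d →L[ℝ] Sp d, |2 / d * coordTrace A| ≤ 2 * ‖A‖ := fun A => by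
    rw [abs_mul, abs_of_pos (by positivity : (0 : ℝ) < 2 / d)]
    calc 2 / d * |coordTrace A| ≤ 2 / d * (d * ‖A‖) := by gcongr; exact abs_coordTrace_le A
      _ = _ := by field_simp
  have hf : Integrable (fun z => (θ x + θ (x + z)) • z) (radialMeasure d g) := by
    refine h.integrable_smul_self
      (c := 2 * |θ x| + 2 * (M + M) + 2 * M * δ ^ 2 * δ)
      (aestronglyMeasurable_const.add (h.aestronglyMeasurable_comp_add hb1 hθ)) fun z hz => ?_
    have h1 := hdθ z hz
    have h2 := (htr (fderiv ℝ u (x + z) - fderiv ℝ u x)).trans (mul_le_mul_of_nonneg_left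
      ((norm_sub_le _ _).trans (add_le_add (hfd _ (hmem z hz)) (hfd _ hxD))) zero_le_two)
    have h3 : 2 * M * δ ^ 2 * ‖z‖ ≤ 2 * M * δ ^ 2 * δ := by gcongr
    set T := 2 / d * coordTrace (fderiv ℝ u (x + z) - fderiv ℝ u x)
    have h4 := le_abs_self (θ x)
    have h5 := neg_abs_le (θ x)
    rw [abs_le] at h1 h2 ⊢
    constructor <;> linarith [h1.1, h1.2, h2.1, h2.2]
  have hb : Integrable (fun z => coordTrace (H z) • z) (radialMeasure d g) := by
    refine h.integrable_smul_self (c := d * (‖H‖ * δ))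
      (continuous_coordTrace.comp H.continuous).aestronglyMeasurable fun z hz =>
      (abs_coordTrace_le _).trans ?_
    gcongr
    exact (H.le_opNorm z).trans (by gcongr)
  have hb' : Integrable (fun z => (2 / d : ℝ) • coordTrace (H z) • z) (radialMeasure d g) :=
    hb.smul (2 / d : ℝ)
  rw [← integral_smul]
  refine h.norm_integral_sub_le hf hb' fun z hz => ?_
  have ht := norm_odd_taylor_le (f := fderiv ℝ u) (x := x) (w := z) (r := δ) (M := M)
    (fun y hy => (hu.contDiffAt hD (hb1 hy)).fderiv_right (by norm_num))
    (fun y hy => by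
      rw [norm_iteratedFDeriv_fderiv]; exact hu.bound 4 le_rfl y (hb1 hy)) hz
  have h1 := hdθ z hz
  have h2 := hdθ (-z) (by rwa [norm_neg])
  have h3 := htr ((1 / 2 : ℝ) • (fderiv ℝ u (x + z) - fderiv ℝ u (x - z)) - H z)
  rw [coordTrace_sub, coordTrace_smul, coordTrace_sub] at h3
  rw [coordTrace_sub] at h1 h2
  rw [norm_neg, ← sub_eq_add_neg] at h2
  have heq : (1 / 2 : ℝ) • ((θ x + θ (x + z)) • z + (θ x + θ (x + -z)) • -z) -
      (2 / d : ℝ) • coordTrace (H z) • z =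
      ((1 / 2 : ℝ) * (θ (x + z) - θ (x - z)) - 2 / d * coordTrace (H z)) • z := by
    rw [← sub_eq_add_neg]
    module
  have h4 : M * ‖z‖ ^ 3 ≤ M * δ ^ 2 * ‖z‖ := by
    calc M * ‖z‖ ^ 3 = M * ‖z‖ ^ 2 * ‖z‖ := by ring
      _ ≤ _ := by gcongr
  have h5 : |(1 / 2 : ℝ) * (θ (x + z) - θ (x - z)) - 2 / d * coordTrace (H z)| ≤
      4 * M * δ ^ 2 * ‖z‖ := by
    have h6 := h3.trans (mul_le_mul_of_nonneg_left (ht.trans h4) zero_le_two)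
    rw [abs_le] at h1 h2 h6 ⊢
    constructor <;> linarith [h1.1, h1.2, h2.1, h2.2, h6.1, h6.2]
  rw [heq, norm_smul, Real.norm_eq_abs]
  calc _ ≤ 4 * M * δ ^ 2 * ‖z‖ * ‖z‖ := by gcongr
    _ = _ := by ring

/-- Second-order consistency of the LPS operator with the Navier operator. -/
theorem norm_lpsOperator_sub_navier_le (h : IsRadialWeight d g δ) (hd : 1 ≤ d) (lam mu : ℝ)
    (hD : IsOpen D) (hu : IsC4Bounded D M u) (hx : Metric.ball x (2 * δ) ⊆ D) (hδ : 0 < δ)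
    (hm : 0 < lpsMoment d g δ)
    (hθ : AEStronglyMeasurable (dilatation g (lpsMoment d g δ) D u) (volume.restrict D)) :
    ‖lpsOperator lam mu g (lpsMoment d g δ) D u x - navier lam mu u x‖ ≤
      (|lpsC₁ d * (lam - mu)| * 4 + |lpsC₂ d * mu|) * M * δ ^ 2 := by
  have h1 := h.norm_dil_sub_le hd hD hu hx hδ hm hθ
  have hb1 : Metric.ball x δ ⊆ D := (Metric.ball_subset_ball (by linarith)).trans hx
  have h2 := h.norm_dev_sub_le hD hu hb1 hδ
  have hxD : x ∈ D := hb1 (Metric.mem_ball_self hδ)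
  have hd' : (0 : ℝ) < d := by exact_mod_cast hd
  have hI1 := h.setIntegral_eq hb1 fun y => IsLPSWeight.dilTerm g (lpsMoment d g δ) D u (x, y)
  have hI2 := h.setIntegral_eq hb1 fun y => IsLPSWeight.devTerm u (x, y)
  rw [IsLPSWeight.lpsOperator_eq, hI1, hI2]
  simp only [IsLPSWeight.dilTerm, IsLPSWeight.devTerm, projInc, add_sub_cancel_left]
  set m := lpsMoment d g δ with hmdef
  set I1 := ∫ z, (dilatation g m D u x + dilatation g m D u (x + z)) • z ∂(radialMeasure d g)
  set I2 := ∫ z, (⟪z, u (x + z) - u x⟫ / ‖z‖ ^ 2) • z ∂(radialMeasure d g)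
  set H := fderiv ℝ (fderiv ℝ u) x with hH
  set J1 := ∫ z, coordTrace (H z) • z ∂(radialMeasure d g) with hJ1
  set J2 := ∫ z, (⟪z, H z z⟫ / ‖z‖ ^ 2) • z ∂(radialMeasure d g) with hJ2
  -- The values of C₁ and C₂ enter here: C₁(2/d)(1/d) = 1 gives (λ-μ)∇div, and C₂(1/2)/(d(d+2)) = 1
  -- gives μ(2∇div + Δ). Together they form the Navier operator.
  have hN : navier lam mu u x = (lpsC₁ d / m * (lam - mu)) • (2 / d : ℝ) • J1 +
      (lpsC₂ d / m * mu) • (1 / 2 : ℝ) • J2 := by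
    ext i
    have hu4 := hu.contDiffAt hD hxD
    have hsymm : ∀ v w, H v w = H w v := fun v w => (hu4.isSymmSndFDerivAt (by rw [minSmoothness_of_isRCLikeNormedField]; norm_num)).eq v w
    have hJ1i : J1 i = m / d * coordTrace (H (EuclideanSpace.single i 1)) := by
      let l : Sp d →L[ℝ] ℝ := LinearMap.toContinuousLinearMap
        { toFun := fun z => coordTrace (H z)
          map_add' := fun a b => by simp [coordTrace, Finset.sum_add_distrib]
          map_smul' := fun c a => by simp [coordTrace, Finset.mul_sum] }
      exact h.integral_linear_smul_apply l i
    have hJ2i := h.integral_bilinear_smul_apply H i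
    rw [← hJ2, ← hmdef] at hJ2i
    have hs : ∑ j, H (EuclideanSpace.single j 1) (EuclideanSpace.single i 1) j =
        coordTrace (H (EuclideanSpace.single i 1)) :=
      Finset.sum_congr rfl fun j _ => by rw [hsymm]
    rw [hs] at hJ2i
    rw [navier_apply lam mu hu4, PiLp.add_apply, PiLp.smul_apply, PiLp.smul_apply, PiLp.smul_apply,
      PiLp.smul_apply, hJ1i, hJ2i, ← hH, lpsC₁, lpsC₂]
    simp only [smul_eq_mul, coordTrace]
    field_simp
    ring
  rw [hN]
  have heq : ∀ (a b : ℝ) (P Q P' Q' : Sp d), a • P + b • Q - (a • P' + b • Q') =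
      a • (P - P') + b • (Q - Q') := fun a b P Q P' Q' => by module
  rw [heq]
  refine (norm_add_le _ _).trans ?_
  rw [norm_smul, norm_smul, Real.norm_eq_abs, Real.norm_eq_abs, div_mul_eq_mul_div,
    div_mul_eq_mul_div, abs_div, abs_div, abs_of_pos hm]
  calc _ ≤ |lpsC₁ d * (lam - mu)| / m * (4 * M * δ ^ 2 * m) +
        |lpsC₂ d * mu| / m * (M * δ ^ 2 * m) := by gcongr
    _ = _ := by field_simp

end Consistency

end IsRadialWeight

/-! ### Error estimate for the nonlocal Poisson model -/

theorem isQuadratic_of_le {err : ℝ → ℝ≥0∞} {P V : ℝ≥0∞} (hP : P ≠ ∞) (hV : V ≠ ∞) {c δ₁ : ℝ}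
    (hδ₁ : 0 < δ₁) (h : ∀ δ ∈ Ioc 0 δ₁, err δ ≤ P * ENNReal.ofReal (c * δ ^ 2) * V) :
    IsQuadratic err := by
  refine ⟨P.toReal * V.toReal * c, δ₁, hδ₁, fun δ hδ => (h δ hδ).trans_eq ?_⟩
  have h1 : P.toReal * V.toReal * c * δ ^ 2 = P.toReal * (V.toReal * (c * δ ^ 2)) := by ring
  rw [h1, ENNReal.ofReal_mul ENNReal.toReal_nonneg, ENNReal.ofReal_mul ENNReal.toReal_nonneg,
    ENNReal.ofReal_toReal hP, ENNReal.ofReal_toReal hV]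
  ring

theorem measurableSet_interactionDomain {d : ℕ} {Ω : Set (Sp d)} (hΩ : IsOpen Ω) {ρ : ℝ}
    (hρ : 0 < ρ) : MeasurableSet (interactionDomain Ω ρ) := by
  have : interactionDomain Ω ρ = extDomain Ω ρ \ Ω := by
    ext y
    simp only [extDomain, interactionDomain, Set.mem_sdiff, mem_union, mem_ofPred_eq]
    tauto
  rw [this]
  exact (measurableSet_extDomain Ω hρ).diff hΩ.measurableSet

theorem radialEnergy_congr {d : ℕ} {G : ℝ → ℝ≥0∞} {D : Set (Sp d)} {u v : Sp d → Sp d}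
    (h : u =ᵐ[volume.restrict D] v) : radialEnergy G D u = radialEnergy G D v := by
  refine lintegral_congr_ae ?_
  filter_upwards [h] with x hx
  refine lintegral_congr_ae ?_
  filter_upwards [h] with y hy
  rw [hx, hy]

/-- The uniform Poincaré–Korn inequality, for fields that vanish almost everywhere on a patch. -/
theorem exists_korn_poincare_ae {d : ℕ} (hd : 1 ≤ d) {Ω : Set (Sp d)} (hΩ : IsLipschitzDomain Ω)
    {a : ℝ} (ha : 1 ≤ a) {x₀ : Sp d} (hx₀ : x₀ ∈ frontier Ω) {r : ℝ} (hr : 0 < r) :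
    ∃ C : ℝ≥0∞, C ≠ ∞ ∧ ∃ δ₁ : ℝ, 0 < δ₁ ∧ ∀ δ ∈ Ioc 0 δ₁, ∀ G : ℝ → ℝ≥0∞, Measurable G →
      (∀ t, δ ≤ t → G t = 0) → ∀ u : Sp d → Sp d,
      AEStronglyMeasurable u (volume.restrict (extDomain Ω (a * δ))) →
      (∀ᵐ x ∂(volume.restrict (interactionDomain Ω (a * δ) ∩ Metric.ball x₀ r)), u x = 0) →
      radialMoment d G * (eLpNorm u 2 (volume.restrict (extDomain Ω (a * δ)))) ^ 2 ≤
        C * radialEnergy G (extDomain Ω (a * δ)) u := by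
  obtain ⟨C, hC, δ₁, hδ₁, h⟩ := exists_korn_poincare hd hΩ ha hx₀ hr
  refine ⟨C, hC, δ₁, hδ₁, fun δ hδ G hG hG0 u hu hu0 => ?_⟩
  have hρ : 0 < a * δ := mul_pos (by linarith) hδ.1
  set S := interactionDomain Ω (a * δ) ∩ Metric.ball x₀ r
  have hS : MeasurableSet S :=
    (measurableSet_interactionDomain hΩ.isOpen hρ).inter measurableSet_ball
  -- A Borel representative, cut off on the patch, vanishes there at every point, as the walking
  -- argument requires; energy and norm do not change.
  have hae : u =ᵐ[volume.restrict (extDomain Ω (a * δ))] Sᶜ.indicator (hu.mk u) := by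
    filter_upwards [hu.ae_eq_mk, ae_restrict_of_ae ((ae_restrict_iff' hS).1 hu0)] with x hx hx0
    by_cases hxS : x ∈ S
    · rw [indicator_of_notMem (notMem_compl_iff.2 hxS), hx0 hxS]
    · rw [indicator_of_mem hxS, hx]
  rw [radialEnergy_congr hae, eLpNorm_congr_ae hae, eLpNorm_two_sq]
  refine h δ hδ G hG hG0 _ (hu.stronglyMeasurable_mk.measurable.indicator hS.compl) fun x hx => ?_
  exact indicator_of_notMem (notMem_compl_iff.2 hx) _

theorem ae_restrict_extDomain {d : ℕ} {Ω Ωnloc Ωloc : Set (Sp d)} {ρ : ℝ}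
    (hpart : IsPartition Ω ρ Ωnloc Ωloc) {p : Sp d → Prop}
    (h1 : ∀ᵐ x ∂(volume.restrict Ω), p x) (h2 : ∀ᵐ x ∂(volume.restrict Ωnloc), p x)
    (h3 : ∀ᵐ x ∂(volume.restrict Ωloc), p x) :
    ∀ᵐ x ∂(volume.restrict (extDomain Ω ρ)), p x := by
  rw [extDomain, ← hpart.union_eq, ae_restrict_union_iff, ae_restrict_union_iff]
  exact ⟨h1, h2, h3⟩

theorem IsPartition.loc_subset {d : ℕ} {Ω Ωnloc Ωloc : Set (Sp d)} {ρ : ℝ}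
    (hpart : IsPartition Ω ρ Ωnloc Ωloc) : Ωloc ⊆ extDomain Ω ρ :=
  fun _ hx => Or.inr (hpart.union_eq ▸ Or.inr hx)

namespace IsPoissonKernel

variable {d : ℕ} {Ω : Set (Sp d)} {δ₀ : ℝ} {γ : ℝ → Sp d → Sp d → ℝ}

/-- A Poincaré inequality for the error turns consistency into an error bound. -/
theorem l2Error_le (hγ : IsPoissonKernel Ω δ₀ γ) (hΩ : Bornology.IsBounded Ω) {δ A : ℝ}
    (hδ : δ ∈ Ioc 0 δ₀) (hA : 0 ≤ A) {Ωnloc Ωloc : Set (Sp d)}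
    (hpart : IsPartition Ω δ Ωnloc Ωloc) {s ul un : Sp d → ℝ}
    (hul : MemLp ul 2 (volume.restrict (extDomain Ω δ)))
    (hun : MemLp un 2 (volume.restrict (extDomain Ω δ)))
    (hcons : ∀ x ∈ Ω, |nonlocalLaplacian (γ δ) ul x + s x| ≤ A)
    (heq : ∀ᵐ x ∂(volume.restrict Ω), -(nonlocalLaplacian (γ δ) un x) = s x)
    (hnloc : ∀ᵐ x ∂(volume.restrict Ωnloc), un x = ul x)
    (hloc : ∀ᵐ x ∂(volume.restrict Ωloc), un x = ul x ∨
      nonlocalFlux (γ δ) (extDomain Ω δ) un x = nonlocalFlux (γ δ) (extDomain Ω δ) ul x)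
    (hΩm : MeasurableSet Ω) {P : ℝ≥0∞}
    (hP : (eLpNorm (fun x => un x - ul x) 2 (volume.restrict (extDomain Ω δ))) ^ 2 ≤
      P * energySq (γ δ) (extDomain Ω δ) fun x => un x - ul x) :
    l2Error (extDomain Ω δ) un ul ≤
      P * ENNReal.ofReal A * volume (extDomain Ω δ) ^ (1 / 2 : ℝ) := by
  obtain ⟨B, hk⟩ := hγ.isPairKernel hΩ hδ
  have : IsFiniteMeasure (volume.restrict (extDomain Ω δ)) :=
    ⟨by simpa using (isBounded_extDomain hΩ hδ.1).measure_lt_top⟩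
  have hsub := nonlocalFlux_sub hk hun hul
  refine eLpNorm_le_of_residual_le hk (e := fun x => un x - ul x) (hun.sub hul) ?_ hP
  -- Three regions: consistency error in Ω, zero error in Ω_nloc, and in Ω_loc either zero error or
  -- zero flux of the error. Hence DtD and DtN share one estimate.
  refine ae_restrict_extDomain hpart ?_ ?_ ?_
  · filter_upwards [ae_restrict_of_ae_restrict_of_subset subset_union_left hsub, heq,
      ae_restrict_mem hΩm] with x h1 h2 hx
    have h3 := hcons x hx
    have h4 := hγ.nonlocalLaplacian_eq hδ hx un
    have h5 := hγ.nonlocalLaplacian_eq hδ hx ul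
    have h6 : 2 * nonlocalFlux (γ δ) (extDomain Ω δ) (fun y => un y - ul y) x =
        nonlocalLaplacian (γ δ) ul x + s x := by
      rw [h1, ← h2, h4, mul_sub, ← h5]; ring
    rw [h6, abs_mul, mul_comm]
    gcongr
  · filter_upwards [hnloc] with x hx
    simp [hx]
  · filter_upwards [ae_restrict_of_ae_restrict_of_subset hpart.loc_subset hsub, hloc] with x h1 h2
    rcases h2 with h2 | h2
    · simp [h2]
    · rw [h1, h2]; simp; positivity

/-- The Korn–Poincaré inequality carries the second moment of the weight on its left side. The
scaling makes each diagonal second moment at least 1/2 for small δ, so that factor can be divided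
out uniformly. -/
theorem radialMoment_ge (hd : 1 ≤ d) (hγ : IsPoissonKernel Ω δ₀ γ)
    (hΩ : Bornology.IsBounded Ω) (hne : Ω.Nonempty) :
    ∃ δ₁ : ℝ, 0 < δ₁ ∧ ∀ δ ∈ Ioc 0 δ₀, δ ≤ δ₁ → ∀ G : ℝ → ℝ≥0∞,
      (∀ x y, ENNReal.ofReal (γ δ x y) = G ‖y - x‖) →
      ENNReal.ofReal (1 / 2) ≤ radialMoment d G := by
  obtain ⟨K, hK⟩ := hγ.scaled
  obtain ⟨x, hx⟩ := hne
  refine ⟨min 1 (1 / (2 * |K| + 1)), by positivity, fun δ hδ hδ1 G hG => ?_⟩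
  obtain ⟨-, hK2, -⟩ := hK δ hδ x hx
  obtain ⟨hi, he⟩ := hγ.integral_norm_sq_row hΩ hδ hx
  have hsm : |K| * δ ^ 2 ≤ 1 / 2 := by
    have h1 : δ ≤ 1 := hδ1.trans (min_le_left _ _)
    have h2 : δ ≤ 1 / (2 * |K| + 1) := hδ1.trans (min_le_right _ _)
    rw [le_div_iff₀ (by positivity)] at h2
    have h3 := hδ.1
    have h4 : δ ^ 2 ≤ δ := by nlinarith
    nlinarith [abs_nonneg K]
  have hge : 1 / 2 ≤ ∫ y in extDomain Ω δ, ‖y - x‖ ^ 2 * γ δ x y := by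
    rw [he]
    have h1 : ∀ i : Fin d, 1 / 2 ≤ ∫ y, (y i - x i) * (y i - x i) * γ δ x y := fun i => by
      have h2 := hK2 i i
      rw [if_pos rfl] at h2
      have h3 := (abs_le.1 h2).1
      nlinarith [le_abs_self K, sq_nonneg δ]
    calc (1 / 2 : ℝ) ≤ d * (1 / 2) := by
          have : (1 : ℝ) ≤ d := by exact_mod_cast hd
          linarith
      _ = ∑ _i : Fin d, (1 / 2 : ℝ) := by simp
      _ ≤ _ := Finset.sum_le_sum fun i _ => h1 i
  calc ENNReal.ofReal (1 / 2)
      ≤ ENNReal.ofReal (∫ y in extDomain Ω δ, ‖y - x‖ ^ 2 * γ δ x y) :=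
        ENNReal.ofReal_le_ofReal hge
    _ = ∫⁻ y in extDomain Ω δ, ENNReal.ofReal (‖y - x‖ ^ 2 * γ δ x y) :=
        ofReal_integral_eq_lintegral_ofReal hi
          (ae_of_all _ fun y => mul_nonneg (sq_nonneg _) (hγ.nonneg δ hδ x y))
    _ ≤ ∫⁻ y, ENNReal.ofReal (‖y - x‖ ^ 2 * γ δ x y) := setLIntegral_le_lintegral _ _
    _ = ∫⁻ y, G ‖y - x‖ * ENNReal.ofReal (‖y - x‖ ^ 2) := by
        refine lintegral_congr fun y => ?_
        rw [← hG, mul_comm, ENNReal.ofReal_mul (hγ.nonneg δ hδ x y)]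
    _ = radialMoment d G :=
        lintegral_sub_right_eq_self (fun z => G ‖z‖ * ENNReal.ofReal (‖z‖ ^ 2)) x

/-- Radial kernels satisfy a uniform Poincaré inequality on functions vanishing on a patch. -/
theorem exists_poincare_of_radial (hd : 1 ≤ d) (hγ : IsPoissonKernel Ω δ₀ γ)
    (hΩ : IsLipschitzDomain Ω) (hrad : IsRadialKernel δ₀ γ) {x₀ : Sp d} (hx₀ : x₀ ∈ frontier Ω)
    {r : ℝ} (hr : 0 < r) :
    ∃ C : ℝ≥0∞, C ≠ ∞ ∧ ∃ δ₁ : ℝ, 0 < δ₁ ∧ ∀ δ ∈ Ioc 0 δ₀, δ ≤ δ₁ → ∀ e : Sp d → ℝ,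
      AEStronglyMeasurable e (volume.restrict (extDomain Ω δ)) →
      (∀ᵐ x ∂(volume.restrict (interactionDomain Ω δ ∩ Metric.ball x₀ r)), e x = 0) →
      (eLpNorm e 2 (volume.restrict (extDomain Ω δ))) ^ 2 ≤
        C * energySq (γ δ) (extDomain Ω δ) e := by
  obtain ⟨g, hg⟩ := hrad
  obtain ⟨C, hC, δ₁, hδ₁, h⟩ := exists_korn_poincare_ae hd hΩ le_rfl hx₀ hr
  obtain ⟨δ₂, hδ₂, h2⟩ := hγ.radialMoment_ge hd hΩ.isBounded hΩ.isConnected.nonempty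
  refine ⟨2 * C, ENNReal.mul_ne_top (by simp) hC, min δ₁ δ₂, lt_min hδ₁ hδ₂,
    fun δ hδ hδ1 e he he0 => ?_⟩
  -- The scalar case embeds in the vector case through the field e b with a fixed unit vector b.
  set b : Sp d := EuclideanSpace.single ⟨0, hd⟩ (1 : ℝ) with hb
  have hbn : ‖b‖ = 1 := by simp [hb]
  -- The profile is read off from the kernel along the line through b, because the function in
  -- `IsRadialKernel` is not assumed measurable.
  set G : ℝ → ℝ≥0∞ := fun t => ENNReal.ofReal (γ δ 0 (t • b)) with hGdef
  have hG : ∀ x y, ENNReal.ofReal (γ δ x y) = G ‖y - x‖ := fun x y => by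
    simp only [hGdef]
    rw [hg δ hδ, hg δ hδ, sub_zero, norm_smul, norm_norm, hbn, mul_one]
  have hGm : Measurable G :=
    ((hγ.measurable_row hδ 0).comp (by fun_prop : Measurable fun t : ℝ => t • b)).ennreal_ofReal
  have hG0 : ∀ t, δ ≤ t → G t = 0 := fun t ht => by
    obtain ⟨x, hx⟩ := hΩ.isConnected.nonempty
    have ht0 : 0 ≤ t := hδ.1.le.trans ht
    have h3 : ‖x + t • b - x‖ = t := by
      rw [add_sub_cancel_left, norm_smul, hbn, mul_one, Real.norm_of_nonneg ht0]
    have h4 := hG x (x + t • b)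
    rw [h3] at h4
    rw [← h4, hγ.eq_zero δ hδ x hx _ (by rw [Metric.mem_ball, dist_eq_norm, h3]; exact not_lt.2 ht),
      ENNReal.ofReal_zero]
  have key := h δ ⟨hδ.1, hδ1.trans (min_le_left _ _)⟩ G hGm hG0 (fun x => e x • b)
    (by rw [one_mul]; exact he.smul_const b)
    (by rw [one_mul]; filter_upwards [he0] with x hx; rw [hx, zero_smul])
  rw [one_mul] at key
  have hnorm : eLpNorm (fun x => e x • b) 2 (volume.restrict (extDomain Ω δ)) =
      eLpNorm e 2 (volume.restrict (extDomain Ω δ)) :=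
    eLpNorm_congr_norm_ae (ae_of_all _ fun x => by rw [norm_smul, hbn, mul_one])
  -- Since |⟪b, z⟫| ≤ ‖z‖, the projected energy of e b is at most the full scalar energy of e.
  have hen : radialEnergy G (extDomain Ω δ) (fun x => e x • b) ≤
      energySq (γ δ) (extDomain Ω δ) e := by
    refine lintegral_mono fun x => lintegral_mono fun y => ?_
    simp only
    rw [← hG, ← ENNReal.ofReal_mul (hγ.nonneg δ hδ x y), mul_comm]
    refine ENNReal.ofReal_le_ofReal (mul_le_mul_of_nonneg_right ?_ (hγ.nonneg δ hδ x y))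
    rw [← sub_smul, real_inner_smul_left, mul_pow]
    refine div_le_of_le_mul₀ (sq_nonneg _) (sq_nonneg _) ?_
    refine mul_le_mul_of_nonneg_left ?_ (sq_nonneg _)
    have := abs_real_inner_le_norm b (y - x)
    rw [hbn, one_mul] at this
    exact sq_le_sq' (abs_le.1 this).1 (abs_le.1 this).2
  rw [hnorm] at key
  have h3 := h2 δ hδ (hδ1.trans (min_le_right _ _)) G hG
  calc (eLpNorm e 2 (volume.restrict (extDomain Ω δ))) ^ 2
      = 2 * (ENNReal.ofReal (1 / 2) * (eLpNorm e 2 (volume.restrict (extDomain Ω δ))) ^ 2) := by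
        have : 2 * ENNReal.ofReal (1 / 2) = 1 := by
          rw [← ENNReal.ofReal_ofNat 2, ← ENNReal.ofReal_mul (by norm_num)]
          norm_num
        rw [← mul_assoc, this, one_mul]
    _ ≤ 2 * (radialMoment d G * (eLpNorm e 2 (volume.restrict (extDomain Ω δ))) ^ 2) := by gcongr
    _ ≤ 2 * (C * energySq (γ δ) (extDomain Ω δ) e) :=
        mul_le_mul_right (key.trans (mul_le_mul_right hen _)) _
    _ = _ := by rw [mul_assoc]

/-- Second-order convergence, given a Poincaré inequality for the error. -/
theorem isQuadratic_l2Error (hγ : IsPoissonKernel Ω δ₀ γ) (hΩ : IsLipschitzDomain Ω)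
    (hδ₀ : 0 < δ₀) {Ωnloc Ωloc : ℝ → Set (Sp d)}
    (hpart : ∀ δ ∈ Ioc 0 δ₀, IsPartition Ω δ (Ωnloc δ) (Ωloc δ)) {s ul un : ℝ → Sp d → ℝ} {M : ℝ}
    (hul : ∀ δ ∈ Ioc 0 δ₀, IsC4Bounded (extDomain Ω δ) M (ul δ))
    (hs : ∀ δ ∈ Ioc 0 δ₀, ∀ x ∈ extDomain Ω δ, -(Laplacian.laplacian (ul δ) x) = s δ x)
    (hun : ∀ δ ∈ Ioc 0 δ₀, MemLp (un δ) 2 (volume.restrict (extDomain Ω δ)))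
    (heq : ∀ δ ∈ Ioc 0 δ₀, ∀ᵐ x ∂(volume.restrict Ω), -(nonlocalLaplacian (γ δ) (un δ) x) = s δ x)
    (hnloc : ∀ δ ∈ Ioc 0 δ₀, ∀ᵐ x ∂(volume.restrict (Ωnloc δ)), un δ x = ul δ x)
    (hloc : ∀ δ ∈ Ioc 0 δ₀, ∀ᵐ x ∂(volume.restrict (Ωloc δ)), un δ x = ul δ x ∨
      nonlocalFlux (γ δ) (extDomain Ω δ) (un δ) x = nonlocalFlux (γ δ) (extDomain Ω δ) (ul δ) x)
    {P : ℝ≥0∞} (hP : P ≠ ∞) {δ₁ : ℝ} (hδ₁ : 0 < δ₁)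
    (hpoin : ∀ δ ∈ Ioc 0 δ₀, δ ≤ δ₁ →
      (eLpNorm (fun x => un δ x - ul δ x) 2 (volume.restrict (extDomain Ω δ))) ^ 2 ≤
        P * energySq (γ δ) (extDomain Ω δ) fun x => un δ x - ul δ x) :
    IsQuadratic fun δ => l2Error (extDomain Ω δ) (un δ) (ul δ) := by
  obtain ⟨C, hC⟩ := hγ.exists_consistency hΩ.isBounded
  have hV : volume (extDomain Ω δ₀) ^ (1 / 2 : ℝ) ≠ ∞ :=
    ENNReal.rpow_ne_top_of_nonneg (by norm_num)
      (isBounded_extDomain hΩ.isBounded hδ₀).measure_lt_top.ne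
  refine isQuadratic_of_le hP hV (c := C * M) (lt_min hδ₀ hδ₁) fun δ hδ => ?_
  have hδ' : δ ∈ Ioc 0 δ₀ := ⟨hδ.1, hδ.2.trans (min_le_left _ _)⟩
  have : IsFiniteMeasure (volume.restrict (extDomain Ω δ)) :=
    ⟨by simpa using (isBounded_extDomain hΩ.isBounded hδ.1).measure_lt_top⟩
  have hcons : ∀ x ∈ Ω, |nonlocalLaplacian (γ δ) (ul δ) x + s δ x| ≤ C * M * δ ^ 2 := fun x hx => by
    rw [← hs δ hδ' x (Or.inl hx), ← sub_eq_add_neg]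
    exact hC δ hδ' M (ul δ) (hul δ hδ') x hx
  obtain ⟨x, hx⟩ := hΩ.isConnected.nonempty
  refine (hγ.l2Error_le hΩ.isBounded hδ' ((abs_nonneg _).trans (hcons x hx)) (hpart δ hδ')
    ((hul δ hδ').memLp (isOpen_extDomain Ω hδ.1) 2) (hun δ hδ') hcons (heq δ hδ') (hnloc δ hδ')
    (hloc δ hδ') hΩ.isOpen.measurableSet
    (hpoin δ hδ' (hδ.2.trans (min_le_right _ _)))).trans ?_
  gcongr
  exact extDomain_mono Ω hδ'.2

/-- Functions vanishing on the whole interaction domain satisfy a uniform Poincaré inequality. -/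
theorem exists_poincare_dirichlet (hd : 1 ≤ d) (hγ : IsPoissonKernel Ω δ₀ γ)
    (hΩ : IsLipschitzDomain Ω) (hδ₀ : 0 < δ₀) :
    ∃ P : ℝ≥0∞, P ≠ ∞ ∧ ∃ δ₁ : ℝ, 0 < δ₁ ∧ ∀ δ ∈ Ioc 0 δ₀, δ ≤ δ₁ → ∀ e : Sp d → ℝ,
      MemLp e 2 (volume.restrict (extDomain Ω δ)) →
      (∀ᵐ x ∂(volume.restrict (extDomain Ω δ)), x ∈ Ω ∨ e x = 0) →
      (eLpNorm e 2 (volume.restrict (extDomain Ω δ))) ^ 2 ≤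
        P * energySq (γ δ) (extDomain Ω δ) e := by
  obtain ⟨δ₁, hδ₁, h⟩ := hγ.exists_supersolution hd hΩ.isBounded
  obtain ⟨R, hR⟩ := (isBounded_extDomain hΩ.isBounded hδ₀).exists_norm_le
  -- R bounds the largest extended domain, so R² + 1 - ‖x‖² lies between 1 and R² + 1 on all of them
  -- and the constant does not depend on δ.
  refine ⟨ENNReal.ofReal (R ^ 2 + 1), ENNReal.ofReal_ne_top, δ₁, hδ₁, fun δ hδ hδ1 e he he0 => ?_⟩
  obtain ⟨B, hk⟩ := hγ.isPairKernel hΩ.isBounded hδ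
  refine poincare_of_supersolution hk he (measurableSet_extDomain Ω hδ.1)
    (φ := fun y => R ^ 2 + 1 - ‖y‖ ^ 2) (by fun_prop) (fun x hx => ?_)
    (fun x _ => by linarith [sq_nonneg ‖x‖]) ?_
  · have h1 : ‖x‖ ^ 2 ≤ R ^ 2 := by gcongr; exact hR x (extDomain_mono Ω hδ.2 hx)
    linarith
  · filter_upwards [he0] with x hx
    rcases hx with hx | hx
    · exact Or.inr (h δ hδ hδ1 _ x hx)
    · exact Or.inl hx

/-- Bounded row mass makes the energy of every L² function finite, so the assumed Poincaré
inequality applies to the error. -/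
theorem memConstrainedSpace (hγ : IsPoissonKernel Ω δ₀ γ) (hΩ : Bornology.IsBounded Ω) {δ : ℝ}
    (hδ : δ ∈ Ioc 0 δ₀) {Λ : Set (Sp d)} {e : Sp d → ℝ}
    (he : MemLp e 2 (volume.restrict (extDomain Ω δ)))
    (he0 : ∀ᵐ x ∂(volume.restrict Λ), e x = 0) :
    MemConstrainedSpace (γ δ) (extDomain Ω δ) Λ e := by
  obtain ⟨B, hk⟩ := hγ.isPairKernel hΩ hδ
  refine ⟨⟨he, ?_⟩, he0⟩
  rw [energySq_eq_ofReal_integral_flux hk he]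
  exact ENNReal.ofReal_lt_top

end IsPoissonKernel

/-! ### Error estimate for the LPS model -/

theorem radialEnergy_eq_lpsEnergySq {d : ℕ} {g : ℝ → ℝ} {δ m : ℝ} (hg : ∀ t, 0 ≤ g t)
    (hδ : ∀ t, δ ≤ t → g t = 0) (hm : 0 < m) (D : Set (Sp d)) (u : Sp d → Sp d) :
    radialEnergy (fun t => ENNReal.ofReal (g t)) D u =
      ENNReal.ofReal m * lpsEnergySq g δ m D u := by
  rw [lpsEnergySq, ← mul_assoc, ← ENNReal.ofReal_mul hm.le, mul_one_div_cancel hm.ne',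
    ENNReal.ofReal_one, one_mul, radialEnergy]
  refine lintegral_congr fun x => ?_
  rw [inter_comm, ← Measure.restrict_restrict measurableSet_ball,
    ← lintegral_indicator measurableSet_ball]
  refine lintegral_congr fun y => ?_
  by_cases hy : y ∈ Metric.ball x δ
  · rw [indicator_of_mem hy, ← ENNReal.ofReal_mul (hg _), div_mul_eq_mul_div, mul_div_assoc]
  · rw [indicator_of_notMem hy]
    rw [Metric.mem_ball, dist_eq_norm, not_lt] at hy
    simp [hδ _ hy]

namespace IsRadialWeight

variable {d : ℕ} {g : ℝ → ℝ} {δ : ℝ}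

theorem integrable_mul_norm_sq (h : IsRadialWeight d g δ) :
    Integrable (fun z : Sp d => g ‖z‖ * ‖z‖ ^ 2) := by
  refine (h.integrable.mul_const (δ ^ 2)).mono' ?_ (ae_of_all _ fun z => ?_)
  · have := h.measurable
    exact (by fun_prop : Measurable fun z : Sp d => g ‖z‖ * ‖z‖ ^ 2).aestronglyMeasurable
  · rw [Real.norm_of_nonneg (mul_nonneg (h.nonneg _) (sq_nonneg _))]
    rcases le_or_gt δ ‖z‖ with hz | hz
    · simp [h.eq_zero _ hz]
    · have := h.nonneg ‖z‖
      gcongr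

theorem integral_mul_norm_sq (h : IsRadialWeight d g δ) :
    ∫ z : Sp d, g ‖z‖ * ‖z‖ ^ 2 = lpsMoment d g δ := by
  rw [lpsMoment]
  refine (setIntegral_eq_integral_of_forall_compl_eq_zero fun z hz => ?_).symm
  rw [Metric.mem_ball, dist_zero_right, not_lt] at hz
  simp [h.eq_zero _ hz]

theorem radialMoment_eq (h : IsRadialWeight d g δ) :
    radialMoment d (fun t => ENNReal.ofReal (g t)) = ENNReal.ofReal (lpsMoment d g δ) := by
  rw [← h.integral_mul_norm_sq, ofReal_integral_eq_lintegral_ofReal h.integrable_mul_norm_sq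
    (ae_of_all _ fun z => mul_nonneg (h.nonneg _) (sq_nonneg _)), radialMoment]
  exact lintegral_congr fun z => (ENNReal.ofReal_mul (h.nonneg _)).symm

theorem isLPSWeight (h : IsRadialWeight d g δ) (hm : 0 < lpsMoment d g δ) {D : Set (Sp d)}
    (hD : MeasurableSet D) (hDb : Bornology.IsBounded D) :
    ∃ B, IsLPSWeight g (lpsMoment d g δ) D B := by
  have hgm := h.measurable
  refine ⟨∫⁻ z : Sp d, ENNReal.ofReal (g ‖z‖), hD, ⟨by simpa using hDb.measure_lt_top⟩, ?_,
    ⟨?_, fun _ _ => h.nonneg _, fun x y => by rw [norm_sub_rev],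
      h.integrable.lintegral_lt_top.ne, ae_of_all _ fun x => ?_⟩, hm, fun x _ => ?_⟩
  · obtain ⟨R, hR⟩ := Metric.isBounded_iff.1 hDb
    exact ⟨R, fun x hx y hy => by rw [← dist_eq_norm]; exact hR hy hx⟩
  · exact hgm.comp (by fun_prop)
  · exact (setLIntegral_le_lintegral _ _).trans_eq
      (lintegral_sub_right_eq_self (fun z : Sp d => ENNReal.ofReal (g ‖z‖)) x)
  · rw [← h.integral_mul_norm_sq,
      ← integral_sub_right_eq_self (fun z : Sp d => g ‖z‖ * ‖z‖ ^ 2) x]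
    exact setIntegral_le_integral (h.integrable_mul_norm_sq.comp_sub_right x)
      (ae_of_all _ fun y => mul_nonneg (h.nonneg _) (sq_nonneg _))

end IsRadialWeight

namespace IsLPSKernel

variable {d : ℕ} {Ω : Set (Sp d)} {δ₀ : ℝ} {g : ℝ → ℝ → ℝ}

theorem isRadialWeight (hg : IsLPSKernel d δ₀ g) {δ : ℝ} (hδ : δ ∈ Ioc 0 δ₀) :
    IsRadialWeight d (g δ) δ :=
  ⟨hg.measurable δ hδ, hg.nonneg δ hδ, hg.eq_zero δ hδ, hg.integrable δ hδ⟩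

theorem lpsMoment_pos (hd : 1 ≤ d) (hg : IsLPSKernel d δ₀ g) {δ : ℝ} (hδ : δ ∈ Ioc 0 δ₀) :
    0 < lpsMoment d (g δ) δ := by
  have : Nonempty (Fin d) := ⟨⟨0, hd⟩⟩
  have : Nontrivial (Sp d) := inferInstance
  have h := hg.isRadialWeight hδ
  rw [lpsMoment, setIntegral_pos_iff_support_of_nonneg_ae
    (ae_of_all _ fun z => mul_nonneg (h.nonneg _) (sq_nonneg _))
    h.integrable_mul_norm_sq.integrableOn]
  calc (0 : ℝ≥0∞) < volume (Metric.ball (0 : Sp d) δ) := Metric.measure_ball_pos _ _ hδ.1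
    _ = volume (Metric.ball (0 : Sp d) δ \ {0}) := (measure_sdiff_null (measure_singleton _)).symm
    _ ≤ _ := by
      refine measure_mono fun z hz => ⟨?_, hz.1⟩
      have hz0 : 0 < ‖z‖ := norm_pos_iff.2 hz.2
      have h1 := hg.pos δ hδ ‖z‖ hz0.le (by simpa using hz.1)
      exact (by positivity : g δ ‖z‖ * ‖z‖ ^ 2 ≠ 0)

/-- Second-order convergence for fields that agree with the local solution on a patch. -/
theorem isQuadratic_l2Error (hd : 1 ≤ d) (hΩ : IsLipschitzDomain Ω) (hδ₀ : 0 < δ₀) {lam mu : ℝ}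
    (hmu : 0 < mu) (hlam : 0 < d * lam + 2 * mu) (hg : IsLPSKernel d δ₀ g)
    {Ωnloc Ωloc : ℝ → Set (Sp d)}
    (hpart : ∀ δ ∈ Ioc 0 δ₀, IsPartition Ω (2 * δ) (Ωnloc δ) (Ωloc δ))
    {s ul un : ℝ → Sp d → Sp d} {M : ℝ}
    (hul : ∀ δ ∈ Ioc 0 δ₀, IsC4Bounded (extDomain Ω (2 * δ)) M (ul δ))
    (hs : ∀ δ ∈ Ioc 0 δ₀, ∀ x ∈ extDomain Ω (2 * δ), -(navier lam mu (ul δ) x) = s δ x)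
    (hun : ∀ δ ∈ Ioc 0 δ₀, MemLp (un δ) 2 (volume.restrict (extDomain Ω (2 * δ))))
    (heq : ∀ δ ∈ Ioc 0 δ₀, ∀ᵐ x ∂(volume.restrict Ω),
      -(lpsOperator lam mu (g δ) (lpsMoment d (g δ) δ) (extDomain Ω (2 * δ)) (un δ) x) = s δ x)
    (hnloc : ∀ δ ∈ Ioc 0 δ₀, ∀ᵐ x ∂(volume.restrict (Ωnloc δ)), un δ x = ul δ x)
    (hloc : ∀ δ ∈ Ioc 0 δ₀, ∀ᵐ x ∂(volume.restrict (Ωloc δ)), un δ x = ul δ x ∨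
      lpsOperator lam mu (g δ) (lpsMoment d (g δ) δ) (extDomain Ω (2 * δ)) (un δ) x =
        lpsOperator lam mu (g δ) (lpsMoment d (g δ) δ) (extDomain Ω (2 * δ)) (ul δ) x)
    {x₀ : Sp d} (hx₀ : x₀ ∈ frontier Ω) {r : ℝ} (hr : 0 < r)
    (hpatch : ∀ δ ∈ Ioc 0 δ₀, ∀ᵐ x ∂(volume.restrict
      (interactionDomain Ω (2 * δ) ∩ Metric.ball x₀ r)), un δ x = ul δ x) :
    IsQuadratic fun δ => l2Error (extDomain Ω (2 * δ)) (un δ) (ul δ) := by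
  obtain ⟨P, hP, δ₁, hδ₁, hkorn⟩ := exists_korn_poincare_ae hd hΩ one_le_two hx₀ hr
  obtain ⟨c, hc, hcoer⟩ := IsLPSWeight.exists_coercive hd hmu hlam
  have hV : volume (extDomain Ω (2 * δ₀)) ^ (1 / 2 : ℝ) ≠ ∞ :=
    ENNReal.rpow_ne_top_of_nonneg (by norm_num)
      (isBounded_extDomain hΩ.isBounded (by positivity)).measure_lt_top.ne
  set K := |lpsC₁ d * (lam - mu)| * 4 + |lpsC₂ d * mu| with hK
  refine isQuadratic_of_le hP hV (c := c⁻¹ * (K * M)) (lt_min hδ₀ hδ₁) fun δ hδ => ?_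
  have hδ' : δ ∈ Ioc 0 δ₀ := ⟨hδ.1, hδ.2.trans (min_le_left _ _)⟩
  have hρ : 0 < 2 * δ := by linarith [hδ.1]
  have hDo : IsOpen (extDomain Ω (2 * δ)) := isOpen_extDomain Ω hρ
  have hw := hg.isRadialWeight hδ'
  have hm := hg.lpsMoment_pos hd hδ'
  obtain ⟨B, hB⟩ := hw.isLPSWeight hm hDo.measurableSet (isBounded_extDomain hΩ.isBounded hρ)
  have hvol : volume (extDomain Ω (2 * δ)) ≤ volume (extDomain Ω (2 * δ₀)) :=
    measure_mono (extDomain_mono Ω (by linarith [hδ'.2]))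
  set D := extDomain Ω (2 * δ) with hD
  have hsubset : Ω ⊆ D := subset_union_left
  set m := lpsMoment d (g δ) δ with hmdef
  have := hB.finite
  have hulm : MemLp (ul δ) 2 (volume.restrict D) := (hul δ hδ').memLp hDo 2
  have hunm := hun δ hδ'
  have he : MemLp (fun x => un δ x - ul δ x) 2 (volume.restrict D) := hunm.sub hulm
  have hM : 0 ≤ M := by
    obtain ⟨x, hx⟩ := hΩ.isConnected.nonempty
    exact (norm_nonneg _).trans ((hul δ hδ').norm_le (hsubset hx))
  have hsub := hB.lpsOperator_sub lam mu hunm hulm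
  have hres : ∀ᵐ x ∂(volume.restrict D), |⟪un δ x - ul δ x,
      lpsOperator lam mu (g δ) m D (fun x => un δ x - ul δ x) x⟫| ≤
        K * M * δ ^ 2 * ‖un δ x - ul δ x‖ := by
    -- The same division into three regions as in the Poisson model, with consistency in Ω relative
    -- to the Navier operator.
    refine ae_restrict_extDomain (hpart δ hδ') ?_ ?_ ?_
    · filter_upwards [ae_restrict_of_ae_restrict_of_subset hsubset hsub, heq δ hδ',
        ae_restrict_mem hΩ.isOpen.measurableSet] with x h1 h2 hx
      have h3 := hw.norm_lpsOperator_sub_navier_le hd lam mu hDo (hul δ hδ')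
        (ball_subset_extDomain hρ hx) hδ.1 hm (hB.memLp_dilatation hulm).1
      have h4 := hs δ hδ' x (hsubset hx)
      have h5 : ‖lpsOperator lam mu (g δ) m D (fun x => un δ x - ul δ x) x‖ ≤ K * M * δ ^ 2 := by
        rw [h1, norm_sub_rev, neg_eq_iff_eq_neg.1 h2, ← h4, neg_neg]
        exact h3
      refine (abs_real_inner_le_norm _ _).trans ?_
      rw [mul_comm]
      gcongr
    · filter_upwards [hnloc δ hδ'] with x hx
      simp [hx]
    · filter_upwards [ae_restrict_of_ae_restrict_of_subset (hpart δ hδ').loc_subset hsub,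
        hloc δ hδ'] with x h1 h2
      rcases h2 with h2 | h2
      · simp [h2]
      · rw [h1, h2, sub_self, inner_zero_right, abs_zero]
        positivity
  have hpoin : (eLpNorm (fun x => un δ x - ul δ x) 2 (volume.restrict D)) ^ 2 ≤
      P * lpsEnergySq (g δ) δ m D fun x => un δ x - ul δ x := by
    have h1 := hkorn δ ⟨hδ.1, hδ.2.trans (min_le_right _ _)⟩
      (fun t => ENNReal.ofReal (g δ t)) hw.measurable.ennreal_ofReal
      (fun t ht => by rw [hw.eq_zero t ht, ENNReal.ofReal_zero]) _ he.1 (by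
        filter_upwards [hpatch δ hδ'] with x hx
        rw [hx, sub_self])
    rw [hw.radialMoment_eq, radialEnergy_eq_lpsEnergySq hw.nonneg hw.eq_zero hm, ← mul_assoc,
      mul_comm P, mul_assoc] at h1
    -- The second moment of the weight is m(δ), and so is the factor between the unnormalized and
    -- the LPS energy. They cancel, so no lower bound of m(δ) in terms of δ is needed.
    exact (ENNReal.mul_le_mul_iff_right (by simpa using hm) ENNReal.ofReal_ne_top).1 h1
  refine (hB.eLpNorm_le_of_residual_le hc hw.eq_zero he (hcoer _ _ _ _ hB _ he) hres hpoin).trans ?_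
  rw [← mul_assoc c⁻¹]
  gcongr

end IsLPSKernel

end NonlocalBC

end

/-! ### The five cases of the theorem. -/

theorem mainTheorem3 {d : ℕ} (hd : 1 ≤ d) (Ω : Set (NonlocalBC.Sp d))
    (hΩ : NonlocalBC.IsLipschitzDomain Ω) (δ₀ : ℝ) (hδ₀ : 0 < δ₀) :
    -- the nonlocal Poisson model (interaction domain of thickness `δ`)
    (∀ γ : ℝ → NonlocalBC.Sp d → NonlocalBC.Sp d → ℝ, NonlocalBC.IsPoissonKernel Ω δ₀ γ →
      ∀ Ωnloc Ωloc : ℝ → Set (NonlocalBC.Sp d),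
      (∀ δ ∈ Ioc 0 δ₀, NonlocalBC.IsPartition Ω δ (Ωnloc δ) (Ωloc δ)) →
      ∀ s w v ul : ℝ → NonlocalBC.Sp d → ℝ,
      (∃ M : ℝ, ∀ δ ∈ Ioc 0 δ₀, NonlocalBC.IsC4Bounded (NonlocalBC.extDomain Ω δ) M (ul δ)) →
      (∀ δ ∈ Ioc 0 δ₀, NonlocalBC.IsLocalPoissonSolution (NonlocalBC.extDomain Ω δ)
        (Ωnloc δ) (Ωloc δ) (s δ) (w δ) (v δ) (ul δ)) →
      (∀ δ ∈ Ioc 0 δ₀, ∀ᵐ x ∂(volume.restrict (Ωnloc δ)), v δ x = ul δ x) →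
      ∀ un : ℝ → NonlocalBC.Sp d → ℝ,
        -- Dirichlet-to-Dirichlet
        ((∀ δ ∈ Ioc 0 δ₀, NonlocalBC.IsPoissonDtD (γ δ) Ω (NonlocalBC.extDomain Ω δ)
            (Ωnloc δ) (Ωloc δ) (s δ) (ul δ) (v δ) (un δ)) →
          NonlocalBC.IsQuadratic fun δ =>
            NonlocalBC.l2Error (NonlocalBC.extDomain Ω δ) (un δ) (ul δ)) ∧
        -- Dirichlet-to-Neumann, all kernels of the class that satisfy a Poincaré inequality
        (NonlocalBC.SatisfiesPoincare Ω δ₀ γ Ωnloc →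
          (∀ δ ∈ Ioc 0 δ₀, NonlocalBC.IsPoissonDtN (γ δ) Ω (NonlocalBC.extDomain Ω δ)
            (Ωnloc δ) (Ωloc δ) (s δ) (ul δ) (v δ) (un δ)) →
          NonlocalBC.IsQuadratic fun δ =>
            NonlocalBC.l2Error (NonlocalBC.extDomain Ω δ) (un δ) (ul δ)) ∧
        -- Dirichlet-to-Neumann, radial kernels, no Poincaré inequality assumed
        (NonlocalBC.IsRadialKernel δ₀ γ →
          NonlocalBC.ContainsPatch Ω δ₀ (fun δ => δ) Ωnloc →
          (∀ δ ∈ Ioc 0 δ₀, NonlocalBC.IsPoissonDtN (γ δ) Ω (NonlocalBC.extDomain Ω δ)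
            (Ωnloc δ) (Ωloc δ) (s δ) (ul δ) (v δ) (un δ)) →
          NonlocalBC.IsQuadratic fun δ =>
            NonlocalBC.l2Error (NonlocalBC.extDomain Ω δ) (un δ) (ul δ))) ∧
    -- the LPS model (interaction domain of thickness `2 * δ`)
    (∀ lam mu : ℝ, 0 < mu → 0 < d * lam + 2 * mu →
      ∀ g : ℝ → ℝ → ℝ, NonlocalBC.IsLPSKernel d δ₀ g →
      ∀ Ωnloc Ωloc : ℝ → Set (NonlocalBC.Sp d),
      (∀ δ ∈ Ioc 0 δ₀, NonlocalBC.IsPartition Ω (2 * δ) (Ωnloc δ) (Ωloc δ)) →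
      ∀ s w v ul : ℝ → NonlocalBC.Sp d → NonlocalBC.Sp d,
      (∃ M : ℝ, ∀ δ ∈ Ioc 0 δ₀,
        NonlocalBC.IsC4Bounded (NonlocalBC.extDomain Ω (2 * δ)) M (ul δ)) →
      (∀ δ ∈ Ioc 0 δ₀, NonlocalBC.IsLocalNavierSolution lam mu (NonlocalBC.extDomain Ω (2 * δ))
        (Ωnloc δ) (Ωloc δ) (s δ) (w δ) (v δ) (ul δ)) →
      (∀ δ ∈ Ioc 0 δ₀, ∀ᵐ x ∂(volume.restrict (Ωnloc δ)), v δ x = ul δ x) →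
      ∀ un : ℝ → NonlocalBC.Sp d → NonlocalBC.Sp d,
        -- Dirichlet-to-Dirichlet
        ((∀ δ ∈ Ioc 0 δ₀, NonlocalBC.IsLPSDtD lam mu (g δ) δ Ω (NonlocalBC.extDomain Ω (2 * δ))
            (Ωnloc δ) (Ωloc δ) (s δ) (ul δ) (v δ) (un δ)) →
          NonlocalBC.IsQuadratic fun δ =>
            NonlocalBC.l2Error (NonlocalBC.extDomain Ω (2 * δ)) (un δ) (ul δ)) ∧
        -- Dirichlet-to-Neumann
        (NonlocalBC.ContainsPatch Ω δ₀ (fun δ => 2 * δ) Ωnloc →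
          (∀ δ ∈ Ioc 0 δ₀, NonlocalBC.IsLPSDtN lam mu (g δ) δ Ω (NonlocalBC.extDomain Ω (2 * δ))
            (Ωnloc δ) (Ωloc δ) (s δ) (ul δ) (v δ) (un δ)) →
          NonlocalBC.IsQuadratic fun δ =>
            NonlocalBC.l2Error (NonlocalBC.extDomain Ω (2 * δ)) (un δ) (ul δ))) := by
  refine ⟨fun γ hγ Ωnloc Ωloc hpart s w v ul ⟨M, hul⟩ hsol hv un => ⟨fun h => ?_,
    fun ⟨C, hC⟩ h => ?_, fun hrad ⟨x₀, hx₀, r, hr, hpatch⟩ h => ?_⟩,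
    fun lam mu hmu hlam g hg Ωnloc Ωloc hpart s w v ul ⟨M, hul⟩ hsol hv un =>
      ⟨fun h => ?_, fun ⟨x₀, hx₀, r, hr, hpatch⟩ h => ?_⟩⟩
  · have hnloc : ∀ δ ∈ Ioc 0 δ₀, ∀ᵐ x ∂(volume.restrict (Ωnloc δ)), un δ x = ul δ x :=
      fun δ hδ => by filter_upwards [(h δ hδ).nloc, hv δ hδ] with x h1 h2 using h1.trans h2
    -- In DtD the error vanishes on the whole interaction domain, so the supersolution argument
    -- applies and the kernels need not be radial.
    obtain ⟨P, hP, δ₁, hδ₁, hpoin⟩ := hγ.exists_poincare_dirichlet hd hΩ hδ₀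
    refine hγ.isQuadratic_l2Error hΩ hδ₀ hpart hul (fun δ hδ => (hsol δ hδ).equation)
      (fun δ hδ => (h δ hδ).mem.1) (fun δ hδ => (h δ hδ).equation) hnloc
      (fun δ hδ => (h δ hδ).loc.mono fun x hx => Or.inl hx) hP hδ₁ fun δ hδ hδ1 => ?_
    have : IsFiniteMeasure (volume.restrict (NonlocalBC.extDomain Ω δ)) :=
      ⟨by simpa using (NonlocalBC.isBounded_extDomain hΩ.isBounded hδ.1).measure_lt_top⟩
    refine hpoin δ hδ hδ1 _
      ((h δ hδ).mem.1.sub ((hul δ hδ).memLp (NonlocalBC.isOpen_extDomain Ω hδ.1) 2)) ?_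
    refine NonlocalBC.ae_restrict_extDomain (hpart δ hδ) ?_ ?_ ?_
    · filter_upwards [ae_restrict_mem hΩ.isOpen.measurableSet] with x hx using Or.inl hx
    · filter_upwards [hnloc δ hδ] with x hx using Or.inr (sub_eq_zero.2 hx)
    · filter_upwards [(h δ hδ).loc] with x hx using Or.inr (sub_eq_zero.2 hx)
  · have hnloc : ∀ δ ∈ Ioc 0 δ₀, ∀ᵐ x ∂(volume.restrict (Ωnloc δ)), un δ x = ul δ x :=
      fun δ hδ => by filter_upwards [(h δ hδ).nloc, hv δ hδ] with x h1 h2 using h1.trans h2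
    refine hγ.isQuadratic_l2Error hΩ hδ₀ hpart hul (fun δ hδ => (hsol δ hδ).equation)
      (fun δ hδ => (h δ hδ).mem.1) (fun δ hδ => (h δ hδ).equation) hnloc
      (fun δ hδ => (h δ hδ).loc.mono fun x hx => Or.inr (neg_injective hx))
      -- The assumed inequality holds for every δ up to δ₀, so the threshold is irrelevant; 1 is
      -- arbitrary.
      (P := ENNReal.ofReal (C ^ 2)) ENNReal.ofReal_ne_top one_pos fun δ hδ _ => ?_
    have : IsFiniteMeasure (volume.restrict (NonlocalBC.extDomain Ω δ)) :=
      ⟨by simpa using (NonlocalBC.isBounded_extDomain hΩ.isBounded hδ.1).measure_lt_top⟩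
    refine hC δ hδ _ (hγ.memConstrainedSpace hΩ.isBounded hδ
      ((h δ hδ).mem.1.sub ((hul δ hδ).memLp (NonlocalBC.isOpen_extDomain Ω hδ.1) 2)) ?_)
    filter_upwards [hnloc δ hδ] with x hx using sub_eq_zero.2 hx
  · have hnloc : ∀ δ ∈ Ioc 0 δ₀, ∀ᵐ x ∂(volume.restrict (Ωnloc δ)), un δ x = ul δ x :=
      fun δ hδ => by filter_upwards [(h δ hδ).nloc, hv δ hδ] with x h1 h2 using h1.trans h2
    obtain ⟨P, hP, δ₁, hδ₁, hpoin⟩ := hγ.exists_poincare_of_radial hd hΩ hrad hx₀ hr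
    refine hγ.isQuadratic_l2Error hΩ hδ₀ hpart hul (fun δ hδ => (hsol δ hδ).equation)
      (fun δ hδ => (h δ hδ).mem.1) (fun δ hδ => (h δ hδ).equation) hnloc
      (fun δ hδ => (h δ hδ).loc.mono fun x hx => Or.inr (neg_injective hx))
      hP hδ₁ fun δ hδ hδ1 => ?_
    refine hpoin δ hδ hδ1 _ ((h δ hδ).mem.1.1.sub
      ((hul δ hδ).aestronglyMeasurable (NonlocalBC.isOpen_extDomain Ω hδ.1))) ?_
    filter_upwards [ae_restrict_of_ae_restrict_of_subset (hpatch δ hδ) (hnloc δ hδ)] with x hx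
      using sub_eq_zero.2 hx
  · have hnloc : ∀ δ ∈ Ioc 0 δ₀, ∀ᵐ x ∂(volume.restrict (Ωnloc δ)), un δ x = ul δ x :=
      fun δ hδ => by filter_upwards [(h δ hδ).nloc, hv δ hδ] with x h1 h2 using h1.trans h2
    -- In DtD the error vanishes on the whole interaction domain, so any boundary point and any
    -- radius, here 1, serve as the patch.
    obtain ⟨x₀, hx₀⟩ := NonlocalBC.nonempty_frontier hd hΩ
    refine hg.isQuadratic_l2Error hd hΩ hδ₀ hmu hlam hpart hul
      (fun δ hδ => (hsol δ hδ).equation) (fun δ hδ => (h δ hδ).mem.1)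
      (fun δ hδ => (h δ hδ).equation) hnloc
      (fun δ hδ => (h δ hδ).loc.mono fun x hx => Or.inl hx) hx₀ one_pos fun δ hδ => ?_
    refine ae_restrict_of_ae_restrict_of_subset inter_subset_left ?_
    rw [← (hpart δ hδ).union_eq, ae_restrict_union_iff]
    exact ⟨hnloc δ hδ, (h δ hδ).loc⟩
  · have hnloc : ∀ δ ∈ Ioc 0 δ₀, ∀ᵐ x ∂(volume.restrict (Ωnloc δ)), un δ x = ul δ x :=
      fun δ hδ => by filter_upwards [(h δ hδ).nloc, hv δ hδ] with x h1 h2 using h1.trans h2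
    exact hg.isQuadratic_l2Error hd hΩ hδ₀ hmu hlam hpart hul
      (fun δ hδ => (hsol δ hδ).equation) (fun δ hδ => (h δ hδ).mem.1)
      (fun δ hδ => (h δ hδ).equation) hnloc
      (fun δ hδ => (h δ hδ).loc.mono fun x hx => Or.inr (neg_injective hx)) hx₀ hr
      fun δ hδ => ae_restrict_of_ae_restrict_of_subset (hpatch δ hδ) (hnloc δ hδ)
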